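/- **Setting.** A difference operator is a formal series $\sum_{k\in\mathbb Z}a_k\Lambda^k$ with $a_k:\mathbb Z\to\mathbb C$; products are given by $f\Lambda^i\cdot g\Lambda^j=f(n)\,g(n+i)\,\Lambda^{i+j}$ whenever the sums involved are finite, and $[A,B]=AB-BA$. Write $A_{\ge m}$, $A_{<m}$, etc. for truncations in the degree $k$, $\operatorname{Res}A=a_0$ and $\langle A\rangle=\sum_n(\operatorname{Res}A)(n)$. Let $\mathcal E^-$ (resp. $\mathcal E^+$) be the operators whose degrees are bounded above (resp. below) and whose coefficients $a_k$ all have finite support, and put $\langle(X,\hat X),(Y,\hat Y)\rangle=\langle XY\rangle+\langle\hat X\hat Y\rangle$. For integers $N,M\ge1$ let $$U_{N,M}=(\mathcal E^-)_{<N}\times(\mathcal E^+)_{\ge-M},\qquad U^*_{N,M}=(\mathcal E^-)_{>-N}\times(\mathcal E^+)_{\le M};$$ these are the tangent and cotangent spaces of the coset $(\Lambda^N,0)+U_{N,M}$ at each of its points $\mathbf A=(A,\hat A)$. A functional is a function $F$ on the coset that is analytic on finite-dimensional affine subspaces and has at each point $\mathbf A$ a gradient $\delta F/\delta\mathbf A\in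 U^*_{N,M}$, i.e. $\frac{d}{dt}F(\mathbf A+tV)|_{t=0}=\langle\delta F/\delta\mathbf A,V\rangle$ for all $V\in U_{N,M}$. A Poisson structure is a family of linear maps $\mathcal P_{\mathbf A}:U^*_{N,M}\to U_{N,M}$ such that $\{F,H\}(\mathbf A)=\langle\delta F/\delta\mathbf A,\mathcal P_{\mathbf A}(\delta H/\delta\mathbf A)\rangle$ is a Poisson bracket on functionals (closed, bilinear, skew-symmetric, Leibniz, Jacobi); two are compatible if all their linear combinations are Poisson. Put $$\begin{aligned}P_1(X,\hat X)=\big(&[-X_{<0}-\hat X_{<0},A]+[X,A]_{\le0}+[\hat X,\hat A]_{\le0},\\&[X_{\ge0}+\hat X_{\ge0},\hat A]-[X,A]_{>0}-[\hat X,\hat A]_{>0}\big),\end{aligned}$$ and, with $S=AX+XA$, $\hat S=\hat A\hat X+\hat X\hat A$, $C=[X,A]+[\hat X,\hat A]$ (truncations of sums being taken termwise), $$P_2(X,\hat X)=\tfrac12\big([-S_{<0}-\hat S_{<0},A]+A\,C_{\le0}+C_{\le0}A,\ [S_{\ge0}+\hat S_{\ge0},\hat A]-\hat A\,C_{>0}-C_{>0}\hat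 A\big).$$ **Lemma.** Let $N,M\ge 1$. 1. On the coset $(\Lambda^N,0)+U_{N,M}$ the formulas $$P_1^{\mathrm{red}}(X,\hat X)=P_1(X,\hat X),\qquad P_2^{\mathrm{red}}(X,\hat X)=P_2(X,\hat X)-([f,A],[f,\hat A]),$$ $$f=\tfrac12(1+\Lambda^N)(1-\Lambda^N)^{-1}\operatorname{Res}\big([X,A]+[\hat X,\hat A]\big)$$ define two compatible Poisson structures. Here $(1-\Lambda^N)^{-1}$ is the mean of its two expansions, $(1-\Lambda^N)^{-1}=\tfrac12\big(\sum_{k\ge0}\Lambda^{kN}-\sum_{k\ge1}\Lambda^{-kN}\big)$, so that $(1+\Lambda^N)(1-\Lambda^N)^{-1}$ is skew-adjoint. 2. Let $P_2^{+}$ be given by the same formula as $P_2^{\mathrm{red}}$, but with the one-sided expansion $(1-\Lambda^N)^{-1}=1+\Lambda^N+\Lambda^{2N}+\cdots$. Then $\langle\mathbf X,P_2^{\mathrm{red}}\mathbf Y\rangle=\tfrac12\big(\langle\mathbf X,P_2^{+}\mathbf Y\rangle-\langle\mathbf Y,P_2^{+}\mathbf X\rangle\big)$ for all $\mathbf X,\mathbf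 Y\in U^*_{N,M}$ at every point of the coset. If $N=1$, then $P_2^{+}=P_2^{\mathrm{red}}$. For every $N$, $P_1^{\mathrm{red}}$ and $P_2^{+}$ map $U^*_{N,M}$ linearly to $U_{N,M}$ at every point and define compatible Poisson brackets on the functionals $F$ with $\langle\delta F/\delta\mathbf A,([p,A],[p,\hat A])\rangle=0$ for all $\mathbf A$ in the coset and all $N$-periodic $p:\mathbb Z\to\mathbb C$. 3. These structures come from the $R$-matrix brackets by Dirac reduction. Let $R(X,\hat X)=(X_{\ge0}-X_{<0}-2\hat X_{<0},\ \hat X_{\ge0}-\hat X_{<0}+2X_{\ge0})$. Then for $\mathbf X,\mathbf Y\in\mathcal E^-\times\mathcal E^+$ and every pair $\mathbf A=(A,\hat A)$ with $A$ bounded above and $\hat A$ bounded below in degree (arbitrary coefficients), $$\langle\mathbf X,P_1\mathbf Y\rangle=\tfrac12\big(\langle[\mathbf A,\mathbf X],R(\mathbf Y)\rangle-\langle[\mathbf A,\mathbf Y],R(\mathbf X)\rangle\big),$$ $$\langle\mathbf X,P_2\mathbf Y\rangle=\tfrac14\big(\langle[\mathbf A,\mathbf X],R(\mathbf A\mathbf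 Y+\mathbf Y\mathbf A)\rangle-\langle[\mathbf A,\mathbf Y],R(\mathbf A\mathbf X+\mathbf X\mathbf A)\rangle\big).$$ Let $\pi_U$ be the truncation of a pair to degrees $<N$ in the first and $\ge-M$ in the second component, and $\pi_V=1-\pi_U$. For each $(P,P^{\mathrm{red}})\in\{(P_1,P_1^{\mathrm{red}}),(P_2,P_2^{\mathrm{red}}),(P_2,P_2^{+})\}$, each point of the coset and each $\mathbf X\in U^*_{N,M}$ there is a pair $W$, of degrees $\le-N$ in the first and $>M$ in the second component (arbitrary coefficients), with $\pi_VP(W)=-\pi_VP(\mathbf X)$ and $P^{\mathrm{red}}(\mathbf X)=\pi_UP(\mathbf X)+\pi_UP(W)$. -/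

import Mathlib

/-- Formal difference operators `∑ₖ aₖ Λᵏ` with `aₖ : ℤ → ℂ`; `A k n` is the value at the site `n`
of the coefficient of `Λᵏ`. No restriction is put here on the degrees or on the supports. -/
def DiffOp : Type := ℤ → ℤ → ℂ

namespace DiffOp

noncomputable instance : AddCommGroup DiffOp := inferInstanceAs (AddCommGroup (ℤ → ℤ → ℂ))

noncomputable instance : Module ℂ DiffOp := inferInstanceAs (Module ℂ (ℤ → ℤ → ℂ))

/-- The product determined by `f Λⁱ · g Λʲ = f(n) g(n + i) Λⁱ⁺ʲ`. The sum over `i` is finite when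
both factors are bounded above, when both are bounded below, and when one of them has only
finitely many nonzero coefficients; it is only used in these cases. -/
noncomputable instance : Mul DiffOp :=
  ⟨fun A B k n => ∑ᶠ i : ℤ, A i n * B (k - i) (n + i)⟩

/-- The commutator. -/
noncomputable instance : Bracket DiffOp DiffOp := ⟨fun A B => A * B - B * A⟩

/-- `A_{≥ m}`; in particular `A_{> m}` is `A.ge (m + 1)`. -/
def ge (A : DiffOp) (m : ℤ) : DiffOp := fun k => if m ≤ k then A k else 0

/-- `A_{< m}`; in particular `A_{≤ m}` is `A.lt (m + 1)`. -/
def lt (A : DiffOp) (m : ℤ) : DiffOp := fun k => if k < m then A k else 0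

/-- `Res (∑ aₖ Λᵏ) = a₀`. -/
def res (A : DiffOp) : ℤ → ℂ := A 0

/-- `⟨A⟩ = ∑ₙ (Res A)(n)`, for operators whose residue has finite support. -/
noncomputable def trace (A : DiffOp) : ℂ := ∑ᶠ n : ℤ, A.res n

/-- The operator `g Λ⁰` of multiplication by the function `g`. -/
def diag (g : ℤ → ℂ) : DiffOp := fun k => if k = 0 then g else 0

/-- The operator `Λᴺ`. -/
def shiftPow (N : ℕ) : DiffOp := fun k _ => if k = N then 1 else 0

/-- Operators all of whose coefficients have finite support. -/
noncomputable def finCoeff : Submodule ℂ DiffOp where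
  carrier := {A | ∀ k, (Function.support (A k)).Finite}
  zero_mem' := fun k => by
    have h : Function.support ((0 : DiffOp) k) = ∅ := Function.support_zero
    rw [h]; exact Set.finite_empty
  add_mem' := fun {A B} hA hB k =>
    ((hA k).union (hB k)).subset (Function.support_add (A k) (B k))
  smul_mem' := fun c A hA k =>
    (hA k).subset (Function.support_const_smul_subset c (A k))

/-- Operators of the form `∑_{k < m} aₖ Λᵏ`. -/
def degLT (m : ℤ) : Submodule ℂ DiffOp where
  carrier := {A | ∀ k, m ≤ k → A k = 0}
  zero_mem' := fun _ _ => rfl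
  add_mem' := fun {A B} hA hB k hk => by
    change A k + B k = 0
    rw [hA k hk, hB k hk, add_zero]
  smul_mem' := fun c A hA k hk => by
    change c • A k = 0
    rw [hA k hk, smul_zero]

/-- Operators of the form `∑_{k ≥ m} aₖ Λᵏ`. -/
def degGE (m : ℤ) : Submodule ℂ DiffOp where
  carrier := {A | ∀ k, k < m → A k = 0}
  zero_mem' := fun _ _ => rfl
  add_mem' := fun {A B} hA hB k hk => by
    change A k + B k = 0
    rw [hA k hk, hB k hk, add_zero]
  smul_mem' := fun c A hA k hk => by
    change c • A k = 0
    rw [hA k hk, smul_zero]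

/-- Operators whose degrees are bounded above (arbitrary coefficients). -/
noncomputable def bddAboveOp : Submodule ℂ DiffOp where
  carrier := {A | ∃ m, A ∈ degLT m}
  zero_mem' := ⟨0, (degLT 0).zero_mem⟩
  add_mem' := fun ⟨p, hp⟩ ⟨q, hq⟩ => ⟨max p q, (degLT _).add_mem
    (fun k hk => hp k ((le_max_left p q).trans hk))
    (fun k hk => hq k ((le_max_right p q).trans hk))⟩
  smul_mem' := fun c _ ⟨p, hp⟩ => ⟨p, (degLT p).smul_mem c hp⟩

/-- Operators whose degrees are bounded below (arbitrary coefficients). -/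
noncomputable def bddBelowOp : Submodule ℂ DiffOp where
  carrier := {A | ∃ m, A ∈ degGE m}
  zero_mem' := ⟨0, (degGE 0).zero_mem⟩
  add_mem' := fun ⟨p, hp⟩ ⟨q, hq⟩ => ⟨min p q, (degGE _).add_mem
    (fun k hk => hp k (hk.trans_le (min_le_left p q)))
    (fun k hk => hq k (hk.trans_le (min_le_right p q)))⟩
  smul_mem' := fun c _ ⟨p, hp⟩ => ⟨p, (degGE p).smul_mem c hp⟩

/-- `ℰ⁻`: bounded above, coefficients of finite support. -/
noncomputable def minusAlg : Submodule ℂ DiffOp := finCoeff ⊓ bddAboveOp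

/-- `ℰ⁺`: bounded below, coefficients of finite support. -/
noncomputable def plusAlg : Submodule ℂ DiffOp := finCoeff ⊓ bddBelowOp

end DiffOp

namespace Toda

open DiffOp

/-- Pairs `(A, Â)` of formal difference operators. -/
abbrev Pair : Type := DiffOp × DiffOp

/-- The coupled algebra `ℰ⁻ × ℰ⁺`. -/
noncomputable def coupled : Submodule ℂ Pair := minusAlg.prod plusAlg

/-- The pairs (bounded above, bounded below) with arbitrary coefficients. This contains both the
coupled algebra `ℰ⁻ × ℰ⁺` and the cosets of `(Λᴺ, 0)`. -/
noncomputable def coupledExt : Submodule ℂ Pair := bddAboveOp.prod bddBelowOp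

/-- `⟨(X, X̂), (Y, Ŷ)⟩ = ⟨X Y⟩ + ⟨X̂ Ŷ⟩`. -/
noncomputable def pairing (X Y : Pair) : ℂ := (X.1 * Y.1).trace + (X.2 * Y.2).trace

/-- `U_{N,M} = (ℰ⁻)_{<N} × (ℰ⁺)_{≥-M}`, the tangent space at every point of the coset. -/
noncomputable def tangent (N M : ℕ) : Submodule ℂ Pair :=
  (minusAlg ⊓ degLT N).prod (plusAlg ⊓ degGE (-M))

/-- `U*_{N,M} = (ℰ⁻)_{>-N} × (ℰ⁺)_{≤M}`, the cotangent space at every point of the coset. -/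
noncomputable def cotangent (N M : ℕ) : Submodule ℂ Pair :=
  (minusAlg ⊓ degGE (-N + 1)).prod (plusAlg ⊓ degLT (M + 1))

/-- The complementary covectors, of degrees `≤ -N` and `> M`, with arbitrary coefficients. -/
noncomputable def cotangentCompl (N M : ℕ) : Submodule ℂ Pair :=
  (bddAboveOp ⊓ degLT (-N + 1)).prod (bddBelowOp ⊓ degGE (M + 1))

/-- The projection onto the tangent directions, of degrees `< N` and `≥ -M`. -/
noncomputable def projU (N M : ℕ) (V : Pair) : Pair := (V.1.lt N, V.2.ge (-M))

/-- The projection onto the transversal directions, of degrees `≥ N` and `< -M`. -/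
noncomputable def projV (N M : ℕ) (V : Pair) : Pair := (V.1.ge N, V.2.lt (-M))

/-- The coset `(Λᴺ, 0) + U_{N,M}`. -/
noncomputable def coset (N M : ℕ) : Set Pair := {A | A - (shiftPow N, 0) ∈ tangent N M}

/-- The point `(Λᴺ, 0) + u` of the coset; `u ∈ U_{N,M}` is its global linear coordinate. -/
noncomputable def point {N M : ℕ} (u : tangent N M) : Pair := (shiftPow N, 0) + (u : Pair)

/-! ### The `R`-matrix brackets -/

/-- The `R`-matrix
`R(X, X̂) = (X_{≥0} - X_{<0} - 2 X̂_{<0}, X̂_{≥0} - X̂_{<0} + 2 X_{≥0})`. -/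
noncomputable def Rmat (X : Pair) : Pair :=
  (X.1.ge 0 - X.1.lt 0 - (2 : ℂ) • X.2.lt 0, X.2.ge 0 - X.2.lt 0 + (2 : ℂ) • X.1.ge 0)

/-- The componentwise commutator of pairs. -/
noncomputable def pairComm (A X : Pair) : Pair := (⁅A.1, X.1⁆, ⁅A.2, X.2⁆)

/-- The componentwise anticommutator of pairs. -/
noncomputable def pairAnti (A X : Pair) : Pair :=
  (A.1 * X.1 + X.1 * A.1, A.2 * X.2 + X.2 * A.2)

/-- The linear `R`-matrix bracket at `A` of functionals with gradients `X` and `Y` at `A`. -/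
noncomputable def linearRBracket (A X Y : Pair) : ℂ :=
  (1 / 2 : ℂ) * (pairing (pairComm A X) (Rmat Y) - pairing (pairComm A Y) (Rmat X))

/-- The quadratic `R`-matrix bracket at `A` of functionals with gradients `X` and `Y` at `A`. -/
noncomputable def quadraticRBracket (A X Y : Pair) : ℂ :=
  (1 / 4 : ℂ) * (pairing (pairComm A X) (Rmat (pairAnti A Y))
    - pairing (pairComm A Y) (Rmat (pairAnti A X)))

/-! ### The tensors -/

/-- `P₁` at the point `A`, applied to the covector `X`. -/
noncomputable def P1 (A X : Pair) : Pair :=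
  (⁅-X.1.lt 0 - X.2.lt 0, A.1⁆ + (⁅X.1, A.1⁆ : DiffOp).lt 1 + (⁅X.2, A.2⁆ : DiffOp).lt 1,
   ⁅X.1.ge 0 + X.2.ge 0, A.2⁆ - (⁅X.1, A.1⁆ : DiffOp).ge 1 - (⁅X.2, A.2⁆ : DiffOp).ge 1)

/-- `P₂` at the point `A`, applied to the covector `X`. -/
noncomputable def P2 (A X : Pair) : Pair :=
  ((1 / 2 : ℂ) •
    (⁅-(A.1 * X.1 + X.1 * A.1).lt 0 - (A.2 * X.2 + X.2 * A.2).lt 0, A.1⁆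
      + A.1 * ((⁅X.1, A.1⁆ : DiffOp).lt 1 + (⁅X.2, A.2⁆ : DiffOp).lt 1)
      + ((⁅X.1, A.1⁆ : DiffOp).lt 1 + (⁅X.2, A.2⁆ : DiffOp).lt 1) * A.1),
   (1 / 2 : ℂ) •
    (⁅(A.1 * X.1 + X.1 * A.1).ge 0 + (A.2 * X.2 + X.2 * A.2).ge 0, A.2⁆
      - A.2 * ((⁅X.1, A.1⁆ : DiffOp).ge 1 + (⁅X.2, A.2⁆ : DiffOp).ge 1)
      - ((⁅X.1, A.1⁆ : DiffOp).ge 1 + (⁅X.2, A.2⁆ : DiffOp).ge 1) * A.2))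

/-- `(1 - Λᴺ)⁻¹` expanded at `Λ = 0`: `1 + Λᴺ + Λ²ᴺ + ⋯`. -/
noncomputable def invForward (N : ℕ) (g : ℤ → ℂ) : ℤ → ℂ :=
  fun n => ∑ᶠ k : ℕ, g (n + k * N)

/-- `(1 - Λᴺ)⁻¹` expanded at `Λ = ∞`: `-Λ⁻ᴺ - Λ⁻²ᴺ - ⋯`. -/
noncomputable def invBackward (N : ℕ) (g : ℤ → ℂ) : ℤ → ℂ :=
  fun n => -∑ᶠ k : ℕ, g (n - (k + 1) * N)

/-- `(1 - Λᴺ)⁻¹` as the mean of its two expansions, which makes the operator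
`(1 + Λᴺ)(1 - Λᴺ)⁻¹` skew-adjoint. -/
noncomputable def invSym (N : ℕ) (g : ℤ → ℂ) : ℤ → ℂ :=
  fun n => (1 / 2 : ℂ) * (invForward N g n + invBackward N g n)

/-- `f = ½ (1 + Λᴺ)(1 - Λᴺ)⁻¹ Res([X, A] + [X̂, Â])`, for the given operator `(1 - Λᴺ)⁻¹`. -/
noncomputable def corrFun (inv : (ℤ → ℂ) → (ℤ → ℂ)) (N : ℕ) (A X : Pair) : ℤ → ℂ :=
  fun n => (1 / 2 : ℂ) * (inv (⁅X.1, A.1⁆ + ⁅X.2, A.2⁆ : DiffOp).res n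
    + inv (⁅X.1, A.1⁆ + ⁅X.2, A.2⁆ : DiffOp).res (n + N))

/-- `P₂(X, X̂) - ([f, A], [f, Â])`, for the given operator `(1 - Λᴺ)⁻¹`. -/
noncomputable def P2corr (inv : (ℤ → ℂ) → (ℤ → ℂ)) (N : ℕ) (A X : Pair) : Pair :=
  P2 A X - pairComm (diag (corrFun inv N A X), diag (corrFun inv N A X)) A

/-- The first reduced tensor. -/
noncomputable def P1red (A X : Pair) : Pair := P1 A X

/-- The second reduced tensor. -/
noncomputable def P2red (N : ℕ) (A X : Pair) : Pair := P2corr (invSym N) N A X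

/-- The second reduced tensor computed with the one-sided expansion `1 + Λᴺ + Λ²ᴺ + ⋯`. -/
noncomputable def P2redForward (N : ℕ) (A X : Pair) : Pair := P2corr (invForward N) N A X

/-- `Pr` is the Dirac reduction of `P` onto the coset:
`Pr = P^{UU} - P^{UV} ∘ (P^{VV})⁻¹ ∘ P^{VU}`, with `W = -(P^{VV})⁻¹ P^{VU} X`. -/
def IsDiracReduction (N M : ℕ) (P Pr : Pair → Pair → Pair) : Prop :=
  ∀ A ∈ coset N M, ∀ X ∈ cotangent N M, ∃ W ∈ cotangentCompl N M,
    projV N M (P A W) = -projV N M (P A X) ∧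
    Pr A X = projU N M (P A X) + projU N M (P A W)

/-! ### Functionals and Poisson structures on the coset

Functions on the coset are written as functions of the coordinate `u ∈ U_{N,M}`. -/

/-- `X` is the gradient at `u` of the function `F` on the coset. -/
def HasGrad {N M : ℕ} (F : tangent N M → ℂ) (u : tangent N M) (X : Pair) : Prop :=
  X ∈ cotangent N M ∧
    ∀ v : tangent N M, HasDerivAt (fun t : ℂ => F (u + t • v)) (pairing X v) 0

/-- Functionals: functions on the coset that are analytic on every finite-dimensional affine
subspace and that have a gradient in `U*_{N,M}` at every point. -/
def IsFunctional {N M : ℕ} (F : tangent N M → ℂ) : Prop :=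
  (∀ (k : ℕ) (u : tangent N M) (v : Fin k → tangent N M),
    AnalyticOnNhd ℂ (fun c : Fin k → ℂ => F (u + ∑ i, c i • v i)) Set.univ) ∧
  ∀ u, ∃ X, HasGrad F u X

open Classical in
/-- The gradient (zero if there is none). -/
noncomputable def grad {N M : ℕ} (F : tangent N M → ℂ) (u : tangent N M) : Pair :=
  if h : ∃ X, HasGrad F u X then h.choose else 0

/-- Functionals that are infinitesimally invariant under the conjugations by `N`-periodic
functions `p`. -/
def IsPeriodicInvariant {N M : ℕ} (F : tangent N M → ℂ) : Prop :=
  IsFunctional F ∧ ∀ (u : tangent N M) (p : ℤ → ℂ), (∀ n, p (n + N) = p n) →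
    pairing (grad F u) (pairComm (diag p, diag p) (point u)) = 0

/-- `{F, H}(A) = ⟨δF/δA, P_A (δH/δA)⟩`. -/
noncomputable def poissonBracket {N M : ℕ} (P : Pair → Pair → Pair) (F H : tangent N M → ℂ) :
    tangent N M → ℂ :=
  fun u => pairing (grad F u) (P (point u) (grad H u))

/-- `P` is a linear bundle map from `T*U_{N,M}` to `TU_{N,M}` over the coset, and the bracket that
it defines on the class `C` of functions is a Poisson bracket. -/
structure IsPoissonTensor (N M : ℕ) (C : (tangent N M → ℂ) → Prop) (P : Pair → Pair → Pair) :
    Prop where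
  mapsTo : ∀ A ∈ coset N M, ∀ X ∈ cotangent N M, P A X ∈ tangent N M
  map_add : ∀ A ∈ coset N M, ∀ X ∈ cotangent N M, ∀ Y ∈ cotangent N M,
    P A (X + Y) = P A X + P A Y
  map_smul : ∀ A ∈ coset N M, ∀ (c : ℂ), ∀ X ∈ cotangent N M, P A (c • X) = c • P A X
  closed : ∀ F H, C F → C H → C (poissonBracket P F H)
  add_left : ∀ F G H, C F → C G → C H →
    poissonBracket P (F + G) H = poissonBracket P F H + poissonBracket P G H
  smul_left : ∀ (c : ℂ) F H, C F → C H → poissonBracket P (c • F) H = c • poissonBracket P F H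
  skew : ∀ F H, C F → C H → poissonBracket P F H = -poissonBracket P H F
  leibniz : ∀ F G H, C F → C G → C H →
    poissonBracket P (F * G) H = F * poissonBracket P G H + poissonBracket P F H * G
  jacobi : ∀ F G H, C F → C G → C H →
    poissonBracket P F (poissonBracket P G H) + poissonBracket P G (poissonBracket P H F)
      + poissonBracket P H (poissonBracket P F G) = 0

/-- `P` and `Q` are Poisson tensors, and so are all their linear combinations. -/
def CompatiblePoisson (N M : ℕ) (C : (tangent N M → ℂ) → Prop) (P Q : Pair → Pair → Pair) :
    Prop :=
  IsPoissonTensor N M C P ∧ IsPoissonTensor N M C Q ∧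
    ∀ a b : ℂ, IsPoissonTensor N M C (fun A X => a • P A X + b • Q A X)

end Toda

/-! ### Arithmetic of formal difference operators. -/

namespace DiffOp

/-! Everything takes place in the ring of pairs (bounded above, bounded below), where the trace of a
product is cyclic as soon as one factor lies in the ideal ℰ⁻ × ℰ⁺. The R-matrix is `skewR` + δ,
where `skewR` splits the degree-zero part evenly and is skew, and δ, multiplication by the total
residue, is symmetric. In these terms P₂ is X ↦ aA - Ab with a = ½ s(AX) + ½ δ(XA) and b = ½ s(XA) +
½ δ(AX), s = `skewR` (`P2_eq`). Subtracting [f, ·] subtracts from both a and b the same function ½ C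
Res[X, A], with C = (1 + Λᴺ)(1 - Λᴺ)⁻¹ and Res taken of the total commutator. `SklyaninData`
isolates what is needed of s, δ and γ = C ∘ Res.

Jacobi identity on constant covectors (`SklyaninData.jacobi`): all words containing both a and b
cancel in the cyclic sum, and the rest is the modified Yang-Baxter equation for AX, AY, AZ minus
that for XA, YA, ZA, whose right sides agree by cyclicity. The values of δ and γ commute with one
another and act by symmetries of s, so they contribute nothing (`yang_baxter_add`); skewness of γ
only serves to make the tensor skew. Thus the corrected tensor is Poisson before any restriction.
Since f is chosen to remove the coefficient of Λᴺ (`P2corr_mem_tangent`), the tensor is tangent to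
the coset and the identity restricts. No general reduction theorem is used for the Poisson property.

P₁ is the derivative of P₂ along the identity: W(A + ε) = W(A) + ε P₁(A) exactly, because W(1) = 0,
and the correction does not affect P₁. The Jacobi identity at A + ε is a quadratic polynomial in ε,
whose three coefficients give it for every αP₁ + βP₂ (`jacobi_pencil`).

The Yang-Baxter equation (`skewR_yang_baxter`) comes from x = (c + p, -c + q) with image (c - p, c +
q). Here c is a band operator common to both components, and p, q are triangular; the cubic terms in
c cancel between the components and those in p and in q have no residue.

Passing from constant covectors to functionals requires second derivatives in infinite dimensions.
Each covector has finitely many coordinates, and by Baire's theorem and the identity theorem the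
gradient of a functional involves only finitely many of them on a whole finite-dimensional affine
subspace (`IsGradient.exists_finset`). Hence Hessians are represented by covectors, brackets have
gradients, and the Hessian terms cancel in the Jacobi sum by symmetry.

The one-sided correction differs from the symmetric one by an N-periodic function, depending on X
through a symmetric form. So P₂^red is the skew part of P₂⁺, and the difference is invisible to
functionals invariant under periodic conjugations; these are closed under the bracket because the
tensors are invariant as well. For Dirac reduction, P₁ is tangent already, and P₂ sends wΛ⁻ᴺ to the
commutator with ½(1 + Λᴺ)w, so w = -(1 - Λᴺ)⁻¹Res[X, A] produces the correction (`P2_transversal`).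
-/

@[ext] theorem ext {A B : DiffOp} (h : ∀ k n, A k n = B k n) : A = B :=
  funext fun k => funext fun n => h k n

section Coefficients

variable (A B : DiffOp) (k n : ℤ)

theorem mul_apply : (A * B) k n = ∑ᶠ i : ℤ, A i n * B (k - i) (n + i) := rfl
@[simp] theorem add_apply : (A + B) k n = A k n + B k n := rfl
@[simp] theorem sub_apply : (A - B) k n = A k n - B k n := rfl
@[simp] theorem neg_apply : (-A) k n = -A k n := rfl
@[simp] theorem zero_apply : (0 : DiffOp) k n = 0 := rfl
@[simp] theorem smul_apply (c : ℂ) : (c • A) k n = c * A k n := rfl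
theorem bracket_def : ⁅A, B⁆ = A * B - B * A := rfl

@[simp] theorem lt_apply (m : ℤ) : A.lt m k n = if k < m then A k n else 0 := by
  unfold lt; split_ifs <;> rfl

@[simp] theorem ge_apply (m : ℤ) : A.ge m k n = if m ≤ k then A k n else 0 := by
  unfold ge; split_ifs <;> rfl

@[simp] theorem diag_apply (g : ℤ → ℂ) : diag g k n = if k = 0 then g n else 0 := by
  unfold diag; split_ifs <;> rfl

end Coefficients

theorem lt_add_ge (A : DiffOp) (m : ℤ) : A.lt m + A.ge m = A := by
  ext k n; simp only [add_apply, lt_apply, ge_apply]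
  split_ifs <;> first | omega | simp

@[simp] theorem lt_add (A B : DiffOp) (m : ℤ) : (A + B).lt m = A.lt m + B.lt m := by
  ext k n; simp only [add_apply, lt_apply]; split_ifs <;> simp

@[simp] theorem ge_add (A B : DiffOp) (m : ℤ) : (A + B).ge m = A.ge m + B.ge m := by
  ext k n; simp only [add_apply, ge_apply]; split_ifs <;> simp

@[simp] theorem lt_smul (c : ℂ) (A : DiffOp) (m : ℤ) : (c • A).lt m = c • A.lt m := by
  ext k n; simp only [smul_apply, lt_apply]; split_ifs <;> simp

@[simp] theorem ge_smul (c : ℂ) (A : DiffOp) (m : ℤ) : (c • A).ge m = c • A.ge m := by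
  ext k n; simp only [smul_apply, ge_apply]; split_ifs <;> simp

@[simp] theorem diag_add (f g : ℤ → ℂ) : diag (f + g) = diag f + diag g := by
  ext k n; simp only [add_apply, diag_apply, Pi.add_apply]; split_ifs <;> simp

@[simp] theorem diag_smul (c : ℂ) (f : ℤ → ℂ) : diag (c • f) = c • diag f := by
  ext k n; simp only [smul_apply, diag_apply, Pi.smul_apply, smul_eq_mul]; split_ifs <;> simp

theorem mem_degLT {A : DiffOp} {m : ℤ} : A ∈ degLT m ↔ ∀ k, m ≤ k → ∀ n, A k n = 0 :=
  ⟨fun h k hk n => congrFun (h k hk) n, fun h k hk => funext (h k hk)⟩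

theorem mem_degGE {A : DiffOp} {m : ℤ} : A ∈ degGE m ↔ ∀ k, k < m → ∀ n, A k n = 0 :=
  ⟨fun h k hk n => congrFun (h k hk) n, fun h k hk => funext (h k hk)⟩

theorem degLT_mono {p q : ℤ} (h : p ≤ q) : degLT p ≤ degLT q :=
  fun _ hA k hk => hA k (h.trans hk)

theorem degGE_mono {p q : ℤ} (h : p ≤ q) : degGE q ≤ degGE p :=
  fun _ hA k hk => hA k (hk.trans_le h)

theorem lt_mem_degLT (A : DiffOp) (m : ℤ) : A.lt m ∈ degLT m :=
  mem_degLT.2 fun k hk n => by rw [lt_apply, if_neg (by omega)]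

theorem ge_mem_degGE (A : DiffOp) (m : ℤ) : A.ge m ∈ degGE m :=
  mem_degGE.2 fun k hk n => by rw [ge_apply, if_neg (by omega)]

theorem diag_mem_degLT (g : ℤ → ℂ) : diag g ∈ degLT 1 :=
  mem_degLT.2 fun k hk n => by rw [diag_apply, if_neg (by omega)]

theorem diag_mem_degGE (g : ℤ → ℂ) : diag g ∈ degGE 0 :=
  mem_degGE.2 fun k hk n => by rw [diag_apply, if_neg (by omega)]

theorem diag_mul_apply (g : ℤ → ℂ) (A : DiffOp) (k n : ℤ) : (diag g * A) k n = g n * A k n := by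
  rw [mul_apply, finsum_eq_single _ 0]
  · simp
  · intro i hi; simp [hi]

theorem mul_diag_apply (A : DiffOp) (g : ℤ → ℂ) (k n : ℤ) :
    (A * diag g) k n = A k n * g (n + k) := by
  rw [mul_apply, finsum_eq_single _ k]
  · simp
  · intro i hi; simp [sub_eq_zero, hi.symm]

/-- In a product of operators of degrees `< p` and `< q` the sum over the degrees is finite. -/
theorem mul_apply_eq_sum {A B : DiffOp} {p q : ℤ} (hA : A ∈ degLT p) (hB : B ∈ degLT q)
    {k lo hi : ℤ} (n : ℤ) (hlo : lo ≤ k - q) (hhi : p ≤ hi) :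
    (A * B) k n = ∑ i ∈ Finset.Ioo lo hi, A i n * B (k - i) (n + i) := by
  rw [mul_apply]
  refine finsum_eq_sum_of_support_subset _ fun i hi => ?_
  have h := Function.mem_support.1 hi
  have h1 : ¬ p ≤ i := fun hp => h (by rw [mem_degLT.1 hA i hp, zero_mul])
  have h2 : ¬ q ≤ k - i := fun hq => h (by rw [mem_degLT.1 hB _ hq, mul_zero])
  simp only [Finset.coe_Ioo, Set.mem_Ioo]; omega

theorem mul_mem_degLT {A B : DiffOp} {p q : ℤ} (hA : A ∈ degLT (p + 1))
    (hB : B ∈ degLT (q + 1)) : A * B ∈ degLT (p + q + 1) := by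
  refine mem_degLT.2 fun k hk n => ?_
  rw [mul_apply_eq_sum hA hB n le_rfl le_rfl]
  refine Finset.sum_eq_zero fun i hi => ?_
  rw [Finset.mem_Ioo] at hi; omega

/-- Only one term of the sum survives the two degree bounds. Leading coefficients are what decides
whether a tensor is tangent to the coset. -/
theorem mul_apply_top {A B : DiffOp} {p q : ℤ} (hA : A ∈ degLT (p + 1))
    (hB : B ∈ degLT (q + 1)) (n : ℤ) : (A * B) (p + q) n = A p n * B q (n + p) := by
  rw [mul_apply, finsum_eq_single _ p]
  · rw [add_sub_cancel_left]
  · intro i hi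
    rcases lt_or_gt_of_ne hi with h | h
    · rw [mem_degLT.1 hB (p + q - i) (by omega), mul_zero]
    · rw [mem_degLT.1 hA i (by omega), zero_mul]

theorem mul_apply_bot {A B : DiffOp} {p q : ℤ} (hA : A ∈ degGE p) (hB : B ∈ degGE q) (n : ℤ) :
    (A * B) (p + q) n = A p n * B q (n + p) := by
  rw [mul_apply, finsum_eq_single _ p]
  · rw [add_sub_cancel_left]
  · intro i hi
    rcases lt_or_gt_of_ne hi with h | h
    · rw [mem_degGE.1 hA i (by omega), zero_mul]
    · rw [mem_degGE.1 hB (p + q - i) (by omega), mul_zero]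

theorem mul_mem_bddAboveOp {A B : DiffOp} (hA : A ∈ bddAboveOp) (hB : B ∈ bddAboveOp) :
    A * B ∈ bddAboveOp := by
  obtain ⟨p, hp⟩ := hA
  obtain ⟨q, hq⟩ := hB
  exact ⟨_, mul_mem_degLT (p := p - 1) (q := q - 1) (by simpa using hp) (by simpa using hq)⟩

theorem mul_add_above {A B C : DiffOp} (hA : A ∈ bddAboveOp) (hB : B ∈ bddAboveOp)
    (hC : C ∈ bddAboveOp) : A * (B + C) = A * B + A * C := by
  obtain ⟨p, hp⟩ := hA
  obtain ⟨q, hq⟩ := hB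
  obtain ⟨r, hr⟩ := hC
  have hq' := degLT_mono (le_max_left q r) hq
  have hr' := degLT_mono (le_max_right q r) hr
  ext k n
  rw [add_apply, mul_apply_eq_sum hp (add_mem hq' hr') n le_rfl le_rfl,
    mul_apply_eq_sum hp hq' n le_rfl le_rfl, mul_apply_eq_sum hp hr' n le_rfl le_rfl,
    ← Finset.sum_add_distrib]
  simp only [add_apply, mul_add]

theorem add_mul_above {A B C : DiffOp} (hA : A ∈ bddAboveOp) (hB : B ∈ bddAboveOp)
    (hC : C ∈ bddAboveOp) : (A + B) * C = A * C + B * C := by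
  obtain ⟨p, hp⟩ := hA
  obtain ⟨q, hq⟩ := hB
  obtain ⟨r, hr⟩ := hC
  have hp' := degLT_mono (le_max_left p q) hp
  have hq' := degLT_mono (le_max_right p q) hq
  ext k n
  rw [add_apply, mul_apply_eq_sum (add_mem hp' hq') hr n le_rfl le_rfl,
    mul_apply_eq_sum hp' hr n le_rfl le_rfl, mul_apply_eq_sum hq' hr n le_rfl le_rfl,
    ← Finset.sum_add_distrib]
  simp only [add_apply, add_mul]

/-- For fixed k both iterated sums are taken over one finite box of degrees (i, j), large enough for
all nonzero terms, and then exchanged. -/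
theorem mul_assoc_above {A B C : DiffOp} (hA : A ∈ bddAboveOp) (hB : B ∈ bddAboveOp)
    (hC : C ∈ bddAboveOp) : A * B * C = A * (B * C) := by
  obtain ⟨p, hp⟩ := hA
  obtain ⟨q, hq⟩ := hB
  obtain ⟨r, hr⟩ := hC
  have hAB : A * B ∈ degLT (p + q) := degLT_mono (by omega)
    (mul_mem_degLT (p := p - 1) (q := q - 1) (by simpa using hp) (by simpa using hq))
  have hBC : B * C ∈ degLT (q + r) := degLT_mono (by omega)
    (mul_mem_degLT (p := q - 1) (q := r - 1) (by simpa using hq) (by simpa using hr))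
  ext k n
  rw [mul_apply_eq_sum hAB hr n le_rfl le_rfl,
    mul_apply_eq_sum hp hBC n (lo := k - r - q) (by omega) le_rfl]
  have h1 : ∀ j ∈ Finset.Ioo (k - r) (p + q), (A * B) j n * C (k - j) (n + j) =
      ∑ i ∈ Finset.Ioo (k - r - q) p,
        A i n * B (j - i) (n + i) * C (k - j) (n + j) := by
    intro j hj
    rw [Finset.mem_Ioo] at hj
    rw [mul_apply_eq_sum hp hq n (lo := k - r - q) (by omega) le_rfl, Finset.sum_mul]
  have h2 : ∀ i ∈ Finset.Ioo (k - r - q) p, A i n * (B * C) (k - i) (n + i) =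
      ∑ j ∈ Finset.Ioo (k - r) (p + q),
        A i n * B (j - i) (n + i) * C (k - j) (n + j) := by
    intro i hi
    rw [Finset.mem_Ioo] at hi
    -- The inner index becomes the total degree j of the first two factors, so that its range no
    -- longer depends on i.
    rw [mul_apply, ← finsum_comp_equiv (Equiv.subRight i),
      finsum_eq_sum_of_support_subset (s := Finset.Ioo (k - r) (p + q)), Finset.mul_sum]
    · refine Finset.sum_congr rfl fun j _ => ?_
      rw [Equiv.subRight_apply, mul_assoc, show k - i - (j - i) = k - j by ring,
        show n + i + (j - i) = n + j by ring]
    · intro j hj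
      have h := Function.mem_support.1 hj
      rw [Equiv.subRight_apply] at h
      have h1 : ¬ q ≤ j - i := fun hp => h (by rw [mem_degLT.1 hq _ hp, zero_mul])
      have h2 : ¬ r ≤ k - i - (j - i) := fun hq => h (by rw [mem_degLT.1 hr _ hq, mul_zero])
      simp only [Finset.coe_Ioo, Set.mem_Ioo]; omega
  rw [Finset.sum_congr rfl h1, Finset.sum_congr rfl h2, Finset.sum_comm]

theorem smul_mul (c : ℂ) (A B : DiffOp) : c • A * B = c • (A * B) := by
  ext k n
  simp only [mul_apply, smul_apply, mul_assoc]
  exact (smul_finsum c fun i => A i n * B (k - i) (n + i)).symm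

theorem mul_smul (c : ℂ) (A B : DiffOp) : A * c • B = c • (A * B) := by
  ext k n
  simp only [mul_apply, smul_apply, mul_left_comm _ c]
  exact (smul_finsum c fun i => A i n * B (k - i) (n + i)).symm

theorem diag_one_mul (A : DiffOp) : diag 1 * A = A := by
  ext k n; simp [diag_mul_apply]

theorem mul_diag_one (A : DiffOp) : A * diag 1 = A := by
  ext k n; simp [mul_diag_apply]

/-- The automorphism `Λ ↦ Λ⁻¹`, `n ↦ -n`. -/
def reflect (A : DiffOp) : DiffOp := fun k n => A (-k) (-n)

@[simp] theorem reflect_apply (A : DiffOp) (k n : ℤ) : A.reflect k n = A (-k) (-n) := rfl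

@[simp] theorem reflect_reflect (A : DiffOp) : A.reflect.reflect = A := by
  ext k n; simp

/-- The substitution turns n + i into -(n + i), so the product rule is preserved. All statements for
operators bounded below are obtained in this way from those for operators bounded above. -/
theorem reflect_mul (A B : DiffOp) : (A * B).reflect = A.reflect * B.reflect := by
  ext k n
  rw [reflect_apply, mul_apply, mul_apply, ← finsum_comp_equiv (Equiv.neg ℤ)]
  refine finsum_congr fun i => ?_
  simp only [Equiv.neg_apply, reflect_apply]
  congr 2 <;> ring

theorem reflect_add (A B : DiffOp) : (A + B).reflect = A.reflect + B.reflect := rfl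

theorem reflect_mem_degLT {A : DiffOp} {m : ℤ} : A.reflect ∈ degLT m ↔ A ∈ degGE (1 - m) := by
  rw [mem_degLT, mem_degGE]
  constructor
  · intro h k hk n
    simpa using h (-k) (by omega) (-n)
  · intro h k hk n
    exact h (-k) (by omega) (-n)

theorem reflect_mem_bddAboveOp {A : DiffOp} : A.reflect ∈ bddAboveOp ↔ A ∈ bddBelowOp :=
  ⟨fun ⟨m, h⟩ => ⟨1 - m, reflect_mem_degLT.1 h⟩,
    fun ⟨m, h⟩ => ⟨1 - m, reflect_mem_degLT.2 (by simpa using h)⟩⟩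

theorem reflect_injective : Function.Injective reflect :=
  Function.LeftInverse.injective reflect_reflect

theorem mul_mem_degGE {A B : DiffOp} {p q : ℤ} (hA : A ∈ degGE p) (hB : B ∈ degGE q) :
    A * B ∈ degGE (p + q) := by
  have hA' : A.reflect ∈ degLT (-p + 1) :=
    reflect_mem_degLT.2 (by rwa [show (1 : ℤ) - (-p + 1) = p by ring])
  have hB' : B.reflect ∈ degLT (-q + 1) :=
    reflect_mem_degLT.2 (by rwa [show (1 : ℤ) - (-q + 1) = q by ring])
  have h := mul_mem_degLT hA' hB'
  rw [← reflect_mul, reflect_mem_degLT] at h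
  convert h using 2; ring

theorem mul_mem_bddBelowOp {A B : DiffOp} (hA : A ∈ bddBelowOp) (hB : B ∈ bddBelowOp) :
    A * B ∈ bddBelowOp := by
  obtain ⟨p, hp⟩ := hA
  obtain ⟨q, hq⟩ := hB
  exact ⟨_, mul_mem_degGE hp hq⟩

theorem mul_add_below {A B C : DiffOp} (hA : A ∈ bddBelowOp) (hB : B ∈ bddBelowOp)
    (hC : C ∈ bddBelowOp) : A * (B + C) = A * B + A * C :=
  reflect_injective (by
    rw [reflect_mul, reflect_add, mul_add_above, ← reflect_mul, ← reflect_mul, ← reflect_add]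
    all_goals rwa [reflect_mem_bddAboveOp])

theorem add_mul_below {A B C : DiffOp} (hA : A ∈ bddBelowOp) (hB : B ∈ bddBelowOp)
    (hC : C ∈ bddBelowOp) : (A + B) * C = A * C + B * C :=
  reflect_injective (by
    rw [reflect_mul, reflect_add, add_mul_above, ← reflect_mul, ← reflect_mul, ← reflect_add]
    all_goals rwa [reflect_mem_bddAboveOp])

theorem mul_assoc_below {A B C : DiffOp} (hA : A ∈ bddBelowOp) (hB : B ∈ bddBelowOp)
    (hC : C ∈ bddBelowOp) : A * B * C = A * (B * C) :=
  reflect_injective (by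
    rw [reflect_mul, reflect_mul, mul_assoc_above, ← reflect_mul, ← reflect_mul]
    all_goals rwa [reflect_mem_bddAboveOp])

theorem zero_mul' (A : DiffOp) : (0 : DiffOp) * A = 0 := by
  ext k n; simp [mul_apply]

theorem mul_zero' (A : DiffOp) : A * (0 : DiffOp) = 0 := by
  ext k n; simp [mul_apply]

/-- The ring of difference operators of degrees bounded above. -/
noncomputable instance : Ring bddAboveOp :=
  { (inferInstance : AddCommGroup bddAboveOp) with
    mul := fun A B => ⟨A.1 * B.1, mul_mem_bddAboveOp A.2 B.2⟩
    one := ⟨diag 1, 1, diag_mem_degLT 1⟩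
    mul_assoc := fun A B C => Subtype.ext (mul_assoc_above A.2 B.2 C.2)
    one_mul := fun A => Subtype.ext (diag_one_mul _)
    mul_one := fun A => Subtype.ext (mul_diag_one _)
    left_distrib := fun A B C => Subtype.ext (mul_add_above A.2 B.2 C.2)
    right_distrib := fun A B C => Subtype.ext (add_mul_above A.2 B.2 C.2)
    zero_mul := fun A => Subtype.ext (zero_mul' _)
    mul_zero := fun A => Subtype.ext (mul_zero' _) }

/-- The ring of difference operators of degrees bounded below. -/
noncomputable instance : Ring bddBelowOp :=
  { (inferInstance : AddCommGroup bddBelowOp) with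
    mul := fun A B => ⟨A.1 * B.1, mul_mem_bddBelowOp A.2 B.2⟩
    one := ⟨diag 1, 0, diag_mem_degGE 1⟩
    mul_assoc := fun A B C => Subtype.ext (mul_assoc_below A.2 B.2 C.2)
    one_mul := fun A => Subtype.ext (diag_one_mul _)
    mul_one := fun A => Subtype.ext (mul_diag_one _)
    left_distrib := fun A B C => Subtype.ext (mul_add_below A.2 B.2 C.2)
    right_distrib := fun A B C => Subtype.ext (add_mul_below A.2 B.2 C.2)
    zero_mul := fun A => Subtype.ext (zero_mul' _)
    mul_zero := fun A => Subtype.ext (mul_zero' _) }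

noncomputable instance : Algebra ℂ bddAboveOp :=
  Algebra.ofModule (fun c A B => Subtype.ext (smul_mul c A.1 B.1))
    (fun c A B => Subtype.ext (mul_smul c A.1 B.1))

noncomputable instance : Algebra ℂ bddBelowOp :=
  Algebra.ofModule (fun c A B => Subtype.ext (smul_mul c A.1 B.1))
    (fun c A B => Subtype.ext (mul_smul c A.1 B.1))

/-! ### Traces -/

/-- Each coefficient of the product is a finite sum over degrees, so finite supports in a single
factor suffice. -/
theorem mul_mem_finCoeff {A B : DiffOp} {p q : ℤ} (hA : A ∈ degLT p) (hB : B ∈ degLT q)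
    (h : A ∈ finCoeff ∨ B ∈ finCoeff) : A * B ∈ finCoeff := by
  intro k
  have hsub : Function.support ((A * B) k) ⊆ ⋃ i ∈ Finset.Ioo (k - q) p,
      {n | A i n ≠ 0 ∧ B (k - i) (n + i) ≠ 0} := by
    intro n hn
    have h := Function.mem_support.1 hn
    rw [mul_apply_eq_sum hA hB n le_rfl le_rfl] at h
    obtain ⟨i, hi, h⟩ := Finset.exists_ne_zero_of_sum_ne_zero h
    exact Set.mem_biUnion hi ⟨left_ne_zero_of_mul h, right_ne_zero_of_mul h⟩
  refine Set.Finite.subset (Set.Finite.biUnion (Finset.finite_toSet _) fun i _ => ?_) hsub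
  rcases h with h | h
  · exact (h i).subset fun n hn => hn.1
  · exact ((h (k - i)).preimage (add_left_injective i).injOn).subset fun n hn => hn.2

theorem reflect_mem_finCoeff {A : DiffOp} : A.reflect ∈ finCoeff ↔ A ∈ finCoeff := by
  have key : ∀ A : DiffOp, A ∈ finCoeff → A.reflect ∈ finCoeff := fun A h k =>
    ((h (-k)).preimage neg_injective.injOn).subset fun n hn => hn
  exact ⟨fun h => by simpa using key _ h, key A⟩

theorem reflect_mem_minusAlg {A : DiffOp} : A.reflect ∈ minusAlg ↔ A ∈ plusAlg :=
  and_congr reflect_mem_finCoeff reflect_mem_bddAboveOp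

theorem mul_mem_minusAlg_left {A B : DiffOp} (hA : A ∈ minusAlg) (hB : B ∈ bddAboveOp) :
    A * B ∈ minusAlg :=
  ⟨mul_mem_finCoeff hA.2.choose_spec hB.choose_spec (.inl hA.1), mul_mem_bddAboveOp hA.2 hB⟩

theorem mul_mem_minusAlg_right {A B : DiffOp} (hA : A ∈ bddAboveOp) (hB : B ∈ minusAlg) :
    A * B ∈ minusAlg :=
  ⟨mul_mem_finCoeff hA.choose_spec hB.2.choose_spec (.inr hB.1), mul_mem_bddAboveOp hA hB.2⟩

theorem mul_mem_plusAlg_left {A B : DiffOp} (hA : A ∈ plusAlg) (hB : B ∈ bddBelowOp) :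
    A * B ∈ plusAlg := by
  rw [← reflect_mem_minusAlg, reflect_mul]
  exact mul_mem_minusAlg_left (reflect_mem_minusAlg.2 hA) (reflect_mem_bddAboveOp.2 hB)

theorem mul_mem_plusAlg_right {A B : DiffOp} (hA : A ∈ bddBelowOp) (hB : B ∈ plusAlg) :
    A * B ∈ plusAlg := by
  rw [← reflect_mem_minusAlg, reflect_mul]
  exact mul_mem_minusAlg_right (reflect_mem_bddAboveOp.2 hA) (reflect_mem_minusAlg.2 hB)

/-- Cyclicity of the trace, when only finitely many terms occur. -/
theorem trace_mul_comm_of_finite {A B : DiffOp}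
    (h : {p : ℤ × ℤ | A p.1 p.2 ≠ 0 ∧ B (-p.1) (p.2 + p.1) ≠ 0}.Finite) :
    (A * B).trace = (B * A).trace := by
  have key : ∀ {A B : DiffOp},
      {p : ℤ × ℤ | A p.1 p.2 ≠ 0 ∧ B (-p.1) (p.2 + p.1) ≠ 0}.Finite →
      (A * B).trace = ∑ᶠ p : ℤ × ℤ, A p.1 p.2 * B (-p.1) (p.2 + p.1) := by
    intro A B h
    have hs : (Function.support fun p : ℤ × ℤ => A p.2 p.1 * B (-p.2) (p.1 + p.2)).Finite := by
      refine (h.preimage (Equiv.prodComm ℤ ℤ).injective.injOn).subset fun p hp => ?_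
      exact ⟨left_ne_zero_of_mul hp, right_ne_zero_of_mul hp⟩
    rw [← finsum_comp_equiv (Equiv.prodComm ℤ ℤ)]
    simp only [Equiv.prodComm_apply, Prod.fst_swap, Prod.snd_swap]
    rw [finsum_curry _ hs]
    refine finsum_congr fun n => ?_
    rw [res, mul_apply]
    simp only [zero_sub]
  -- The involution (i, n) ↦ (-i, n + i) exchanges the roles of the two factors in the double sum.
  let e : ℤ × ℤ ≃ ℤ × ℤ :=
    { toFun := fun p => (-p.1, p.2 + p.1)
      invFun := fun p => (-p.1, p.2 + p.1)
      left_inv := fun p => by simp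
      right_inv := fun p => by simp }
  have h' : {p : ℤ × ℤ | B p.1 p.2 ≠ 0 ∧ A (-p.1) (p.2 + p.1) ≠ 0}.Finite := by
    refine (h.preimage e.injective.injOn).subset fun p hp => ?_
    refine ⟨hp.2, ?_⟩
    simpa [e] using hp.1
  rw [key h, key h', ← finsum_comp_equiv e]
  refine finsum_congr fun p => ?_
  simp [e, mul_comm]

theorem trace_mul_comm_of_degLT {A B : DiffOp} {p q : ℤ} (hA : ∀ i, p ≤ i → ∀ n, A i n = 0)
    (hB : ∀ i, q ≤ i → ∀ n, B i n = 0) (h : A ∈ finCoeff ∨ B ∈ finCoeff) :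
    (A * B).trace = (B * A).trace := by
  refine trace_mul_comm_of_finite (Set.Finite.subset (s := ⋃ i ∈ Finset.Ioo (-q) p,
    Prod.mk i '' {n | A i n ≠ 0 ∧ B (-i) (n + i) ≠ 0}) ?_ ?_)
  · refine Set.Finite.biUnion (Finset.finite_toSet _) fun i _ => Set.Finite.image _ ?_
    rcases h with h | h
    · exact (h i).subset fun n hn => hn.1
    · exact ((h (-i)).preimage (add_left_injective i).injOn).subset fun n hn => hn.2
  · rintro ⟨i, n⟩ ⟨h1, h2⟩
    have hi : i ∈ Finset.Ioo (-q) p := by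
      rw [Finset.mem_Ioo]
      have := mt (hA i · n) h1
      have := mt (hB (-i) · (n + i)) h2
      omega
    exact Set.mem_biUnion hi ⟨n, ⟨h1, h2⟩, rfl⟩

theorem trace_reflect (A : DiffOp) : A.reflect.trace = A.trace := by
  rw [trace, trace, ← finsum_comp_equiv (Equiv.neg ℤ)]
  exact finsum_congr fun n => by simp [res]

theorem trace_mul_comm_above {A B : DiffOp} (hA : A ∈ minusAlg) (hB : B ∈ bddAboveOp) :
    (A * B).trace = (B * A).trace :=
  trace_mul_comm_of_degLT (mem_degLT.1 hA.2.choose_spec) (mem_degLT.1 hB.choose_spec) (.inl hA.1)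

theorem trace_mul_comm_below {A B : DiffOp} (hA : A ∈ plusAlg) (hB : B ∈ bddBelowOp) :
    (A * B).trace = (B * A).trace := by
  rw [← trace_reflect, ← trace_reflect (B * A), reflect_mul, reflect_mul]
  exact trace_mul_comm_above (reflect_mem_minusAlg.2 hA) (reflect_mem_bddAboveOp.2 hB)

theorem trace_add {A B : DiffOp} (hA : A ∈ finCoeff) (hB : B ∈ finCoeff) :
    (A + B).trace = A.trace + B.trace :=
  finsum_add_distrib (hA 0) (hB 0)

theorem trace_smul (c : ℂ) (A : DiffOp) : (c • A).trace = c * A.trace :=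
  (smul_finsum c fun n => A.res n).symm

/-- The residue pairs degree i with degree -i, and -i < m means i ≥ 1 - m. -/
theorem trace_mul_lt (A B : DiffOp) (m : ℤ) : (A * B.lt m).trace = (A.ge (1 - m) * B).trace := by
  refine finsum_congr fun n => finsum_congr fun i => ?_
  rw [lt_apply, ge_apply]
  split_ifs <;> first | omega | simp

theorem trace_mul_ge (A B : DiffOp) (m : ℤ) : (A * B.ge m).trace = (A.lt (1 - m) * B).trace := by
  refine finsum_congr fun n => finsum_congr fun i => ?_
  rw [lt_apply, ge_apply]
  split_ifs <;> first | omega | simp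

theorem trace_mul_diag (A : DiffOp) (g : ℤ → ℂ) : (A * diag g).trace = ∑ᶠ n, A 0 n * g n := by
  refine finsum_congr fun n => ?_
  rw [res, mul_diag_apply, add_zero]

end DiffOp

/-! ### The abstract quadratic bracket and its Jacobi identity. -/

/-- A ring with a trace functional `T` that is cyclic on the ideal `I`, a skew solution `s` of the
modified Yang-Baxter equation, and operators `δ` (symmetric) and `γ` (skew) with values in a
commutative subspace `D` that acts by symmetries of `s`. -/
structure SklyaninData (R : Type*) [Ring R] [Algebra ℂ R] where
  T : R →ₗ[ℂ] ℂ
  I : Submodule ℂ R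
  mul_left : ∀ x ∈ I, ∀ y, y * x ∈ I
  mul_right : ∀ x ∈ I, ∀ y, x * y ∈ I
  cyclic : ∀ x ∈ I, ∀ y, T (x * y) = T (y * x)
  s : R →ₗ[ℂ] R
  skew : ∀ x ∈ I, ∀ y ∈ I, T (x * s y) = -T (y * s x)
  yang_baxter : ∀ x ∈ I, ∀ y ∈ I, ∀ z ∈ I,
    T ((s x * s y - s y * s x) * z) + T ((s y * s z - s z * s y) * x)
      + T ((s z * s x - s x * s z) * y) = -T ((x * y - y * x) * z)
  D : Submodule ℂ R
  comm : ∀ p ∈ D, ∀ q ∈ D, p * q = q * p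
  ad : ∀ p ∈ D, ∀ x, s (p * x - x * p) = p * s x - s x * p
  δ : R →ₗ[ℂ] R
  δ_mem : ∀ x, δ x ∈ D
  δ_symm : ∀ x ∈ I, ∀ y ∈ I, T (x * δ y) = T (y * δ x)
  γ : R →ₗ[ℂ] R
  γ_mem : ∀ x, γ x ∈ D
  γ_skew : ∀ x ∈ I, ∀ y ∈ I, T (x * γ y) = -T (y * γ x)

namespace SklyaninData

variable {R : Type*} [Ring R] [Algebra ℂ R] (S : SklyaninData R)

/-- Only the middle factor has to lie in the ideal. This is the device by which every traced word is
brought to a form beginning with a covector. -/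
theorem rotate {Y : R} (hY : Y ∈ S.I) (p q : R) : S.T (p * (Y * q)) = S.T (Y * (q * p)) := by
  rw [← S.cyclic _ (S.mul_right Y hY q), mul_assoc]

/-- The left multiplier of the quadratic tensor. -/
noncomputable def a (V Z : R) : R :=
  (1 / 2 : ℂ) • S.s (V * Z) + ((1 / 2 : ℂ) • S.δ (Z * V) - (1 / 2 : ℂ) • S.γ (Z * V - V * Z))

/-- The right multiplier of the quadratic tensor. -/
noncomputable def b (V Z : R) : R :=
  (1 / 2 : ℂ) • S.s (Z * V) + ((1 / 2 : ℂ) • S.δ (V * Z) - (1 / 2 : ℂ) • S.γ (Z * V - V * Z))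

/-- The quadratic tensor at `A`, applied to the covector `Z`. -/
noncomputable def W (A Z : R) : R := S.a A Z * A - A * S.b A Z

/-- The linear tensor at `A`, applied to the covector `Z`. -/
noncomputable def linW (A Z : R) : R :=
  S.a A Z - S.b A Z + (S.a 1 Z * A - A * S.a 1 Z)

/-- The polarized quadratic bracket. -/
noncomputable def β (Y Z A V : R) : ℂ := S.T (Y * (S.a V Z * A - A * S.b V Z))

/-- The gradient of the quadratic bracket of the covectors `Y` and `Z`. -/
noncomputable def G (A Y Z : R) : R :=
  Y * S.a A Z - S.b A Z * Y - (Z * S.a A Y - S.b A Y * Z)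

theorem G_mem {A Y Z : R} (hY : Y ∈ S.I) (hZ : Z ∈ S.I) : S.G A Y Z ∈ S.I :=
  sub_mem (sub_mem (S.mul_right _ hY _) (S.mul_left _ hY _))
    (sub_mem (S.mul_right _ hZ _) (S.mul_left _ hZ _))

/-- With the base point absorbed into the covector, a and b are traced against AY and YA, which lie
in I, so the adjoint properties of s, δ, γ apply. -/
theorem β_eq {Y : R} (hY : Y ∈ S.I) (Z A V : R) :
    S.β Y Z A V = S.T (A * Y * S.a V Z) - S.T (Y * A * S.b V Z) := by
  rw [β, mul_sub, map_sub, mul_assoc A, S.rotate hY, mul_assoc Y A]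

theorem a_add (V V' Z : R) : S.a (V + V') Z = S.a V Z + S.a V' Z := by
  simp only [a, mul_add, add_mul, map_add, map_sub, smul_add, smul_sub]; abel

theorem b_add (V V' Z : R) : S.b (V + V') Z = S.b V Z + S.b V' Z := by
  simp only [b, mul_add, add_mul, map_add, map_sub, smul_add, smul_sub]; abel

theorem a_smul (c : ℂ) (V Z : R) : S.a (c • V) Z = c • S.a V Z := by
  simp only [a, smul_mul_assoc, mul_smul_comm, map_smul, map_sub]; module

theorem b_smul (c : ℂ) (V Z : R) : S.b (c • V) Z = c • S.b V Z := by
  simp only [b, smul_mul_assoc, mul_smul_comm, map_smul, map_sub]; module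

theorem β_add_left (Y Z A A' V : R) : S.β Y Z (A + A') V = S.β Y Z A V + S.β Y Z A' V := by
  simp only [β, mul_add, add_mul, map_add, mul_sub, map_sub]; ring

theorem β_smul_left (c : ℂ) (Y Z A V : R) : S.β Y Z (c • A) V = c * S.β Y Z A V := by
  simp only [β, smul_mul_assoc, mul_smul_comm, map_smul, mul_sub, map_sub, smul_eq_mul]

theorem β_add_right (Y Z A V V' : R) : S.β Y Z A (V + V') = S.β Y Z A V + S.β Y Z A V' := by
  simp only [β, a_add, b_add, mul_add, add_mul, map_add, mul_sub, map_sub]; ring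

theorem β_smul_right (c : ℂ) (Y Z A V : R) : S.β Y Z A (c • V) = c * S.β Y Z A V := by
  simp only [β, a_smul, b_smul, smul_mul_assoc, mul_smul_comm, map_smul, mul_sub, map_sub,
    smul_eq_mul]

/-- The s-terms are skew separately against AY and YA. The δ-term of a is matched with that of b,
which is why their arguments are in the opposite order; γ sees only commutators, and its skewness
gives the rest. -/
theorem β_skew {Y Z : R} (hY : Y ∈ S.I) (hZ : Z ∈ S.I) (A V : R) :
    S.β Y Z A V = -S.β Z Y V A := by
  have hs := S.skew _ (S.mul_left Y hY A) _ (S.mul_left Z hZ V)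
  have hs' := S.skew _ (S.mul_right Y hY A) _ (S.mul_right Z hZ V)
  have hd := S.δ_symm _ (S.mul_left Y hY A) _ (S.mul_right Z hZ V)
  have hd' := S.δ_symm _ (S.mul_right Y hY A) _ (S.mul_left Z hZ V)
  have hc := S.γ_skew _ (sub_mem (S.mul_right Y hY A) (S.mul_left Y hY A))
    _ (sub_mem (S.mul_right Z hZ V) (S.mul_left Z hZ V))
  simp only [map_sub, sub_mul, mul_sub] at hc
  rw [S.β_eq hY, S.β_eq hZ]
  simp only [a, b, mul_add, mul_sub, map_add, map_sub, mul_smul_comm, map_smul, smul_eq_mul]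
  linear_combination (1 / 2) * hs - (1 / 2) * hs' + (1 / 2) * hd - (1 / 2) * hd' + (1 / 2) * hc

/-- `G` is the gradient of the quadratic bracket. -/
theorem β_add_β {Y Z : R} (hY : Y ∈ S.I) (hZ : Z ∈ S.I) (A V : R) :
    S.β Y Z A V + S.β Y Z V A = S.T (V * S.G A Y Z) := by
  rw [S.β_skew hY hZ A V, S.β_eq hY, S.β_eq hZ, ← S.cyclic _ (S.G_mem hY hZ), G]
  have h1 := S.rotate hY (S.b A Z) V
  have h2 := S.rotate hZ (S.b A Y) V
  have h3 := S.rotate hY V (S.a A Z)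
  have h4 := S.rotate hZ V (S.a A Y)
  simp only [sub_mul, map_sub, mul_assoc] at *
  linear_combination h1 - h2 + h3 - h4

theorem T_W {Y : R} (Z A : R) : S.T (Y * S.W A Z) = S.β Y Z A A := rfl

/-- Cyclic sums of double commutators of multipliers. -/
theorem yang_baxter_add {x y z p q r : R} (hx : x ∈ S.I) (hy : y ∈ S.I) (hz : z ∈ S.I)
    (hp : p ∈ S.D) (hq : q ∈ S.D) (hr : r ∈ S.D) {u v w : R} (hu : u = (1 / 2 : ℂ) • S.s x + p)
    (hv : v = (1 / 2 : ℂ) • S.s y + q) (hw : w = (1 / 2 : ℂ) • S.s z + r) :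
    S.T ((u * v - v * u) * z) + S.T ((v * w - w * v) * x) + S.T ((w * u - u * w) * y)
      = -(1 / 4 : ℂ) * S.T ((x * y - y * x) * z) := by
  -- Cross terms between p in D and s: ad p commutes with s and s is skew, so the two contributions
  -- are opposite.
  have mixed : ∀ {p x y : R}, p ∈ S.D → x ∈ S.I → y ∈ S.I →
      S.T ((p * S.s x - S.s x * p) * y) + S.T ((S.s y * p - p * S.s y) * x) = 0 := by
    intro p x y hp hx hy
    have h1 := S.skew _ (sub_mem (S.mul_left x hx p) (S.mul_right x hx p)) _ hy
    have h2 := S.cyclic _ hy (S.s (p * x - x * p))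
    rw [S.ad p hp] at h1 h2
    have h3 := S.cyclic x hx (S.s y * p - p * S.s y)
    have h4 := S.rotate hx p (S.s y)
    simp only [mul_sub, sub_mul, map_sub, mul_assoc] at *
    linear_combination h1 - h2 - h3 - h4
  have hyb := S.yang_baxter x hx y hy z hz
  -- Terms with two factors from D vanish since D is commutative.
  have c1 : p * q * z - q * p * z = 0 := by rw [S.comm p hp q hq, sub_self]
  have c2 : q * r * x - r * q * x = 0 := by rw [S.comm q hq r hr, sub_self]
  have c3 : r * p * y - p * r * y = 0 := by rw [S.comm r hr p hp, sub_self]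
  replace c1 := congrArg S.T c1
  replace c2 := congrArg S.T c2
  replace c3 := congrArg S.T c3
  have m1 := mixed hp hy hz
  have m2 := mixed hq hz hx
  have m3 := mixed hr hx hy
  subst hu hv hw
  simp only [mul_add, add_mul, mul_sub, sub_mul, map_add, map_sub, mul_smul_comm, smul_mul_assoc,
    map_smul, smul_eq_mul, map_zero] at *
  linear_combination (1 / 4) * hyb + c1 + c2 + c3 + (1 / 2) * m1 + (1 / 2) * m2 + (1 / 2) * m3

/-- A normal form in which each word starts with a covector. The four words containing both a left
and a right multiplier cancel in the cyclic sum over X, Y, Z. -/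
theorem T_W_mul_G {Y Z : R} (hY : Y ∈ S.I) (hZ : Z ∈ S.I) (A X : R) :
    S.T (S.W A X * S.G A Y Z) =
      S.T (Y * (S.a A Z * (S.a A X * A))) - S.T (Y * (S.a A X * (A * S.b A Z)))
      - S.T (Z * (S.a A Y * (S.a A X * A))) + S.T (Z * (S.a A X * (A * S.b A Y)))
      - S.T (Y * (S.a A Z * (A * S.b A X))) + S.T (Y * (A * (S.b A X * S.b A Z)))
      + S.T (Z * (S.a A Y * (A * S.b A X))) - S.T (Z * (A * (S.b A X * S.b A Y))) := by
  have h1 := S.rotate hY (S.a A X * A) (S.a A Z)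
  have h2 := S.rotate hY (S.a A X * (A * S.b A Z)) 1
  have h3 := S.rotate hZ (S.a A X * A) (S.a A Y)
  have h4 := S.rotate hZ (S.a A X * (A * S.b A Y)) 1
  have h5 := S.rotate hY (A * S.b A X) (S.a A Z)
  have h6 := S.rotate hY (A * (S.b A X * S.b A Z)) 1
  have h7 := S.rotate hZ (A * S.b A X) (S.a A Y)
  have h8 := S.rotate hZ (A * (S.b A X * S.b A Y)) 1
  simp only [W, G, mul_sub, sub_mul, map_sub, mul_assoc, mul_one, one_mul] at *
  linear_combination h1 - h2 - h3 + h4 - h5 + h6 + h7 - h8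

/-- The Jacobi identity of the quadratic bracket, for constant covectors. -/
theorem jacobi {X Y Z : R} (hX : X ∈ S.I) (hY : Y ∈ S.I) (hZ : Z ∈ S.I) (A : R) :
    S.T (S.W A X * S.G A Y Z) + S.T (S.W A Y * S.G A Z X) + S.T (S.W A Z * S.G A X Y) = 0 := by
  have hg : ∀ x y : R, (1 / 2 : ℂ) • S.δ x - (1 / 2 : ℂ) • S.γ y ∈ S.D := fun x y =>
    sub_mem (S.D.smul_mem _ (S.δ_mem x)) (S.D.smul_mem _ (S.γ_mem y))
  -- The left multipliers satisfy the Yang-Baxter identity for AX, AY, AZ, the right ones (`hb`)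
  -- that for XA, YA, ZA.
  have ha := S.yang_baxter_add (S.mul_left X hX A) (S.mul_left Y hY A) (S.mul_left Z hZ A)
    (hg _ _) (hg _ _) (hg _ _) (rfl : S.a A X = _) (rfl : S.a A Y = _) (rfl : S.a A Z = _)
  have hb := S.yang_baxter_add (S.mul_right X hX A) (S.mul_right Y hY A) (S.mul_right Z hZ A)
    (hg _ _) (hg _ _) (hg _ _) (rfl : S.b A X = _) (rfl : S.b A Y = _) (rfl : S.b A Z = _)
  have r1 := S.rotate hZ (S.a A X * (S.a A Y * A)) 1
  have r2 := S.rotate hZ (S.a A Y * (S.a A X * A)) 1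
  have r3 := S.rotate hX (S.a A Y * (S.a A Z * A)) 1
  have r4 := S.rotate hX (S.a A Z * (S.a A Y * A)) 1
  have r5 := S.rotate hY (S.a A Z * (S.a A X * A)) 1
  have r6 := S.rotate hY (S.a A X * (S.a A Z * A)) 1
  have q1 := S.rotate hZ (S.b A X * S.b A Y) A
  have q2 := S.rotate hZ (S.b A Y * S.b A X) A
  have q3 := S.rotate hX (S.b A Y * S.b A Z) A
  have q4 := S.rotate hX (S.b A Z * S.b A Y) A
  have q5 := S.rotate hY (S.b A Z * S.b A X) A
  have q6 := S.rotate hY (S.b A X * S.b A Z) A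
  -- Moving one A around identifies the traces of [AX, AY]AZ and [XA, YA]ZA, so the right sides of
  -- `ha` and `hb` cancel.
  have t1 := S.rotate hX A (A * (Y * (A * Z)))
  have t2 := S.rotate hY A (A * (X * (A * Z)))
  rw [S.T_W_mul_G hY hZ, S.T_W_mul_G hZ hX, S.T_W_mul_G hX hY]
  simp only [mul_sub, sub_mul, map_sub, mul_assoc, mul_one, one_mul] at *
  linear_combination ha - hb - r1 + r2 - r3 + r4 - r5 + r6 + q1 - q2 + q3 - q4 + q5 - q6 -
    (1 / 4) * t1 + (1 / 4) * t2

/-- The quadratic bracket is invariant under conjugations by elements of `D`. -/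
theorem T_commutator_mul_G {Y Z p : R} (hY : Y ∈ S.I) (hZ : Z ∈ S.I) (hp : p ∈ S.D) (A : R) :
    S.T ((p * A - A * p) * S.G A Y Z) =
      S.T (Y * (p * S.W A Z - S.W A Z * p)) - S.T (Z * (p * S.W A Y - S.W A Y * p)) := by
  -- Since p commutes with q and r, only the s-parts of the multipliers are differentiated, and
  -- skewness of s moves the derivation from one covector to the other.
  have key : ∀ {x y q r : R}, x ∈ S.I → y ∈ S.I → q ∈ S.D → r ∈ S.D →
      ∀ {u v : R}, u = (1 / 2 : ℂ) • S.s x + q → v = (1 / 2 : ℂ) • S.s y + r →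
      S.T (x * (v * p - p * v)) = S.T (y * (u * p - p * u)) := by
    intro x y q r hx hy hq hr u v hu hv
    have h1 := S.skew _ (sub_mem (S.mul_left x hx p) (S.mul_right x hx p)) _ hy
    rw [S.ad p hp] at h1
    have h2 := S.rotate hx p (S.s y)
    have h3 := congrArg (fun t => S.T (x * t)) (S.comm p hp r hr)
    have h4 := congrArg (fun t => S.T (y * t)) (S.comm p hp q hq)
    subst hu hv
    simp only [mul_add, add_mul, mul_sub, sub_mul, map_add, map_sub, mul_smul_comm,
      smul_mul_assoc, map_smul, smul_eq_mul, mul_assoc] at *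
    linear_combination (1 / 2) * h1 - (1 / 2) * h2 - h3 + h4
  have hg : ∀ x y : R, (1 / 2 : ℂ) • S.δ x - (1 / 2 : ℂ) • S.γ y ∈ S.D := fun x y =>
    sub_mem (S.D.smul_mem _ (S.δ_mem x)) (S.D.smul_mem _ (S.γ_mem y))
  have ha := key (S.mul_left Y hY A) (S.mul_left Z hZ A) (hg _ _) (hg _ _)
    (rfl : S.a A Y = _) (rfl : S.a A Z = _)
  have hb := key (S.mul_right Y hY A) (S.mul_right Z hZ A) (hg _ _) (hg _ _)
    (rfl : S.b A Y = _) (rfl : S.b A Z = _)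
  have u1 := S.rotate hY A (S.a A Z * p)
  have u2 := S.rotate hY A (p * S.a A Z)
  have u3 := S.rotate hZ A (S.a A Y * p)
  have u4 := S.rotate hZ A (p * S.a A Y)
  have v1 := S.rotate hY (p * A) (S.a A Z)
  have v2 := S.rotate hY (A * p) (S.a A Z)
  have v3 := S.rotate hZ (p * A) (S.a A Y)
  have v4 := S.rotate hZ (A * p) (S.a A Y)
  have w1 := S.rotate hY (p * (A * S.b A Z)) 1
  have w2 := S.rotate hY (A * (p * S.b A Z)) 1
  have w3 := S.rotate hZ (p * (A * S.b A Y)) 1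
  have w4 := S.rotate hZ (A * (p * S.b A Y)) 1
  simp only [W, G, mul_sub, sub_mul, map_sub, mul_assoc, mul_one, one_mul] at *
  linear_combination ha - hb + v1 - v2 - v3 + v4 - w1 + w2 + w3 - w4 - u1 + u2 + u3 - u4

/-- There is no ε² term: at the identity the left and right multipliers coincide, and 1 is central.
-/
theorem W_add_smul_one (A Z : R) (ε : ℂ) :
    S.W (A + ε • 1) Z = S.W A Z + ε • S.linW A Z := by
  have h : S.b 1 Z = S.a 1 Z := by simp only [a, b, one_mul, mul_one]
  simp only [W, linW, a_add, b_add, a_smul, b_smul, h, mul_add, add_mul, mul_smul_comm,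
    smul_mul_assoc, mul_one, one_mul, smul_add, smul_sub]
  abel

theorem W_add (A Y Z : R) : S.W A (Y + Z) = S.W A Y + S.W A Z := by
  simp only [W, a, b, mul_add, add_mul, map_add, map_sub, smul_add, smul_sub, mul_sub, sub_mul]
  abel

theorem W_smul (c : ℂ) (A Z : R) : S.W A (c • Z) = c • S.W A Z := by
  simp only [W, a, b, smul_mul_assoc, mul_smul_comm, map_smul, map_sub, mul_sub, sub_mul, mul_add,
    add_mul]
  module

end SklyaninData

/-! ### The symmetric splitting and the skew part of the R-matrix. -/

namespace DiffOp

/-- Half of the sum of `A_{<0}` and `A_{≤0}`. -/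
noncomputable def lowHalf : DiffOp →ₗ[ℂ] DiffOp where
  toFun A := (1 / 2 : ℂ) • (A.lt 0 + A.lt 1)
  map_add' A B := by simp only [lt_add, smul_add]; abel
  map_smul' c A := by simp only [lt_smul, RingHom.id_apply]; module

/-- Half of the sum of `A_{≥0}` and `A_{>0}`. -/
noncomputable def highHalf : DiffOp →ₗ[ℂ] DiffOp where
  toFun A := (1 / 2 : ℂ) • (A.ge 0 + A.ge 1)
  map_add' A B := by simp only [ge_add, smul_add]; abel
  map_smul' c A := by simp only [ge_smul, RingHom.id_apply]; module

theorem lowHalf_apply (A : DiffOp) (k n : ℤ) :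
    lowHalf A k n = (if k < 0 then 1 else if k = 0 then 1 / 2 else 0) * A k n := by
  change (1 / 2 : ℂ) * ((A.lt 0) k n + (A.lt 1) k n) = _
  rw [lt_apply, lt_apply]
  split_ifs <;> first | omega | ring

theorem highHalf_apply (A : DiffOp) (k n : ℤ) :
    highHalf A k n = (if 0 < k then 1 else if k = 0 then 1 / 2 else 0) * A k n := by
  change (1 / 2 : ℂ) * ((A.ge 0) k n + (A.ge 1) k n) = _
  rw [ge_apply, ge_apply]
  split_ifs <;> first | omega | ring

theorem lowHalf_add_highHalf (A : DiffOp) : lowHalf A + highHalf A = A := by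
  ext k n
  rw [add_apply, lowHalf_apply, highHalf_apply]
  split_ifs <;> first | omega | ring

theorem lowHalf_mem_degLT (A : DiffOp) : lowHalf A ∈ degLT 1 :=
  mem_degLT.2 fun k hk n => by
    rw [lowHalf_apply, if_neg (by omega), if_neg (by omega), zero_mul]

theorem highHalf_mem_degGE (A : DiffOp) : highHalf A ∈ degGE 0 :=
  mem_degGE.2 fun k hk n => by
    rw [highHalf_apply, if_neg (by omega), if_neg (by omega), zero_mul]

theorem lowHalf_mem_degGE {A : DiffOp} {m : ℤ} (h : A ∈ degGE m) : lowHalf A ∈ degGE m :=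
  mem_degGE.2 fun k hk n => by rw [lowHalf_apply, mem_degGE.1 h k hk, mul_zero]

theorem highHalf_mem_degLT {A : DiffOp} {m : ℤ} (h : A ∈ degLT m) : highHalf A ∈ degLT m :=
  mem_degLT.2 fun k hk n => by rw [highHalf_apply, mem_degLT.1 h k hk, mul_zero]

theorem mem_finCoeff_of_support {A B : DiffOp} (hA : A ∈ finCoeff)
    (h : ∀ k n, A k n = 0 → B k n = 0) : B ∈ finCoeff :=
  fun k => (hA k).subset fun n hn => fun hA => hn (h k n hA)

theorem lowHalf_mem_finCoeff {A : DiffOp} (h : A ∈ finCoeff) : lowHalf A ∈ finCoeff :=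
  mem_finCoeff_of_support h fun k n h => by rw [lowHalf_apply, h, mul_zero]

theorem highHalf_mem_finCoeff {A : DiffOp} (h : A ∈ finCoeff) : highHalf A ∈ finCoeff :=
  mem_finCoeff_of_support h fun k n h => by rw [highHalf_apply, h, mul_zero]

/-- The residue pairs opposite degrees, and the weight ½ in degree zero is self-adjoint; hence the
two halves are exactly adjoint, which the sharp truncations are not. -/
theorem trace_mul_lowHalf (A B : DiffOp) :
    (A * lowHalf B).trace = (highHalf A * B).trace := by
  refine finsum_congr fun n => finsum_congr fun i => ?_
  rw [lowHalf_apply, highHalf_apply]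
  split_ifs <;> first | omega | ring

theorem trace_mul_highHalf (A B : DiffOp) :
    (A * highHalf B).trace = (lowHalf A * B).trace := by
  refine finsum_congr fun n => finsum_congr fun i => ?_
  rw [lowHalf_apply, highHalf_apply]
  split_ifs <;> first | omega | ring

theorem finite_support_of_band {A : DiffOp} {p q : ℤ} (hA : A ∈ finCoeff) (hp : A ∈ degLT p)
    (hq : A ∈ degGE q) : {x : ℤ × ℤ | A x.1 x.2 ≠ 0}.Finite := by
  refine Set.Finite.subset (s := ⋃ i ∈ Finset.Ico q p, Prod.mk i '' Function.support (A i)) ?_ ?_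
  · exact Set.Finite.biUnion (Finset.finite_toSet _) fun i _ => (hA i).image _
  · rintro ⟨i, n⟩ h1
    have hi : i ∈ Finset.Ico q p := by
      rw [Finset.mem_Ico]
      have := mt (mem_degLT.1 hp i · n) h1
      have := mt (mem_degGE.1 hq i · n) h1
      omega
    exact Set.mem_biUnion hi ⟨n, h1, rfl⟩

theorem trace_mul_comm_of_band {A : DiffOp} {p q : ℤ} (hA : A ∈ finCoeff) (hp : A ∈ degLT p)
    (hq : A ∈ degGE q) (B : DiffOp) : (A * B).trace = (B * A).trace :=
  trace_mul_comm_of_finite ((finite_support_of_band hA hp hq).subset fun _ h => h.1)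

/-- A linear extension of the trace from `finCoeff` to all difference operators. -/
noncomputable def traceExt : DiffOp →ₗ[ℂ] ℂ :=
  (LinearMap.exists_extend (p := finCoeff)
    { toFun := fun A => trace A.1
      map_add' := fun A B => trace_add A.2 B.2
      map_smul' := fun c A => trace_smul c A.1 }).choose

theorem traceExt_apply {A : DiffOp} (hA : A ∈ finCoeff) : traceExt A = A.trace :=
  LinearMap.congr_fun (LinearMap.exists_extend (p := finCoeff)
    { toFun := fun A => trace A.1
      map_add' := fun A B => trace_add A.2 B.2
      map_smul' := fun c A => trace_smul c A.1 }).choose_spec ⟨A, hA⟩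

end DiffOp

/-- The sum over the halves of a splitting, in the modified Yang-Baxter equation. -/
theorem commutator_sum_halves {R : Type*} [Ring R] [Algebra ℂ R] (T : R →ₗ[ℂ] ℂ)
    (J : Submodule ℂ R) (hT : ∀ x ∈ J, ∀ y, T (x * y) = T (y * x))
    {c p c' p' c'' p'' : R} (hc : c ∈ J) (hp : p ∈ J) (hc' : c' ∈ J) (hp' : p' ∈ J) :
    T (((c - p) * (c' - p') - (c' - p') * (c - p)) * (c'' + p''))
      + T (((c' - p') * (c'' - p'') - (c'' - p'') * (c' - p')) * (c + p))
      + T (((c'' - p'') * (c - p) - (c - p) * (c'' - p'')) * (c' + p'))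
      + T (((c + p) * (c' + p') - (c' + p') * (c + p)) * (c'' + p''))
    = 4 * T ((c * c' - c' * c) * c'') + 4 * T ((p * p' - p' * p) * p'') := by
  -- The trace of [x, y]z is invariant under cyclic permutation even when z lies outside J.
  have rot : ∀ {x y : R}, x ∈ J → y ∈ J → ∀ z,
      T ((y * z - z * y) * x) = T ((x * y - y * x) * z) ∧
      T ((z * x - x * z) * y) = T ((x * y - y * x) * z) := by
    intro x y hx hy z
    have h1 := hT x hx (y * z)
    have h2 := hT y hy (x * z)
    have h3 := hT x hx (z * y)
    have h4 := hT y hy (z * x)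
    simp only [sub_mul, map_sub, mul_assoc] at *
    constructor
    · linear_combination h2 - h1 + h3
    · linear_combination h2 - h1 - h4
  rw [(rot (add_mem hc hp) (sub_mem hc' hp') (c'' - p'')).1,
    (rot (sub_mem hc hp) (add_mem hc' hp') (c'' - p'')).2]
  simp only [mul_add, add_mul, mul_sub, sub_mul, map_add, map_sub]
  ring

namespace Toda

open DiffOp

/-- The ring of pairs of operators, of degrees bounded above and below. -/
abbrev PairRing : Type := bddAboveOp × bddBelowOp

/-- The underlying pair of formal difference operators. -/
noncomputable def toPair : PairRing →ₗ[ℂ] Pair :=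
  bddAboveOp.subtype.prodMap bddBelowOp.subtype

/-- `u ↦ u_-`, with values in the operators bounded above. -/
noncomputable def lowPart : DiffOp →ₗ[ℂ] bddAboveOp :=
  lowHalf.codRestrict bddAboveOp fun A => ⟨1, lowHalf_mem_degLT A⟩

/-- `u ↦ u_+`, with values in the operators bounded below. -/
noncomputable def highPart : DiffOp →ₗ[ℂ] bddBelowOp :=
  highHalf.codRestrict bddBelowOp fun A => ⟨0, highHalf_mem_degGE A⟩

/-- The sum of the components of a pair, as a formal operator. -/
noncomputable def total : PairRing →ₗ[ℂ] DiffOp :=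
  bddAboveOp.subtype.coprod bddBelowOp.subtype

/-- The skew part of the `R`-matrix. -/
noncomputable def skewR : PairRing →ₗ[ℂ] PairRing :=
  (LinearMap.fst ℂ _ _ - (2 : ℂ) • lowPart ∘ₗ total).prod
    (-LinearMap.snd ℂ _ _ + (2 : ℂ) • highPart ∘ₗ total)

/-- Multiplication by a function, in both components. -/
noncomputable def diagPair : (ℤ → ℂ) →ₗ[ℂ] PairRing where
  toFun g := (⟨diag g, 1, diag_mem_degLT g⟩, ⟨diag g, 0, diag_mem_degGE g⟩)
  map_add' f g := Prod.ext (Subtype.ext (diag_add f g)) (Subtype.ext (diag_add f g))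
  map_smul' c g := Prod.ext (Subtype.ext (diag_smul c g)) (Subtype.ext (diag_smul c g))

/-- The sum of the residues of the components. -/
noncomputable def resSum : PairRing →ₗ[ℂ] (ℤ → ℂ) where
  toFun x := total x 0
  map_add' x y := by rw [map_add]; rfl
  map_smul' c x := by rw [map_smul]; rfl

theorem resSum_apply (x : PairRing) (n : ℤ) :
    resSum x n = (x.1 : DiffOp) 0 n + (x.2 : DiffOp) 0 n := rfl

/-- The ideal `ℰ⁻ × ℰ⁺`. -/
noncomputable def coupledIdeal : Submodule ℂ PairRing := coupled.comap toPair

/-- The (extended) trace of a pair. -/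
noncomputable def pairTrace : PairRing →ₗ[ℂ] ℂ := traceExt ∘ₗ total

theorem pairTrace_apply (x : PairRing) :
    pairTrace x = traceExt (x.1 : DiffOp) + traceExt (x.2 : DiffOp) :=
  map_add traceExt _ _

theorem coe_mul_above (x y : bddAboveOp) : ((x * y : bddAboveOp) : DiffOp) = x * y := rfl

theorem coe_mul_below (x y : bddBelowOp) : ((x * y : bddBelowOp) : DiffOp) = x * y := rfl

theorem mem_coupledIdeal {x : PairRing} :
    x ∈ coupledIdeal ↔ (x.1 : DiffOp) ∈ minusAlg ∧ (x.2 : DiffOp) ∈ plusAlg := Iff.rfl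

theorem coupledIdeal_mul_left {x : PairRing} (hx : x ∈ coupledIdeal) (y : PairRing) :
    y * x ∈ coupledIdeal :=
  ⟨mul_mem_minusAlg_right y.1.2 hx.1, mul_mem_plusAlg_right y.2.2 hx.2⟩

theorem coupledIdeal_mul_right {x : PairRing} (hx : x ∈ coupledIdeal) (y : PairRing) :
    x * y ∈ coupledIdeal :=
  ⟨mul_mem_minusAlg_left hx.1 y.1.2, mul_mem_plusAlg_left hx.2 y.2.2⟩

theorem pairTrace_eq {x : PairRing} (hx : x ∈ coupledIdeal) :
    pairTrace x = (x.1 : DiffOp).trace + (x.2 : DiffOp).trace := by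
  rw [mem_coupledIdeal] at hx
  rw [pairTrace_apply, traceExt_apply hx.1.1, traceExt_apply hx.2.1]

theorem traceExt_comm_above {x : bddAboveOp} (hx : (x : DiffOp) ∈ minusAlg) (y : bddAboveOp) :
    traceExt ↑(x * y) = traceExt ↑(y * x) := by
  rw [coe_mul_above, coe_mul_above, traceExt_apply (mul_mem_minusAlg_left hx y.2).1,
    traceExt_apply (mul_mem_minusAlg_right y.2 hx).1]
  exact trace_mul_comm_above hx y.2

theorem traceExt_comm_below {x : bddBelowOp} (hx : (x : DiffOp) ∈ plusAlg) (y : bddBelowOp) :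
    traceExt ↑(x * y) = traceExt ↑(y * x) := by
  rw [coe_mul_below, coe_mul_below, traceExt_apply (mul_mem_plusAlg_left hx y.2).1,
    traceExt_apply (mul_mem_plusAlg_right y.2 hx).1]
  exact trace_mul_comm_below hx y.2

theorem pairTrace_cyclic {x : PairRing} (hx : x ∈ coupledIdeal) (y : PairRing) :
    pairTrace (x * y) = pairTrace (y * x) := by
  rw [pairTrace_apply, pairTrace_apply]
  exact congrArg₂ (· + ·) (traceExt_comm_above hx.1 _) (traceExt_comm_below hx.2 _)

/-- The adjoint of the low half is the high half, and the two add up to the identity. -/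
theorem traceExt_lowPart_lowPart {x y : bddAboveOp} (hx : (x : DiffOp) ∈ minusAlg) :
    traceExt ↑(x * lowPart y) + traceExt ↑(y * lowPart x) = traceExt ↑(x * y) := by
  obtain ⟨p, hp⟩ := x.2
  have h : traceExt ↑(x * lowPart y) = traceExt ((y : DiffOp) * highHalf x) := by
    have hx' : highHalf x ∈ minusAlg := ⟨highHalf_mem_finCoeff hx.1, p, highHalf_mem_degLT hp⟩
    rw [coe_mul_above, traceExt_apply (mul_mem_minusAlg_left hx (lowPart y).2).1,
      traceExt_apply (mul_mem_minusAlg_right y.2 hx').1, ← trace_mul_comm_above hx' y.2]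
    exact trace_mul_lowHalf _ _
  rw [h, ← map_add, traceExt_comm_above hx]
  change traceExt ((y : DiffOp) * highHalf x + (y : DiffOp) * lowHalf x) = _
  rw [← mul_add_above y.2 ⟨p, highHalf_mem_degLT hp⟩ ⟨1, lowHalf_mem_degLT _⟩, add_comm,
    lowHalf_add_highHalf]
  rfl

theorem traceExt_highPart_highPart {x y : bddBelowOp} (hx : (x : DiffOp) ∈ plusAlg) :
    traceExt ↑(x * highPart y) + traceExt ↑(y * highPart x) = traceExt ↑(x * y) := by
  obtain ⟨p, hp⟩ := x.2
  have h : traceExt ↑(x * highPart y) = traceExt ((y : DiffOp) * lowHalf x) := by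
    have hx' : lowHalf x ∈ plusAlg := ⟨lowHalf_mem_finCoeff hx.1, p, lowHalf_mem_degGE hp⟩
    rw [coe_mul_below, traceExt_apply (mul_mem_plusAlg_left hx (highPart y).2).1,
      traceExt_apply (mul_mem_plusAlg_right y.2 hx').1, ← trace_mul_comm_below hx' y.2]
    exact trace_mul_highHalf _ _
  rw [h, ← map_add, traceExt_comm_below hx]
  change traceExt ((y : DiffOp) * lowHalf x + (y : DiffOp) * highHalf x) = _
  rw [← mul_add_below y.2 ⟨p, lowHalf_mem_degGE hp⟩ ⟨0, highHalf_mem_degGE _⟩,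
    lowHalf_add_highHalf]
  rfl

/-- The high half of an operator in ℰ⁻ has finitely many nonzero coefficients, so the trace is
cyclic for it against an operator that is bounded only below. -/
theorem traceExt_lowPart_highPart {x : bddAboveOp} {y : bddBelowOp}
    (hx : (x : DiffOp) ∈ minusAlg) (hy : (y : DiffOp) ∈ plusAlg) :
    traceExt ↑(x * lowPart y) = traceExt ↑(y * highPart x) := by
  obtain ⟨p, hp⟩ := x.2
  rw [coe_mul_above, coe_mul_below, traceExt_apply (mul_mem_minusAlg_left hx (lowPart y).2).1,
    traceExt_apply (mul_mem_plusAlg_left hy (highPart x).2).1]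
  change ((x : DiffOp) * lowHalf y).trace = ((y : DiffOp) * highHalf x).trace
  rw [trace_mul_lowHalf]
  exact trace_mul_comm_of_band (highHalf_mem_finCoeff hx.1) (highHalf_mem_degLT hp)
    (highHalf_mem_degGE _) _

theorem pairTrace_mul_skewR (x y : PairRing) :
    pairTrace (x * skewR y) = traceExt ↑(x.1 * y.1) - 2 * traceExt ↑(x.1 * lowPart y.1)
      - 2 * traceExt ↑(x.1 * lowPart y.2) - traceExt ↑(x.2 * y.2)
      + 2 * traceExt ↑(x.2 * highPart y.1) + 2 * traceExt ↑(x.2 * highPart y.2) := by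
  have h1 : (x * skewR y).1 = x.1 * y.1 - (2 : ℂ) • (x.1 * lowPart y.1)
      - (2 : ℂ) • (x.1 * lowPart y.2) := by
    change x.1 * (y.1 - (2 : ℂ) • lowPart (y.1 + y.2)) = _
    rw [map_add, mul_sub, smul_add, mul_add, mul_smul_comm, mul_smul_comm]; abel
  have h2 : (x * skewR y).2 = -(x.2 * y.2) + (2 : ℂ) • (x.2 * highPart y.1)
      + (2 : ℂ) • (x.2 * highPart y.2) := by
    change x.2 * (-y.2 + (2 : ℂ) • highPart (y.1 + y.2)) = _
    rw [map_add, mul_add, mul_neg, smul_add, mul_add, mul_smul_comm, mul_smul_comm]; abel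
  rw [pairTrace_apply, h1, h2]
  simp only [Submodule.coe_sub, Submodule.coe_add, Submodule.coe_smul, Submodule.coe_neg, map_sub,
    map_add, map_smul, map_neg, smul_eq_mul]
  ring

/-- Within each component, the identity term of `skewR` compensates the symmetric part of twice the
projection; the terms mixing the components are adjoint to each other with opposite signs. -/
theorem skewR_skew {x y : PairRing} (hx : x ∈ coupledIdeal) (hy : y ∈ coupledIdeal) :
    pairTrace (x * skewR y) = -pairTrace (y * skewR x) := by
  rw [mem_coupledIdeal] at hx hy
  rw [pairTrace_mul_skewR, pairTrace_mul_skewR]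
  linear_combination -2 * traceExt_lowPart_lowPart (y := y.1) hx.1
    + 2 * traceExt_highPart_highPart (y := y.2) hx.2 - 2 * traceExt_lowPart_highPart hx.1 hy.2
    - 2 * traceExt_lowPart_highPart hy.1 hx.2 + traceExt_comm_below hx.2 y.2
    - traceExt_comm_above hx.1 y.1

theorem diagPair_comm (f g : ℤ → ℂ) : diagPair f * diagPair g = diagPair g * diagPair f := by
  have h : diag f * diag g = diag g * diag f := by
    ext k n
    rw [diag_mul_apply, diag_mul_apply, diag_apply, diag_apply]
    split_ifs <;> ring
  exact Prod.ext (Subtype.ext h) (Subtype.ext h)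

/-- Commutation with a function acts coefficientwise and preserves degrees, so it commutes with both
halves. -/
theorem skewR_ad (p : ℤ → ℂ) (x : PairRing) :
    skewR (diagPair p * x - x * diagPair p) = diagPair p * skewR x - skewR x * diagPair p := by
  refine Prod.ext (Subtype.ext (DiffOp.ext fun k n => ?_))
    (Subtype.ext (DiffOp.ext fun k n => ?_))
  · change (diag p * x.1.1 - x.1.1 * diag p - (2 : ℂ) • lowHalf
      (diag p * x.1.1 - x.1.1 * diag p + (diag p * x.2.1 - x.2.1 * diag p))) k n
      = (diag p * (x.1.1 - (2 : ℂ) • lowHalf (x.1.1 + x.2.1))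
        - (x.1.1 - (2 : ℂ) • lowHalf (x.1.1 + x.2.1)) * diag p) k n
    simp only [sub_apply, smul_apply, lowHalf_apply, add_apply, diag_mul_apply, mul_diag_apply]
    ring
  · change (-(diag p * x.2.1 - x.2.1 * diag p) + (2 : ℂ) • highHalf
      (diag p * x.1.1 - x.1.1 * diag p + (diag p * x.2.1 - x.2.1 * diag p))) k n
      = (diag p * (-x.2.1 + (2 : ℂ) • highHalf (x.1.1 + x.2.1))
        - (-x.2.1 + (2 : ℂ) • highHalf (x.1.1 + x.2.1)) * diag p) k n
    simp only [sub_apply, smul_apply, highHalf_apply, add_apply, neg_apply, diag_mul_apply,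
      mul_diag_apply]
    ring

theorem pairTrace_mul_diagPair {x : PairRing} (hx : x ∈ coupledIdeal) (g : ℤ → ℂ) :
    pairTrace (x * diagPair g) = ∑ᶠ n, resSum x n * g n := by
  rw [pairTrace_eq (coupledIdeal_mul_right hx _)]
  change ((x.1 : DiffOp) * diag g).trace + ((x.2 : DiffOp) * diag g).trace = _
  rw [trace_mul_diag, trace_mul_diag, ← finsum_add_distrib]
  · exact finsum_congr fun n => by rw [resSum_apply]; ring
  · exact (hx.1.1 0).subset fun n hn => left_ne_zero_of_mul hn
  · exact (hx.2.1 0).subset fun n hn => left_ne_zero_of_mul hn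

theorem resSum_finite {x : PairRing} (hx : x ∈ coupledIdeal) :
    (Function.support (resSum x)).Finite :=
  ((hx.1.1 0).union (hx.2.1 0)).subset (Function.support_add _ _)

/-- The band part `x_+ - x̂_-` of a pair with coefficients of finite support. -/
noncomputable def band (x : PairRing) : DiffOp := highHalf x.1 - lowHalf x.2

theorem band_mem_finCoeff {x : PairRing} (hx : x ∈ coupledIdeal) : band x ∈ finCoeff :=
  sub_mem (highHalf_mem_finCoeff hx.1.1) (lowHalf_mem_finCoeff hx.2.1)

theorem band_mem_bddAboveOp (x : PairRing) : band x ∈ bddAboveOp :=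
  sub_mem ⟨_, highHalf_mem_degLT x.1.2.choose_spec⟩ ⟨1, lowHalf_mem_degLT _⟩

theorem band_mem_bddBelowOp (x : PairRing) : band x ∈ bddBelowOp :=
  sub_mem ⟨0, highHalf_mem_degGE _⟩ ⟨_, lowHalf_mem_degGE x.2.2.choose_spec⟩

/-- Degree-zero coefficients commute, so the commutator has negative degree and its product with z
has no residue. -/
theorem traceExt_commutator_above {x y z : bddAboveOp} (hx : (x : DiffOp) ∈ degLT 1)
    (hy : (y : DiffOp) ∈ degLT 1) (hz : (z : DiffOp) ∈ degLT 1) (hz' : (z : DiffOp) ∈ minusAlg) :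
    traceExt ↑((x * y - y * x) * z) = 0 := by
  have h : ((x * y - y * x : bddAboveOp) : DiffOp) ∈ degLT (-1 + 1) := by
    refine mem_degLT.2 fun k hk n => ?_
    change ((x : DiffOp) * y) k n - ((y : DiffOp) * x) k n = 0
    rcases eq_or_lt_of_le hk with rfl | hk
    · have h1 := mul_apply_top (p := 0) (q := 0) hx hy n
      have h2 := mul_apply_top (p := 0) (q := 0) hy hx n
      simp only [add_zero] at h1 h2
      rw [neg_add_cancel, h1, h2, mul_comm, sub_self]
    · rw [mem_degLT.1 (mul_mem_degLT (p := 0) (q := 0) hx hy) k (by omega),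
        mem_degLT.1 (mul_mem_degLT (p := 0) (q := 0) hy hx) k (by omega), sub_self]
  rw [coe_mul_above, traceExt_apply (mul_mem_minusAlg_right (x * y - y * x).2 hz').1]
  have h0 := mem_degLT.1 (mul_mem_degLT (q := 0) h hz) 0 (by norm_num)
  exact (finsum_congr h0).trans finsum_zero

theorem traceExt_commutator_below {x y z : bddBelowOp} (hx : (x : DiffOp) ∈ degGE 0)
    (hy : (y : DiffOp) ∈ degGE 0) (hz : (z : DiffOp) ∈ degGE 0) (hz' : (z : DiffOp) ∈ plusAlg) :
    traceExt ↑((x * y - y * x) * z) = 0 := by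
  have h : ((x * y - y * x : bddBelowOp) : DiffOp) ∈ degGE 1 := by
    refine mem_degGE.2 fun k hk n => ?_
    change ((x : DiffOp) * y) k n - ((y : DiffOp) * x) k n = 0
    rcases eq_or_lt_of_le (show k ≤ 0 by omega) with rfl | hk
    · have h1 := mul_apply_bot hx hy n
      have h2 := mul_apply_bot hy hx n
      simp only [add_zero] at h1 h2
      rw [h1, h2, mul_comm, sub_self]
    · rw [mem_degGE.1 (mul_mem_degGE hx hy) k (by omega),
        mem_degGE.1 (mul_mem_degGE hy hx) k (by omega), sub_self]
  rw [coe_mul_below, traceExt_apply (mul_mem_plusAlg_right (x * y - y * x).2 hz').1]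
  have h0 := mem_degGE.1 (mul_mem_degGE h hz) 0 (by norm_num)
  exact (finsum_congr h0).trans finsum_zero

/-- With c = `band` x and p, q the low and high halves of the total, x = (c + p, -c + q) and `skewR
x` = (c - p, c + q). Up to sign both components have the shape of `commutator_sum_halves`, the
second with -q for p. What remains are the cubic terms of the triangular parts, which vanish, and
those of the band part. -/
theorem skewR_yang_baxter {x y z : PairRing} (hx : x ∈ coupledIdeal) (hy : y ∈ coupledIdeal)
    (hz : z ∈ coupledIdeal) :
    pairTrace ((skewR x * skewR y - skewR y * skewR x) * z)
      + pairTrace ((skewR y * skewR z - skewR z * skewR y) * x)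
      + pairTrace ((skewR z * skewR x - skewR x * skewR z) * y)
      = -pairTrace ((x * y - y * x) * z) := by
  let c : PairRing → bddAboveOp := fun x => ⟨band x, band_mem_bddAboveOp x⟩
  let c' : PairRing → bddBelowOp := fun x => ⟨band x, band_mem_bddBelowOp x⟩
  let p : PairRing → bddAboveOp := fun x => lowPart (total x)
  let q : PairRing → bddBelowOp := fun x => highPart (total x)
  have e1 : ∀ x : PairRing, x.1 = c x + p x := fun x => Subtype.ext (by
    change (x.1 : DiffOp) = highHalf x.1 - lowHalf x.2 + lowHalf (x.1 + x.2)
    rw [map_add]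
    nth_rewrite 1 [← lowHalf_add_highHalf x.1]
    abel)
  have e2 : ∀ x : PairRing, x.2 = -(c' x + -q x) := fun x => Subtype.ext (by
    change (x.2 : DiffOp) = -(highHalf x.1 - lowHalf x.2 + -highHalf (x.1 + x.2))
    rw [map_add]
    nth_rewrite 1 [← lowHalf_add_highHalf x.2]
    abel)
  have s1 : ∀ x : PairRing, (skewR x).1 = c x - p x := fun x => by
    change x.1 - (2 : ℂ) • p x = _
    rw [e1 x]; module
  have s2 : ∀ x : PairRing, (skewR x).2 = c' x - -q x := fun x => by
    change -x.2 + (2 : ℂ) • q x = _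
    rw [e2 x]; module
  let J : Submodule ℂ bddAboveOp := minusAlg.comap bddAboveOp.subtype
  let J' : Submodule ℂ bddBelowOp := plusAlg.comap bddBelowOp.subtype
  have hc : ∀ {x : PairRing}, x ∈ coupledIdeal → c x ∈ J := fun {x} hx =>
    ⟨band_mem_finCoeff hx, (c x).2⟩
  have hc' : ∀ {x : PairRing}, x ∈ coupledIdeal → c' x ∈ J' := fun {x} hx =>
    ⟨band_mem_finCoeff hx, (c' x).2⟩
  have hp : ∀ {x : PairRing}, x ∈ coupledIdeal → p x ∈ J := fun {x} hx =>
    ⟨lowHalf_mem_finCoeff (add_mem hx.1.1 hx.2.1), (p x).2⟩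
  have hq : ∀ {x : PairRing}, x ∈ coupledIdeal → -q x ∈ J' := fun {x} hx => neg_mem
    ⟨highHalf_mem_finCoeff (add_mem hx.1.1 hx.2.1), (q x).2⟩
  have h1 := commutator_sum_halves (traceExt ∘ₗ bddAboveOp.subtype) J
    (fun _ hx y => traceExt_comm_above hx y) (hc hx) (hp hx) (hc hy) (hp hy)
    (c'' := c z) (p'' := p z)
  have h2 := commutator_sum_halves (traceExt ∘ₗ bddBelowOp.subtype) J'
    (fun _ hx y => traceExt_comm_below hx y) (hc' hx) (hq hx) (hc' hy) (hq hy)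
    (c'' := c' z) (p'' := -q z)
  have h3 : traceExt ↑((p x * p y - p y * p x) * p z) = 0 := traceExt_commutator_above
    (lowHalf_mem_degLT _) (lowHalf_mem_degLT _) (lowHalf_mem_degLT _) (hp hz)
  have h4 : traceExt ↑((-q x * -q y - -q y * -q x) * -q z) = 0 := traceExt_commutator_below
    (neg_mem (highHalf_mem_degGE _)) (neg_mem (highHalf_mem_degGE _))
    (neg_mem (highHalf_mem_degGE _)) (hq hz)
  -- The band operator is the same formal operator in both rings, so its cubic terms cancel in the
  -- difference of the two components.
  have h5 : traceExt ↑((c x * c y - c y * c x) * c z)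
    = traceExt ↑((c' x * c' y - c' y * c' x) * c' z) := rfl
  simp only [LinearMap.comp_apply, Submodule.subtype_apply] at h1 h2
  rw [h3, h5] at h1
  rw [h4] at h2
  have e : ((x * y - y * x) * z).1 = ((c x + p x) * (c y + p y) - (c y + p y) * (c x + p x))
      * (c z + p z) := by
    rw [← e1, ← e1, ← e1]; rfl
  have e' : ((x * y - y * x) * z).2 = -(((c' x + -q x) * (c' y + -q y)
      - (c' y + -q y) * (c' x + -q x)) * (c' z + -q z)) := by
    change (x.2 * y.2 - y.2 * x.2) * z.2 = _
    rw [e2 x, e2 y, e2 z, neg_mul_neg, neg_mul_neg, mul_neg]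
  have f : ∀ u v w : PairRing, ((skewR u * skewR v - skewR v * skewR u) * w).1
      = ((c u - p u) * (c v - p v) - (c v - p v) * (c u - p u)) * (c w + p w) := fun u v w => by
    rw [← e1, ← s1, ← s1]; rfl
  have f' : ∀ u v w : PairRing, ((skewR u * skewR v - skewR v * skewR u) * w).2
      = -(((c' u - -q u) * (c' v - -q v) - (c' v - -q v) * (c' u - -q u)) * (c' w + -q w)) :=
    fun u v w => by
      change ((skewR u).2 * (skewR v).2 - (skewR v).2 * (skewR u).2) * w.2 = _
      rw [s2, s2, e2 w, mul_neg]
  simp only [pairTrace_apply, f, f', e, e', Submodule.coe_neg, map_neg]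
  linear_combination h1 - h2

end Toda

/-! ### The expansions of (1 - Λᴺ)⁻¹ and their adjoints. -/

theorem finsum_nat_succ {f : ℕ → ℂ} (hf : (Function.support f).Finite) :
    ∑ᶠ k, f k = f 0 + ∑ᶠ k, f (k + 1) := by
  obtain ⟨K, hK⟩ := hf.bddAbove
  rw [finsum_eq_sum_of_support_subset (s := Finset.range (K + 2)),
    finsum_eq_sum_of_support_subset (s := Finset.range (K + 1)), Finset.sum_range_succ', add_comm]
  · intro k hk
    have := hK (show k + 1 ∈ Function.support f from hk)
    rw [Finset.coe_range, Set.mem_Iio]; omega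
  · intro k hk
    have := hK hk
    rw [Finset.coe_range, Set.mem_Iio]; omega

namespace Toda

/-- Functions of finite support on `ℤ`. -/
noncomputable def finFun : Submodule ℂ (ℤ → ℂ) where
  carrier := {g | (Function.support g).Finite}
  zero_mem' := by
    change (Function.support (0 : ℤ → ℂ)).Finite
    rw [Function.support_zero]; exact Set.finite_empty
  add_mem' := fun {f g} hf hg => (hf.union hg).subset (Function.support_add f g)
  smul_mem' := fun c f hf => hf.subset (Function.support_const_smul_subset c f)

section Inverse

variable {N : ℕ} {f g : ℤ → ℂ}

theorem support_forward_finite (hN : 0 < N) (hg : g ∈ finFun) (n : ℤ) :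
    (Function.support fun k : ℕ => g (n + k * N)).Finite := by
  refine Set.Finite.preimage (f := fun k : ℕ => n + (k : ℤ) * N) (fun k _ l _ h => ?_) hg
  have h' : (k : ℤ) * N = l * N := add_left_cancel h
  exact_mod_cast mul_right_cancel₀ (by exact_mod_cast hN.ne') h'

theorem support_backward_finite (hN : 0 < N) (hg : g ∈ finFun) (n : ℤ) :
    (Function.support fun k : ℕ => g (n - (k + 1) * N)).Finite := by
  refine Set.Finite.preimage (f := fun k : ℕ => n - ((k : ℤ) + 1) * N) (fun k _ l _ h => ?_) hg
  have h' : ((k : ℤ) + 1) * N = (l + 1) * N := sub_right_injective h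
  have := mul_right_cancel₀ (by exact_mod_cast hN.ne') h'
  omega

theorem invForward_add (hN : 0 < N) (hf : f ∈ finFun) (hg : g ∈ finFun) (n : ℤ) :
    invForward N (f + g) n = invForward N f n + invForward N g n :=
  finsum_add_distrib (support_forward_finite hN hf n) (support_forward_finite hN hg n)

theorem invForward_smul (c : ℂ) (n : ℤ) : invForward N (c • g) n = c * invForward N g n :=
  (smul_finsum c fun k : ℕ => g (n + k * N)).symm

theorem invBackward_add (hN : 0 < N) (hf : f ∈ finFun) (hg : g ∈ finFun) (n : ℤ) :
    invBackward N (f + g) n = invBackward N f n + invBackward N g n := by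
  have h := finsum_add_distrib (support_backward_finite hN hf n) (support_backward_finite hN hg n)
  simp only [invBackward, Pi.add_apply]
  rw [h]; ring

theorem invBackward_smul (c : ℂ) (n : ℤ) : invBackward N (c • g) n = c * invBackward N g n := by
  have h := smul_finsum c fun k : ℕ => g (n - (k + 1) * N)
  simp only [smul_eq_mul] at h
  simp only [invBackward, Pi.smul_apply, smul_eq_mul]
  rw [← h]; ring

/-- The series telescopes. Finite support of g is essential, since an infinite `finsum` would be
zero by convention. -/
theorem invForward_sub_shift (hN : 0 < N) (hg : g ∈ finFun) (n : ℤ) :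
    invForward N g n - invForward N g (n + N) = g n := by
  rw [invForward, invForward, finsum_nat_succ (support_forward_finite hN hg n), Nat.cast_zero,
    zero_mul, add_zero, sub_eq_iff_eq_add]
  refine congrArg _ (finsum_congr fun k => ?_)
  push_cast; congr 1; ring

theorem invBackward_sub_shift (hN : 0 < N) (hg : g ∈ finFun) (n : ℤ) :
    invBackward N g n - invBackward N g (n + N) = g n := by
  rw [invBackward, invBackward, finsum_nat_succ (support_backward_finite hN hg (n + N)),
    Nat.cast_zero, zero_add, one_mul, add_sub_cancel_right]
  have h : ∀ k : ℕ, g (n + N - ((k + 1 : ℕ) + 1) * N) = g (n - (k + 1) * N) := fun k => by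
    push_cast; congr 1; ring
  rw [finsum_congr h]; ring

theorem invSym_add (hN : 0 < N) (hf : f ∈ finFun) (hg : g ∈ finFun) (n : ℤ) :
    invSym N (f + g) n = invSym N f n + invSym N g n := by
  simp only [invSym, invForward_add hN hf hg, invBackward_add hN hf hg]; ring

theorem invSym_smul (c : ℂ) (n : ℤ) : invSym N (c • g) n = c * invSym N g n := by
  simp only [invSym, invForward_smul, invBackward_smul]; ring

theorem invSym_sub_shift (hN : 0 < N) (hg : g ∈ finFun) (n : ℤ) :
    invSym N g n - invSym N g (n + N) = g n := by
  simp only [invSym]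
  linear_combination (1 / 2) * invForward_sub_shift hN hg n
    + (1 / 2) * invBackward_sub_shift hN hg n

/-- Both sides are one finite sum over pairs (n, k), reindexed by n ↦ n + (k + j)N. The offsets j =
0 and j = 1 account for the expansion itself and for its shift by Λᴺ. -/
theorem finsum_forward_adjoint (hN : 0 < N) (hf : f ∈ finFun) (hg : g ∈ finFun) (j : ℤ) :
    ∑ᶠ n : ℤ, f n * ∑ᶠ k : ℕ, g (n + (k + j) * N)
      = ∑ᶠ n : ℤ, g n * ∑ᶠ k : ℕ, f (n - (k + j) * N) := by
  let e : ℤ × ℕ ≃ ℤ × ℕ :=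
    { toFun := fun p => (p.1 + (p.2 + j) * N, p.2)
      invFun := fun p => (p.1 - (p.2 + j) * N, p.2)
      left_inv := fun p => by simp
      right_inv := fun p => by simp }
  have h1 : (Function.support fun p : ℤ × ℕ => f p.1 * g (p.1 + (p.2 + j) * N)).Finite := by
    have hi : Function.Injective fun p : ℤ × ℕ => (p.1, p.1 + ((p.2 : ℤ) + j) * N) := by
      rintro ⟨n, k⟩ ⟨n', k'⟩ h
      obtain ⟨rfl, h⟩ := Prod.mk.inj h
      have h' := mul_right_cancel₀ (by exact_mod_cast hN.ne') (add_left_cancel h)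
      rw [Prod.mk.injEq]; omega
    exact ((hf.prod hg).preimage hi.injOn).subset fun p hp =>
      ⟨left_ne_zero_of_mul hp, right_ne_zero_of_mul hp⟩
  have h2 : (Function.support fun p : ℤ × ℕ => g p.1 * f (p.1 - (p.2 + j) * N)).Finite := by
    refine (h1.preimage e.symm.injective.injOn).subset fun p hp => ?_
    simpa [e, mul_comm, and_comm] using hp
  have l : ∀ n, f n * ∑ᶠ k : ℕ, g (n + (k + j) * N) = ∑ᶠ k : ℕ, f n * g (n + (k + j) * N) :=
    fun n => smul_finsum (f n) fun k : ℕ => g (n + (k + j) * N)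
  have r : ∀ n, g n * ∑ᶠ k : ℕ, f (n - (k + j) * N) = ∑ᶠ k : ℕ, g n * f (n - (k + j) * N) :=
    fun n => smul_finsum (g n) fun k : ℕ => f (n - (k + j) * N)
  rw [finsum_congr l, finsum_congr r, ← finsum_curry _ h1, ← finsum_curry _ h2,
    ← finsum_comp_equiv e.symm]
  exact finsum_congr fun p => by simp [e, mul_comm]

theorem finsum_mul_add_distrib (hf : f ∈ finFun) (u v : ℤ → ℂ) :
    ∑ᶠ n, f n * (u n + v n) = ∑ᶠ n, f n * u n + ∑ᶠ n, f n * v n := by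
  rw [← finsum_add_distrib]
  · exact finsum_congr fun n => mul_add _ _ _
  · exact hf.subset fun n hn => left_ne_zero_of_mul hn
  · exact hf.subset fun n hn => left_ne_zero_of_mul hn

theorem finsum_mul_const_mul (c : ℂ) (f u : ℤ → ℂ) :
    ∑ᶠ n, f n * (c * u n) = c * ∑ᶠ n, f n * u n := by
  have h := smul_finsum c fun n => f n * u n
  simp only [smul_eq_mul] at h
  rw [h]
  exact finsum_congr fun n => by ring

/-- The adjoint of `(1 + Λᴺ)(1 - Λᴺ)⁻¹`, expanded in one direction, is minus its expansion in the
other direction. -/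
theorem finsum_forward_eq_neg_backward (hN : 0 < N) (hf : f ∈ finFun) (hg : g ∈ finFun) :
    ∑ᶠ n, f n * (invForward N g n + invForward N g (n + N))
      = -∑ᶠ n, g n * (invBackward N f n + invBackward N f (n + N)) := by
  have h0 := finsum_forward_adjoint hN hf hg 0
  have h1 := finsum_forward_adjoint hN hf hg 1
  have e1 : ∀ n, invForward N g n = ∑ᶠ k : ℕ, g (n + (k + 0) * N) := fun n =>
    finsum_congr fun k => by rw [add_zero]
  have e2 : ∀ n, invForward N g (n + N) = ∑ᶠ k : ℕ, g (n + (k + 1) * N) := fun n =>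
    finsum_congr fun k => congrArg g (by ring)
  have e3 : ∀ n, invBackward N f n = -1 * ∑ᶠ k : ℕ, f (n - (k + 1) * N) := fun n => by
    rw [invBackward, neg_one_mul]
  have e4 : ∀ n, invBackward N f (n + N) = -1 * ∑ᶠ k : ℕ, f (n - (k + 0) * N) := fun n => by
    rw [invBackward, neg_one_mul]
    exact congrArg _ (finsum_congr fun k => congrArg f (by ring))
  rw [finsum_mul_add_distrib hf, finsum_mul_add_distrib hg]
  simp only [e2, e4]
  simp only [e1, e3, finsum_mul_const_mul]
  rw [h0, h1]; ring

/-- Each one-sided operator is minus the adjoint of the other, so their mean is skew. -/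
theorem finsum_invSym_skew (hN : 0 < N) (hf : f ∈ finFun) (hg : g ∈ finFun) :
    ∑ᶠ n, f n * (invSym N g n + invSym N g (n + N))
      = -∑ᶠ n, g n * (invSym N f n + invSym N f (n + N)) := by
  have h : ∀ g n, invSym N g n + invSym N g (n + N)
      = 1 / 2 * ((invForward N g n + invForward N g (n + N))
        + (invBackward N g n + invBackward N g (n + N))) := fun g n => by
    simp only [invSym]; ring
  simp only [h, finsum_mul_const_mul]
  rw [finsum_mul_add_distrib hf, finsum_mul_add_distrib hg]
  linear_combination (1 / 2) * finsum_forward_eq_neg_backward hN hf hg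
    + (1 / 2) * finsum_forward_eq_neg_backward hN hg hf

/-- A linear extension of `(1 + Λᴺ)(1 - Λᴺ)⁻¹` to all functions. -/
theorem exists_linear_extension (hN : 0 < N) : ∃ C : (ℤ → ℂ) →ₗ[ℂ] (ℤ → ℂ),
    ∀ g ∈ finFun, C g = fun n => invSym N g n + invSym N g (n + N) := by
  obtain ⟨C, hC⟩ := LinearMap.exists_extend (p := finFun)
    { toFun := fun g n => invSym N g.1 n + invSym N g.1 (n + N)
      map_add' := fun f g => funext fun n => by
        simp only [Submodule.coe_add, invSym_add hN f.2 g.2, Pi.add_apply]; ring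
      map_smul' := fun c g => funext fun n => by
        simp only [Submodule.coe_smul, invSym_smul, Pi.smul_apply, smul_eq_mul,
          RingHom.id_apply]; ring }
  exact ⟨C, fun g hg => LinearMap.congr_fun hC ⟨g, hg⟩⟩

end Inverse

end Toda

/-! ### The tensors P₁ and P₂ as instances of the abstract bracket. -/

namespace Toda

open DiffOp

/-- Serves both diagonal operators: σ = 1 with the identity for δ, σ = -1 with the skew correction
for γ. -/
theorem pairTrace_diagPair_symm (C : (ℤ → ℂ) →ₗ[ℂ] (ℤ → ℂ)) {σ : ℂ}
    (hC : ∀ f ∈ finFun, ∀ g ∈ finFun, ∑ᶠ n, f n * C g n = σ * ∑ᶠ n, g n * C f n)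
    {x y : PairRing} (hx : x ∈ coupledIdeal) (hy : y ∈ coupledIdeal) :
    pairTrace (x * diagPair (C (resSum y))) = σ * pairTrace (y * diagPair (C (resSum x))) := by
  rw [pairTrace_mul_diagPair hx, pairTrace_mul_diagPair hy]
  exact hC _ (resSum_finite hx) _ (resSum_finite hy)

/-- The quadratic bracket on pairs of difference operators, with a skew-adjoint correction `C`. -/
noncomputable def sklyanin (C : (ℤ → ℂ) →ₗ[ℂ] (ℤ → ℂ))
    (hC : ∀ f ∈ finFun, ∀ g ∈ finFun, ∑ᶠ n, f n * C g n = -∑ᶠ n, g n * C f n) :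
    SklyaninData PairRing where
  T := pairTrace
  I := coupledIdeal
  mul_left _ hx y := coupledIdeal_mul_left hx y
  mul_right _ hx y := coupledIdeal_mul_right hx y
  cyclic _ hx y := pairTrace_cyclic hx y
  s := skewR
  skew _ hx _ hy := skewR_skew hx hy
  yang_baxter _ hx _ hy _ hz := skewR_yang_baxter hx hy hz
  D := LinearMap.range diagPair
  comm := by
    rintro _ ⟨f, rfl⟩ _ ⟨g, rfl⟩
    exact diagPair_comm f g
  ad := by
    rintro _ ⟨p, rfl⟩ x
    exact skewR_ad p x
  δ := diagPair ∘ₗ resSum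
  δ_mem x := ⟨_, rfl⟩
  δ_symm x hx y hy := by
    have h := pairTrace_diagPair_symm (LinearMap.id) (σ := 1) (fun f _ g _ => by
      rw [one_mul]; exact finsum_congr fun n => mul_comm _ _) hx hy
    rwa [one_mul] at h
  γ := diagPair ∘ₗ C ∘ₗ resSum
  γ_mem x := ⟨_, rfl⟩
  γ_skew x hx y hy := by
    have h := pairTrace_diagPair_symm C (σ := -1) (fun f hf g hg => by
      rw [hC f hf g hg, neg_one_mul]) hx hy
    rwa [neg_one_mul] at h

/-- Sharp truncations differ from the symmetric halves by half of the diagonal. These diagonal terms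
are the source of δ. -/
theorem lt_zero_eq (U : DiffOp) : U.lt 0 = lowHalf U - (1 / 2 : ℂ) • diag (U 0) := by
  ext k n
  simp only [lt_apply, sub_apply, smul_apply, lowHalf_apply, diag_apply]
  split_ifs with h1 h2 h2
  · omega
  · ring
  · rw [h2]; ring
  · ring

theorem lt_one_eq (U : DiffOp) : U.lt 1 = lowHalf U + (1 / 2 : ℂ) • diag (U 0) := by
  ext k n
  simp only [lt_apply, add_apply, smul_apply, lowHalf_apply, diag_apply]
  split_ifs <;> first | omega | simp_all <;> ring

theorem ge_zero_eq (U : DiffOp) : U.ge 0 = highHalf U + (1 / 2 : ℂ) • diag (U 0) := by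
  rw [eq_sub_of_add_eq' (lt_add_ge U 0), lt_zero_eq, eq_sub_of_add_eq' (lowHalf_add_highHalf U)]
  abel

theorem ge_one_eq (U : DiffOp) : U.ge 1 = highHalf U - (1 / 2 : ℂ) • diag (U 0) := by
  rw [eq_sub_of_add_eq' (lt_add_ge U 1), lt_one_eq, eq_sub_of_add_eq' (lowHalf_add_highHalf U)]
  abel

theorem diag_resSum (x : PairRing) :
    diag (resSum x) = diag ((x.1 : DiffOp) 0) + diag ((x.2 : DiffOp) 0) :=
  diag_add _ _

theorem coeff_add (A B : DiffOp) (k : ℤ) : (A + B) k = A k + B k := rfl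

theorem coeff_sub (A B : DiffOp) (k : ℤ) : (A - B) k = A k - B k := rfl

theorem diag_sub (f g : ℤ → ℂ) : diag (f - g) = diag f - diag g := by
  rw [eq_sub_iff_add_eq, ← diag_add, sub_add_cancel]

/-- The tensor `P₂`, in terms of the halves of the splitting. -/
theorem P2_eq (A X : PairRing) :
    P2 (toPair A) (toPair X) = toPair
      (((1 / 2 : ℂ) • skewR (A * X) + (1 / 2 : ℂ) • diagPair (resSum (X * A))) * A
        - A * ((1 / 2 : ℂ) • skewR (X * A) + (1 / 2 : ℂ) • diagPair (resSum (A * X)))) := by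
  refine Prod.ext ?_ ?_
  · let m : bddAboveOp := lowPart (total (A * X))
    let r : bddAboveOp := lowPart (total (X * A))
    let d : bddAboveOp := (diagPair (resSum (A * X))).1
    let e : bddAboveOp := (diagPair (resSum (X * A))).1
    have h1 : -(A.1.1 * X.1.1 + X.1.1 * A.1.1).lt 0 - (A.2.1 * X.2.1 + X.2.1 * A.2.1).lt 0
        = ((-(m + r) + (1 / 2 : ℂ) • (d + e) : bddAboveOp) : DiffOp) := by
      change _ = -(lowHalf (A.1.1 * X.1.1 + A.2.1 * X.2.1) + lowHalf (X.1.1 * A.1.1 + X.2.1 * A.2.1))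
        + (1 / 2 : ℂ) • (diag (resSum (A * X)) + diag (resSum (X * A)))
      simp only [lt_zero_eq, map_add, diag_resSum, coeff_add, diag_add,
        Prod.fst_mul, Prod.snd_mul, coe_mul_above, coe_mul_below]
      module
    have h2 : (⁅X.1.1, A.1.1⁆ : DiffOp).lt 1 + (⁅X.2.1, A.2.1⁆ : DiffOp).lt 1
        = ((r - m + (1 / 2 : ℂ) • (e - d) : bddAboveOp) : DiffOp) := by
      change _ = lowHalf (X.1.1 * A.1.1 + X.2.1 * A.2.1) - lowHalf (A.1.1 * X.1.1 + A.2.1 * X.2.1)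
        + (1 / 2 : ℂ) • (diag (resSum (X * A)) - diag (resSum (A * X)))
      simp only [bracket_def, lt_one_eq, map_add, map_sub, diag_resSum, coeff_sub, diag_sub,
        Prod.fst_mul, Prod.snd_mul, coe_mul_above, coe_mul_below]
      module
    -- Both sides reduce to -mA + Ar + ½(eA - Ad); the terms ±½AXA produced by the identity part of
    -- `skewR` cancel.
    have h3 : (1 / 2 : ℂ) • ((-(m + r) + (1 / 2 : ℂ) • (d + e)) * A.1
          - A.1 * (-(m + r) + (1 / 2 : ℂ) • (d + e)) + A.1 * (r - m + (1 / 2 : ℂ) • (e - d))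
          + (r - m + (1 / 2 : ℂ) • (e - d)) * A.1)
        = ((1 / 2 : ℂ) • (A.1 * X.1 - (2 : ℂ) • m) + (1 / 2 : ℂ) • e) * A.1
          - A.1 * ((1 / 2 : ℂ) • (X.1 * A.1 - (2 : ℂ) • r) + (1 / 2 : ℂ) • d) := by
      simp only [mul_add, add_mul, mul_sub, sub_mul, smul_mul_assoc, mul_smul_comm, neg_mul,
        mul_neg, mul_assoc]
      module
    change (1 / 2 : ℂ) • ((-(A.1.1 * X.1.1 + X.1.1 * A.1.1).lt 0
      - (A.2.1 * X.2.1 + X.2.1 * A.2.1).lt 0) * A.1.1 - A.1.1 * (-(A.1.1 * X.1.1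
      + X.1.1 * A.1.1).lt 0 - (A.2.1 * X.2.1 + X.2.1 * A.2.1).lt 0)
      + A.1.1 * ((⁅X.1.1, A.1.1⁆ : DiffOp).lt 1 + (⁅X.2.1, A.2.1⁆ : DiffOp).lt 1)
      + ((⁅X.1.1, A.1.1⁆ : DiffOp).lt 1 + (⁅X.2.1, A.2.1⁆ : DiffOp).lt 1) * A.1.1) = _
    rw [h1, h2]
    exact congrArg Subtype.val h3
  · let m : bddBelowOp := highPart (total (A * X))
    let r : bddBelowOp := highPart (total (X * A))
    let d : bddBelowOp := (diagPair (resSum (A * X))).2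
    let e : bddBelowOp := (diagPair (resSum (X * A))).2
    have h1 : (A.1.1 * X.1.1 + X.1.1 * A.1.1).ge 0 + (A.2.1 * X.2.1 + X.2.1 * A.2.1).ge 0
        = ((m + r + (1 / 2 : ℂ) • (d + e) : bddBelowOp) : DiffOp) := by
      change _ = highHalf (A.1.1 * X.1.1 + A.2.1 * X.2.1) + highHalf (X.1.1 * A.1.1 + X.2.1 * A.2.1)
        + (1 / 2 : ℂ) • (diag (resSum (A * X)) + diag (resSum (X * A)))
      simp only [ge_zero_eq, map_add, diag_resSum, coeff_add, diag_add,
        Prod.fst_mul, Prod.snd_mul, coe_mul_above, coe_mul_below]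
      module
    have h2 : (⁅X.1.1, A.1.1⁆ : DiffOp).ge 1 + (⁅X.2.1, A.2.1⁆ : DiffOp).ge 1
        = ((r - m - (1 / 2 : ℂ) • (e - d) : bddBelowOp) : DiffOp) := by
      change _ = highHalf (X.1.1 * A.1.1 + X.2.1 * A.2.1) - highHalf (A.1.1 * X.1.1 + A.2.1 * X.2.1)
        - (1 / 2 : ℂ) • (diag (resSum (X * A)) - diag (resSum (A * X)))
      simp only [bracket_def, ge_one_eq, map_add, map_sub, diag_resSum, coeff_sub, diag_sub,
        Prod.fst_mul, Prod.snd_mul, coe_mul_above, coe_mul_below]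
      module
    have h3 : (1 / 2 : ℂ) • ((m + r + (1 / 2 : ℂ) • (d + e)) * A.2
          - A.2 * (m + r + (1 / 2 : ℂ) • (d + e)) - A.2 * (r - m - (1 / 2 : ℂ) • (e - d))
          - (r - m - (1 / 2 : ℂ) • (e - d)) * A.2)
        = ((1 / 2 : ℂ) • (-(A.2 * X.2) + (2 : ℂ) • m) + (1 / 2 : ℂ) • e) * A.2
          - A.2 * ((1 / 2 : ℂ) • (-(X.2 * A.2) + (2 : ℂ) • r) + (1 / 2 : ℂ) • d) := by
      simp only [mul_add, add_mul, mul_sub, sub_mul, smul_mul_assoc, mul_smul_comm, neg_mul,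
        mul_neg, mul_assoc]
      module
    change (1 / 2 : ℂ) • (((A.1.1 * X.1.1 + X.1.1 * A.1.1).ge 0
      + (A.2.1 * X.2.1 + X.2.1 * A.2.1).ge 0) * A.2.1 - A.2.1 * ((A.1.1 * X.1.1
      + X.1.1 * A.1.1).ge 0 + (A.2.1 * X.2.1 + X.2.1 * A.2.1).ge 0)
      - A.2.1 * ((⁅X.1.1, A.1.1⁆ : DiffOp).ge 1 + (⁅X.2.1, A.2.1⁆ : DiffOp).ge 1)
      - ((⁅X.1.1, A.1.1⁆ : DiffOp).ge 1 + (⁅X.2.1, A.2.1⁆ : DiffOp).ge 1) * A.2.1) = _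
    rw [h1, h2]
    exact congrArg Subtype.val h3

variable (C : (ℤ → ℂ) →ₗ[ℂ] (ℤ → ℂ))
  (hC : ∀ f ∈ finFun, ∀ g ∈ finFun, ∑ᶠ n, f n * C g n = -∑ᶠ n, g n * C f n)

theorem sklyanin_a (V Z : PairRing) : (sklyanin C hC).a V Z = (1 / 2 : ℂ) • skewR (V * Z)
    + ((1 / 2 : ℂ) • diagPair (resSum (Z * V))
      - (1 / 2 : ℂ) • diagPair (C (resSum (Z * V - V * Z)))) := rfl

theorem sklyanin_b (V Z : PairRing) : (sklyanin C hC).b V Z = (1 / 2 : ℂ) • skewR (Z * V)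
    + ((1 / 2 : ℂ) • diagPair (resSum (V * Z))
      - (1 / 2 : ℂ) • diagPair (C (resSum (Z * V - V * Z)))) := rfl

theorem toPair_W (A X : PairRing) : toPair ((sklyanin C hC).W A X) = P2 (toPair A) (toPair X)
    - pairComm (diag ((1 / 2 : ℂ) • C (resSum (X * A - A * X))),
        diag ((1 / 2 : ℂ) • C (resSum (X * A - A * X)))) (toPair A) := by
  let c : PairRing := diagPair ((1 / 2 : ℂ) • C (resSum (X * A - A * X)))
  have h : (sklyanin C hC).W A X =
      (((1 / 2 : ℂ) • skewR (A * X) + (1 / 2 : ℂ) • diagPair (resSum (X * A))) * A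
        - A * ((1 / 2 : ℂ) • skewR (X * A) + (1 / 2 : ℂ) • diagPair (resSum (A * X))))
        - (c * A - A * c) := by
    simp only [SklyaninData.W, sklyanin_a, sklyanin_b, c, map_smul, add_mul, mul_add, mul_sub,
      sub_mul, smul_mul_assoc, mul_smul_comm]
    module
  rw [P2_eq, h, map_sub]
  rfl

/-- The tensor `P₁`, as the derivative of `P₂` in the direction of the identity. -/
theorem toPair_linW (A X : PairRing) :
    toPair ((sklyanin C hC).linW A X) = P1 (toPair A) (toPair X) := by
  have h0 : (sklyanin C hC).linW A X =
      (-(1 / 2 : ℂ)) • skewR (X * A - A * X)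
        + (1 / 2 : ℂ) • diagPair (resSum (X * A - A * X))
        + (((1 / 2 : ℂ) • skewR X + (1 / 2 : ℂ) • diagPair (resSum X)) * A
          - A * ((1 / 2 : ℂ) • skewR X + (1 / 2 : ℂ) • diagPair (resSum X))) := by
    simp only [SklyaninData.linW, sklyanin_a, sklyanin_b, one_mul, mul_one, sub_self, map_zero,
      map_sub, smul_zero, sub_zero]
    module
  rw [h0]
  refine Prod.ext ?_ ?_
  · let m : bddAboveOp := lowPart (total X)
    let d : bddAboveOp := (diagPair (resSum X)).1
    let r : bddAboveOp := lowPart (total (X * A - A * X))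
    let e : bddAboveOp := (diagPair (resSum (X * A - A * X))).1
    have h1 : -X.1.1.lt 0 - X.2.1.lt 0 = ((-m + (1 / 2 : ℂ) • d : bddAboveOp) : DiffOp) := by
      change _ = -lowHalf (X.1.1 + X.2.1) + (1 / 2 : ℂ) • diag (resSum X)
      simp only [lt_zero_eq, map_add, diag_resSum]
      module
    have h2 : (⁅X.1.1, A.1.1⁆ : DiffOp).lt 1 + (⁅X.2.1, A.2.1⁆ : DiffOp).lt 1
        = ((r + (1 / 2 : ℂ) • e : bddAboveOp) : DiffOp) := by
      change _ = lowHalf ((X.1.1 * A.1.1 - A.1.1 * X.1.1) + (X.2.1 * A.2.1 - A.2.1 * X.2.1))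
        + (1 / 2 : ℂ) • diag (resSum (X * A - A * X))
      rw [map_add, diag_resSum, bracket_def, bracket_def, lt_one_eq, lt_one_eq]
      change _ = _ + (1 / 2 : ℂ) • (diag ((X.1.1 * A.1.1 - A.1.1 * X.1.1) 0)
        + diag ((X.2.1 * A.2.1 - A.2.1 * X.2.1) 0))
      module
    have h3 : (-(1 / 2 : ℂ)) • ((X.1 * A.1 - A.1 * X.1) - (2 : ℂ) • r) + (1 / 2 : ℂ) • e
        + (((1 / 2 : ℂ) • (X.1 - (2 : ℂ) • m) + (1 / 2 : ℂ) • d) * A.1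
          - A.1 * ((1 / 2 : ℂ) • (X.1 - (2 : ℂ) • m) + (1 / 2 : ℂ) • d))
        = (-m + (1 / 2 : ℂ) • d) * A.1 - A.1 * (-m + (1 / 2 : ℂ) • d)
          + (r + (1 / 2 : ℂ) • e) := by
      simp only [mul_add, add_mul, mul_sub, sub_mul, smul_mul_assoc, mul_smul_comm, neg_mul,
        mul_neg]
      module
    change _ = (-X.1.1.lt 0 - X.2.1.lt 0) * A.1.1 - A.1.1 * (-X.1.1.lt 0 - X.2.1.lt 0)
      + (⁅X.1.1, A.1.1⁆ : DiffOp).lt 1 + (⁅X.2.1, A.2.1⁆ : DiffOp).lt 1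
    rw [add_assoc (_ - _), h1, h2]
    exact congrArg Subtype.val h3
  · let m : bddBelowOp := highPart (total X)
    let d : bddBelowOp := (diagPair (resSum X)).2
    let r : bddBelowOp := highPart (total (X * A - A * X))
    let e : bddBelowOp := (diagPair (resSum (X * A - A * X))).2
    have h1 : X.1.1.ge 0 + X.2.1.ge 0 = ((m + (1 / 2 : ℂ) • d : bddBelowOp) : DiffOp) := by
      change _ = highHalf (X.1.1 + X.2.1) + (1 / 2 : ℂ) • diag (resSum X)
      simp only [ge_zero_eq, map_add, diag_resSum]
      module
    have h2 : (⁅X.1.1, A.1.1⁆ : DiffOp).ge 1 + (⁅X.2.1, A.2.1⁆ : DiffOp).ge 1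
        = ((r - (1 / 2 : ℂ) • e : bddBelowOp) : DiffOp) := by
      change _ = highHalf ((X.1.1 * A.1.1 - A.1.1 * X.1.1) + (X.2.1 * A.2.1 - A.2.1 * X.2.1))
        - (1 / 2 : ℂ) • diag (resSum (X * A - A * X))
      rw [map_add, diag_resSum, bracket_def, bracket_def, ge_one_eq, ge_one_eq]
      change _ = _ - (1 / 2 : ℂ) • (diag ((X.1.1 * A.1.1 - A.1.1 * X.1.1) 0)
        + diag ((X.2.1 * A.2.1 - A.2.1 * X.2.1) 0))
      module
    have h3 : (-(1 / 2 : ℂ)) • (-(X.2 * A.2 - A.2 * X.2) + (2 : ℂ) • r) + (1 / 2 : ℂ) • e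
        + (((1 / 2 : ℂ) • (-X.2 + (2 : ℂ) • m) + (1 / 2 : ℂ) • d) * A.2
          - A.2 * ((1 / 2 : ℂ) • (-X.2 + (2 : ℂ) • m) + (1 / 2 : ℂ) • d))
        = (m + (1 / 2 : ℂ) • d) * A.2 - A.2 * (m + (1 / 2 : ℂ) • d)
          - (r - (1 / 2 : ℂ) • e) := by
      simp only [mul_add, add_mul, smul_mul_assoc, mul_smul_comm, neg_mul,
        mul_neg]
      module
    change _ = (X.1.1.ge 0 + X.2.1.ge 0) * A.2.1 - A.2.1 * (X.1.1.ge 0 + X.2.1.ge 0)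
      - (⁅X.1.1, A.1.1⁆ : DiffOp).ge 1 - (⁅X.2.1, A.2.1⁆ : DiffOp).ge 1
    rw [sub_sub (_ - _), h1, h2]
    exact congrArg Subtype.val h3

end Toda

/-! ### Gradients and Hessians of functions analytic on finite-dimensional subspaces. -/

section InfiniteDimensionalCalculus

variable {V D I : Type*} [AddCommGroup V] [Module ℂ V] [AddCommGroup D] [Module ℂ D]

/-- Analyticity on all finite-dimensional affine subspaces. -/
def AnalyticOnSubspaces (F : V → ℂ) : Prop :=
  ∀ (k : ℕ) (u : V) (v : Fin k → V),
    AnalyticOnNhd ℂ (fun c : Fin k → ℂ => F (u + ∑ i, c i • v i)) Set.univ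

/-- `dF` is the gradient of `F` with respect to the pairing `B`. -/
def IsGradient (B : D →ₗ[ℂ] V →ₗ[ℂ] ℂ) (F : V → ℂ) (dF : V → D) : Prop :=
  ∀ u v, HasDerivAt (fun t : ℂ => F (u + t • v)) (B (dF u) v) 0

/-- Dual families that express each covector through finitely many of its coordinates. -/
structure FiniteCoordinates (I : Type*) (B : D →ₗ[ℂ] V →ₗ[ℂ] ℂ) where
  e : I → V
  ε : I → D
  finite : ∀ X, ∃ s : Finset I, ∀ i ∉ s, B X (e i) = 0
  expand : ∀ X (s : Finset I), (∀ i ∉ s, B X (e i) = 0) → X = ∑ i ∈ s, B X (e i) • ε i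

theorem AnalyticOnSubspaces.line {F : V → ℂ} (hF : AnalyticOnSubspaces F) (u v : V) :
    AnalyticOnNhd ℂ (fun t : ℂ => F (u + t • v)) Set.univ := by
  have h := (hF 1 u fun _ => v).comp (f := fun t : ℂ => fun _ : Fin 1 => t)
    (s := Set.univ) (AnalyticOnNhd.pi fun _ => analyticOnNhd_id) (Set.mapsTo_univ _ _)
  simpa [Function.comp_def] using h

theorem AnalyticOnSubspaces.hasDerivAt_line {F : V → ℂ} (hF : AnalyticOnSubspaces F) (u v : V) :
    HasDerivAt (fun t : ℂ => F (u + t • v)) (deriv (fun t : ℂ => F (u + t • v)) 0) 0 :=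
  ((hF.line u v) 0 (Set.mem_univ _)).differentiableAt.hasDerivAt

variable {B : D →ₗ[ℂ] V →ₗ[ℂ] ℂ} {F H : V → ℂ} {dF dH : V → D}

/-- The partial derivatives on an affine subspace are components of the gradient. -/
theorem IsGradient.apply_eq_fderiv (hdF : IsGradient B F dF) (hF : AnalyticOnSubspaces F) {k : ℕ}
    (u : V) (v : Fin k → V) (c : Fin k → ℂ) (i : Fin k) :
    B (dF (u + ∑ j, c j • v j)) (v i)
      = fderiv ℂ (fun c : Fin k → ℂ => F (u + ∑ j, c j • v j)) c (Pi.single i 1) := by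
  have h1 : HasDerivAt (fun t : ℂ => F (u + ∑ j, (c + t • Pi.single i (1 : ℂ) : Fin k → ℂ) j • v j))
      (fderiv ℂ (fun c : Fin k → ℂ => F (u + ∑ j, c j • v j)) c (Pi.single i 1)) 0 :=
    ((hF k u v) c (Set.mem_univ _)).differentiableAt.hasFDerivAt.hasLineDerivAt (Pi.single i 1)
  have h2 : ∀ t : ℂ, u + ∑ j, (c + t • Pi.single i (1 : ℂ) : Fin k → ℂ) j • v j
      = u + ∑ j, c j • v j + t • v i := fun t => by
    rw [add_assoc]
    simp [add_smul, Finset.sum_add_distrib, Pi.single_apply, ite_smul]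
  simp only [h2] at h1
  exact (hdF (u + ∑ j, c j • v j) (v i)).unique h1

/-- Adjoin w as an additional direction: the component of the gradient along w is the partial
derivative in the new variable, restricted to where that variable is zero. -/
theorem IsGradient.analytic (hdF : IsGradient B F dF) (hF : AnalyticOnSubspaces F) (w : V) :
    AnalyticOnSubspaces fun u => B (dF u) w := by
  intro k u v
  let ι : (Fin k → ℂ) →L[ℂ] (Fin (k + 1) → ℂ) :=
    ContinuousLinearMap.pi (Fin.cons 0 fun i => ContinuousLinearMap.proj i)
  have hι : ∀ c, u + ∑ j, ι c j • (Fin.cons w v : Fin (k + 1) → V) j = u + ∑ j, c j • v j := by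
    intro c
    simp [ι, Fin.sum_univ_succ]
  have h := (((hF (k + 1) u (Fin.cons w v)).fderiv).comp (ι.analyticOnNhd Set.univ)
    (Set.mapsTo_univ _ _))
  have h' := ((ContinuousLinearMap.apply ℂ ℂ (Pi.single (0 : Fin (k + 1)) (1 : ℂ))).comp_analyticOnNhd
    h)
  refine h'.congr isOpen_univ fun c _ => ?_
  have := hdF.apply_eq_fderiv hF u (Fin.cons w v) (ι c) 0
  rw [hι, Fin.cons_zero] at this
  exact this.symm

/-- The second derivatives are symmetric. -/
theorem IsGradient.deriv_symm (hdF : IsGradient B F dF) (hF : AnalyticOnSubspaces F) (u v w : V) :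
    deriv (fun t : ℂ => B (dF (u + t • v)) w) 0 = deriv (fun t : ℂ => B (dF (u + t • w)) v) 0 := by
  let x : Fin 2 → V := ![v, w]
  let Φ : (Fin 2 → ℂ) → ℂ := fun c => F (u + ∑ j, c j • x j)
  have hΦ : AnalyticOnNhd ℂ Φ Set.univ := hF 2 u x
  have hs : fderiv ℂ (fderiv ℂ Φ) 0 (Pi.single 0 1) (Pi.single 1 1)
      = fderiv ℂ (fderiv ℂ Φ) 0 (Pi.single 1 1) (Pi.single 0 1) :=
    second_derivative_symmetric
      (fun c => (hΦ c (Set.mem_univ _)).differentiableAt.hasFDerivAt)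
      ((hΦ.fderiv 0 (Set.mem_univ _)).differentiableAt.hasFDerivAt) _ _
  have key : ∀ i j : Fin 2, HasDerivAt (fun t : ℂ => B (dF (u + t • x i)) (x j))
      (fderiv ℂ (fderiv ℂ Φ) 0 (Pi.single i 1) (Pi.single j 1)) 0 := by
    intro i j
    have h1 := ((hΦ.fderiv 0 (Set.mem_univ _)).differentiableAt.hasFDerivAt.hasLineDerivAt
      (Pi.single i 1))
    have h2 := (ContinuousLinearMap.apply ℂ ℂ
      (Pi.single j (1 : ℂ) : Fin 2 → ℂ)).hasFDerivAt.comp_hasDerivAt (0 : ℂ) h1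
    refine h2.congr_of_eventuallyEq (Filter.Eventually.of_forall fun t => ?_)
    have h3 := hdF.apply_eq_fderiv hF u x (t • Pi.single i 1) j
    have h4 : ∑ l, (t • Pi.single i (1 : ℂ) : Fin 2 → ℂ) l • x l = t • x i := by
      simp [Pi.single_apply, ite_smul]
    rw [h4] at h3
    change B (dF (u + t • x i)) (x j) = _
    rw [h3]
    simp [Φ]
  exact ((key 0 1).deriv.trans hs).trans (key 1 0).deriv.symm

/-- On a finite-dimensional affine subspace the gradient has finitely many coordinates. -/
theorem IsGradient.exists_finset [Countable I] (S : FiniteCoordinates I B)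
    (hdF : IsGradient B F dF) (hF : AnalyticOnSubspaces F) {k : ℕ} (u : V) (v : Fin k → V) :
    ∃ s : Finset I, ∀ c : Fin k → ℂ, ∀ i ∉ s, B (dF (u + ∑ j, c j • v j)) (S.e i) = 0 := by
  have ha : ∀ i, AnalyticOnNhd ℂ (fun c : Fin k → ℂ => B (dF (u + ∑ j, c j • v j)) (S.e i))
      Set.univ := fun i => hdF.analytic hF (S.e i) k u v
  -- The countably many closed sets `K s` cover the parameter space, so by Baire one has interior;
  -- there each coordinate outside s vanishes, and by the identity theorem it vanishes everywhere.
  let K : Finset I → Set (Fin k → ℂ) := fun s =>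
    {c | ∀ i ∉ s, B (dF (u + ∑ j, c j • v j)) (S.e i) = 0}
  have hK : ∀ s, IsClosed (K s) := by
    intro s
    have : K s = ⋂ i, ⋂ (_ : i ∉ s), {c | B (dF (u + ∑ j, c j • v j)) (S.e i) = 0} := by
      ext c; simp [K]
    rw [this]
    exact isClosed_iInter fun i => isClosed_iInter fun _ => isClosed_eq
      (continuousOn_univ.1 (ha i).continuousOn) continuous_const
  have hU : ⋃ s, K s = Set.univ := Set.eq_univ_of_forall fun c =>
    Set.mem_iUnion.2 (S.finite (dF (u + ∑ j, c j • v j)))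
  obtain ⟨s, c, hc⟩ := nonempty_interior_of_iUnion_of_closed hK hU
  refine ⟨s, fun c' i hi => ?_⟩
  refine (ha i).eqOn_zero_of_preconnected_of_eventuallyEq_zero isPreconnected_univ
    (Set.mem_univ c) ?_ (Set.mem_univ c')
  filter_upwards [mem_interior_iff_mem_nhds.1 hc] with c'' h
  exact h i hi

theorem IsGradient.exists_finset_line [Countable I] (S : FiniteCoordinates I B)
    (hdF : IsGradient B F dF) (hF : AnalyticOnSubspaces F) (u v : V) :
    ∃ s : Finset I, ∀ t : ℂ, dF (u + t • v) = ∑ i ∈ s, B (dF (u + t • v)) (S.e i) • S.ε i := by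
  obtain ⟨s, hs⟩ := hdF.exists_finset S hF (k := 1) u fun _ => v
  refine ⟨s, fun t => S.expand _ s fun i hi => ?_⟩
  simpa using hs (fun _ => t) i hi

/-- The second derivative in a fixed direction is represented by a covector. -/
theorem IsGradient.exists_hessian [Countable I] (S : FiniteCoordinates I B)
    (hdF : IsGradient B F dF) (hF : AnalyticOnSubspaces F) (u w : V) :
    ∃ Z : D, ∀ v, HasDerivAt (fun t : ℂ => B (dF (u + t • w)) v) (B Z v) 0 ∧
      HasDerivAt (fun t : ℂ => B (dF (u + t • v)) w) (B Z v) 0 := by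
  obtain ⟨s, hs⟩ := hdF.exists_finset_line S hF u w
  -- Along the line only the finitely many coordinates in s vary, so differentiating them one by one
  -- still yields a covector.
  refine ⟨∑ i ∈ s, deriv (fun t : ℂ => B (dF (u + t • w)) (S.e i)) 0 • S.ε i, fun v => ?_⟩
  have h : HasDerivAt (fun t : ℂ => B (dF (u + t • w)) v)
      (B (∑ i ∈ s, deriv (fun t : ℂ => B (dF (u + t • w)) (S.e i)) 0 • S.ε i) v) 0 := by
    have h1 : ∀ t : ℂ, B (dF (u + t • w)) v
        = ∑ i ∈ s, B (dF (u + t • w)) (S.e i) * B (S.ε i) v := fun t => by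
      conv_lhs => rw [hs t]
      simp
    simp only [h1, map_sum, map_smul, LinearMap.sum_apply, LinearMap.smul_apply, smul_eq_mul]
    exact HasDerivAt.fun_sum fun i _ =>
      ((hdF.analytic hF (S.e i)).hasDerivAt_line u w).mul_const _
  refine ⟨h, ?_⟩
  have h2 := (hdF.analytic hF w).hasDerivAt_line u v
  rwa [hdF.deriv_symm hF, h.deriv] at h2

end InfiniteDimensionalCalculus

/-! ### Brackets of functionals from a skew tensor. -/

section PoissonBrackets

variable {V D I : Type*} [AddCommGroup V] [Module ℂ V] [AddCommGroup D] [Module ℂ D]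

/-- A skew tensor whose components are functionals with gradients `Γ`. -/
structure SkewTensor (B : D →ₗ[ℂ] V →ₗ[ℂ] ℂ) where
  P : V → D →ₗ[ℂ] V
  Γ : D → D → V → D
  skew : ∀ u X Y, B X (P u Y) = -B Y (P u X)
  analytic : ∀ X Y, AnalyticOnSubspaces fun u => B X (P u Y)
  gradient : ∀ X Y, IsGradient B (fun u => B X (P u Y)) (Γ X Y)

namespace SkewTensor

variable {B : D →ₗ[ℂ] V →ₗ[ℂ] ℂ} (T : SkewTensor B)

/-- The bracket of functions with gradients `dF` and `dH`. -/
def bracket (dF dH : V → D) : V → ℂ := fun u => B (dF u) (T.P u (dH u))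

variable {F G H : V → ℂ} {dF dG dH : V → D}

theorem apply_sum (u : V) (s s' : Finset I) (f h : I → ℂ) (ε : I → D) :
    B (∑ i ∈ s, f i • ε i) (T.P u (∑ j ∈ s', h j • ε j))
      = ∑ i ∈ s, ∑ j ∈ s', f i * h j * B (ε i) (T.P u (ε j)) := by
  simp only [map_sum, map_smul, LinearMap.sum_apply, LinearMap.smul_apply, smul_eq_mul,
    Finset.mul_sum]
  rw [Finset.sum_comm]
  exact Finset.sum_congr rfl fun i _ => Finset.sum_congr rfl fun j _ => by ring

/-- On each finite-dimensional affine subspace both gradients are combinations of fixed covectors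
with analytic coefficients. -/
theorem analytic_bracket [Countable I] (S : FiniteCoordinates I B)
    (hF : AnalyticOnSubspaces F) (hdF : IsGradient B F dF)
    (hH : AnalyticOnSubspaces H) (hdH : IsGradient B H dH) :
    AnalyticOnSubspaces (T.bracket dF dH) := by
  intro k u v
  obtain ⟨s, hs⟩ := hdF.exists_finset S hF u v
  obtain ⟨s', hs'⟩ := hdH.exists_finset S hH u v
  have h : ∀ c : Fin k → ℂ, T.bracket dF dH (u + ∑ l, c l • v l)
      = ∑ i ∈ s, ∑ j ∈ s', B (dF (u + ∑ l, c l • v l)) (S.e i)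
        * B (dH (u + ∑ l, c l • v l)) (S.e j)
        * B (S.ε i) (T.P (u + ∑ l, c l • v l) (S.ε j)) := fun c => by
    rw [bracket]
    conv_lhs => rw [S.expand _ s (hs c), S.expand _ s' (hs' c)]
    exact T.apply_sum _ s s' _ _ _
  simp only [h]
  exact Finset.analyticOnNhd_fun_sum _ fun i _ => Finset.analyticOnNhd_fun_sum _ fun j _ =>
    ((hdF.analytic hF (S.e i) k u v).mul (hdH.analytic hH (S.e j) k u v)).mul
      (T.analytic (S.ε i) (S.ε j) k u v)

/-- The product rule: Z and Z' represent the Hessians of F and H contracted with the opposite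
Hamiltonian vectors, frozen at u. The minus sign is skewness, and Γ is the derivative of the tensor
itself. -/
theorem hasDerivAt_bracket [Countable I] (S : FiniteCoordinates I B)
    (hF : AnalyticOnSubspaces F) (hdF : IsGradient B F dF)
    (hH : AnalyticOnSubspaces H) (hdH : IsGradient B H dH) {u : V} {Z Z' : D}
    (hZ : ∀ v, HasDerivAt (fun t : ℂ => B (dF (u + t • v)) (T.P u (dH u))) (B Z v) 0)
    (hZ' : ∀ v, HasDerivAt (fun t : ℂ => B (dH (u + t • v)) (T.P u (dF u))) (B Z' v) 0) (v : V) :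
    HasDerivAt (fun t : ℂ => T.bracket dF dH (u + t • v))
      (B (Z - Z' + T.Γ (dF u) (dH u) u) v) 0 := by
  obtain ⟨s, hs⟩ := hdF.exists_finset_line S hF u v
  obtain ⟨s', hs'⟩ := hdH.exists_finset_line S hH u v
  have hf := fun i => (hdF.analytic hF (S.e i)).hasDerivAt_line u v
  have hh := fun j => (hdH.analytic hH (S.e j)).hasDerivAt_line u v
  have hb := fun i j => T.gradient (S.ε i) (S.ε j) u v
  have hs0 := hs 0
  have hs0' := hs' 0
  rw [zero_smul, add_zero] at hs0 hs0'
  have h1 : B Z v = ∑ i ∈ s, ∑ j ∈ s', deriv (fun t : ℂ => B (dF (u + t • v)) (S.e i)) 0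
      * B (dH u) (S.e j) * B (S.ε i) (T.P u (S.ε j)) := by
    refine (hZ v).unique ?_
    have : ∀ t : ℂ, B (dF (u + t • v)) (T.P u (dH u)) = ∑ i ∈ s, ∑ j ∈ s',
        B (dF (u + t • v)) (S.e i) * B (dH u) (S.e j) * B (S.ε i) (T.P u (S.ε j)) := fun t => by
      conv_lhs => rw [hs t, hs0']
      exact T.apply_sum _ s s' _ _ _
    simp only [this]
    exact HasDerivAt.fun_sum fun i _ => HasDerivAt.fun_sum fun j _ =>
      ((hf i).mul_const _).mul_const _
  have h2 : -B Z' v = ∑ i ∈ s, ∑ j ∈ s', B (dF u) (S.e i)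
      * deriv (fun t : ℂ => B (dH (u + t • v)) (S.e j)) 0 * B (S.ε i) (T.P u (S.ε j)) := by
    refine (hZ' v).fun_neg.unique ?_
    have : ∀ t : ℂ, -B (dH (u + t • v)) (T.P u (dF u)) = ∑ i ∈ s, ∑ j ∈ s',
        B (dF u) (S.e i) * B (dH (u + t • v)) (S.e j) * B (S.ε i) (T.P u (S.ε j)) := fun t => by
      rw [← T.skew]
      conv_lhs => rw [hs' t, hs0]
      exact T.apply_sum _ s s' _ _ _
    simp only [this]
    exact HasDerivAt.fun_sum fun i _ => HasDerivAt.fun_sum fun j _ =>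
      ((hh j).const_mul _).mul_const _
  have h3 : B (T.Γ (dF u) (dH u) u) v = ∑ i ∈ s, ∑ j ∈ s', B (dF u) (S.e i)
      * B (dH u) (S.e j) * B (T.Γ (S.ε i) (S.ε j) u) v := by
    refine (T.gradient (dF u) (dH u) u v).unique ?_
    have : ∀ t : ℂ, B (dF u) (T.P (u + t • v) (dH u)) = ∑ i ∈ s, ∑ j ∈ s',
        B (dF u) (S.e i) * B (dH u) (S.e j) * B (S.ε i) (T.P (u + t • v) (S.ε j)) := fun t => by
      conv_lhs => rw [hs0, hs0']
      exact T.apply_sum _ s s' _ _ _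
    simp only [this]
    exact HasDerivAt.fun_sum fun i _ => HasDerivAt.fun_sum fun j _ => (hb i j).const_mul _
  have h4 : ∀ t : ℂ, T.bracket dF dH (u + t • v) = ∑ i ∈ s, ∑ j ∈ s',
      B (dF (u + t • v)) (S.e i) * B (dH (u + t • v)) (S.e j)
        * B (S.ε i) (T.P (u + t • v) (S.ε j)) := fun t => by
    rw [bracket]
    conv_lhs => rw [hs t, hs' t]
    exact T.apply_sum _ s s' _ _ _
  have h5 : B (Z - Z' + T.Γ (dF u) (dH u) u) v = B Z v + -B Z' v + B (T.Γ (dF u) (dH u) u) v := by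
    simp only [map_add, map_sub, LinearMap.add_apply, LinearMap.sub_apply]; ring
  rw [h5, h1, h2, h3, ← Finset.sum_add_distrib, ← Finset.sum_add_distrib]
  simp only [h4]
  refine HasDerivAt.fun_sum fun i _ => ?_
  rw [← Finset.sum_add_distrib, ← Finset.sum_add_distrib]
  refine HasDerivAt.fun_sum fun j _ => ?_
  refine (((hf i).fun_mul (hh j)).fun_mul (hb i j)).congr_deriv ?_
  simp only [zero_smul, add_zero]
  ring

theorem exists_gradient_bracket [Countable I] (S : FiniteCoordinates I B)
    (hF : AnalyticOnSubspaces F) (hdF : IsGradient B F dF)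
    (hH : AnalyticOnSubspaces H) (hdH : IsGradient B H dH) :
    ∃ dK, IsGradient B (T.bracket dF dH) dK := by
  choose Z hZ using fun u => hdF.exists_hessian S hF u (T.P u (dH u))
  choose Z' hZ' using fun u => hdH.exists_hessian S hH u (T.P u (dF u))
  exact ⟨_, fun u v => T.hasDerivAt_bracket S hF hdF hH hdH (fun v => (hZ u v).2)
    (fun v => (hZ' u v).2) v⟩

/-- The Jacobi identity for functionals follows from that for constant covectors. -/
theorem jacobi_bracket [Countable I] (S : FiniteCoordinates I B)
    (hT : ∀ u X Y Z, B (T.Γ Y Z u) (T.P u X) + B (T.Γ Z X u) (T.P u Y)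
      + B (T.Γ X Y u) (T.P u Z) = 0)
    (hF : AnalyticOnSubspaces F) (hdF : IsGradient B F dF)
    (hG : AnalyticOnSubspaces G) (hdG : IsGradient B G dG)
    (hH : AnalyticOnSubspaces H) (hdH : IsGradient B H dH) {dK dL dM : V → D}
    (hK : IsGradient B (T.bracket dG dH) dK) (hL : IsGradient B (T.bracket dH dF) dL)
    (hM : IsGradient B (T.bracket dF dG) dM) (u : V) :
    T.bracket dF dK u + T.bracket dG dL u + T.bracket dH dM u = 0 := by
  obtain ⟨FG, hFG⟩ := hdF.exists_hessian S hF u (T.P u (dG u))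
  obtain ⟨FH, hFH⟩ := hdF.exists_hessian S hF u (T.P u (dH u))
  obtain ⟨GF, hGF⟩ := hdG.exists_hessian S hG u (T.P u (dF u))
  obtain ⟨GH, hGH⟩ := hdG.exists_hessian S hG u (T.P u (dH u))
  obtain ⟨HF, hHF⟩ := hdH.exists_hessian S hH u (T.P u (dF u))
  obtain ⟨HG, hHG⟩ := hdH.exists_hessian S hH u (T.P u (dG u))
  have k1 := (hK u (T.P u (dF u))).unique (T.hasDerivAt_bracket S hG hdG hH hdH
    (fun v => (hGH v).2) (fun v => (hHG v).2) (T.P u (dF u)))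
  have k2 := (hL u (T.P u (dG u))).unique (T.hasDerivAt_bracket S hH hdH hF hdF
    (fun v => (hHF v).2) (fun v => (hFH v).2) (T.P u (dG u)))
  have k3 := (hM u (T.P u (dH u))).unique (T.hasDerivAt_bracket S hF hdF hG hdG
    (fun v => (hFG v).2) (fun v => (hGF v).2) (T.P u (dH u)))
  -- Each functional's Hessian, evaluated on the other two Hamiltonian vectors, occurs twice with
  -- opposite signs; by symmetry only the tensor terms `j` remain.
  have e1 := ((hGH (T.P u (dF u))).1).unique (hGF (T.P u (dH u))).2
  have e2 := ((hHF (T.P u (dG u))).1).unique (hHG (T.P u (dF u))).2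
  have e3 := ((hFG (T.P u (dH u))).1).unique (hFH (T.P u (dG u))).2
  have j := hT u (dF u) (dG u) (dH u)
  simp only [bracket, T.skew u (dF u) (dK u), T.skew u (dG u) (dL u), T.skew u (dH u) (dM u),
    k1, k2, k3, map_add, map_sub, LinearMap.add_apply, LinearMap.sub_apply]
  linear_combination -j - e1 - e2 - e3

/-- An affine vector field that preserves the tensor preserves brackets of invariant functions. -/
theorem bracket_invariant [Countable I] (S : FiniteCoordinates I B) {ξ L : V → V}
    (hξ : ∀ u w (t : ℂ), ξ (u + t • w) = ξ u + t • L w)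
    (hT : ∀ u X Y, B (T.Γ X Y u) (ξ u) = B X (L (T.P u Y)) - B Y (L (T.P u X)))
    (hF : AnalyticOnSubspaces F) (hdF : IsGradient B F dF) (hFξ : ∀ u, B (dF u) (ξ u) = 0)
    (hH : AnalyticOnSubspaces H) (hdH : IsGradient B H dH) (hHξ : ∀ u, B (dH u) (ξ u) = 0)
    {dK : V → D} (hK : IsGradient B (T.bracket dF dH) dK) (u : V) : B (dK u) (ξ u) = 0 := by
  -- Differentiating the identity ⟨dF, ξ⟩ = 0 along w expresses the Hessian on (ξ, w) through the
  -- linear part L of ξ. At t = 0 the product with t contributes only the value of the second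
  -- factor.
  have key : ∀ {F : V → ℂ} {dF : V → D}, AnalyticOnSubspaces F → IsGradient B F dF →
      (∀ u, B (dF u) (ξ u) = 0) → ∀ {w : V} {Z : D},
      HasDerivAt (fun t : ℂ => B (dF (u + t • w)) (ξ u)) (B Z (ξ u)) 0 →
      B Z (ξ u) = -B (dF u) (L w) := by
    intro F dF hF hdF h w Z hZ
    have h1 := hZ.fun_add ((hasDerivAt_id (0 : ℂ)).fun_mul
      ((hdF.analytic hF (L w)).hasDerivAt_line u w))
    have h2 : ∀ t : ℂ, B (dF (u + t • w)) (ξ u) + id t * B (dF (u + t • w)) (L w) = 0 := fun t => by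
      have := h (u + t • w)
      rwa [hξ, map_add, map_smul, smul_eq_mul] at this
    simp only [h2] at h1
    have h3 := (hasDerivAt_const (0 : ℂ) (0 : ℂ)).unique h1
    simp only [zero_smul, add_zero, one_mul, id_eq, zero_mul] at h3
    linear_combination -h3
  obtain ⟨Z, hZ⟩ := hdF.exists_hessian S hF u (T.P u (dH u))
  obtain ⟨Z', hZ'⟩ := hdH.exists_hessian S hH u (T.P u (dF u))
  rw [(hK u (ξ u)).unique (T.hasDerivAt_bracket S hF hdF hH hdH
    (fun v => (hZ v).2) (fun v => (hZ' v).2) (ξ u)), map_add, map_sub, LinearMap.add_apply,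
    LinearMap.sub_apply, hT, key hF hdF hFξ (hZ (ξ u)).1, key hH hdH hHξ (hZ' (ξ u)).1]
  ring

end SkewTensor

end PoissonBrackets

/-! ### Coordinates on the cotangent space of the coset. -/

namespace DiffOp

/-- The operator with the single nonzero coefficient `1`, in degree `k` at the site `n`. -/
noncomputable def unit (k n : ℤ) : DiffOp := fun k' n' => if k' = k ∧ n' = n then 1 else 0

theorem unit_apply (k n k' n' : ℤ) : unit k n k' n' = if k' = k ∧ n' = n then 1 else 0 := rfl

theorem unit_mem_finCoeff (k n : ℤ) : unit k n ∈ finCoeff := fun k' =>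
  (Set.finite_singleton n).subset fun n' h => by
    by_contra h'
    exact h (if_neg fun h'' => h' h''.2)

theorem unit_mem_degLT {k m : ℤ} (n : ℤ) (h : k < m) : unit k n ∈ degLT m :=
  mem_degLT.2 fun k' _ _ => if_neg fun h'' => by omega

theorem unit_mem_degGE {k m : ℤ} (n : ℤ) (h : m ≤ k) : unit k n ∈ degGE m :=
  mem_degGE.2 fun k' _ _ => if_neg fun h'' => by omega

/-- Identifies the operator dual to the coefficient at (k, n): opposite degree, at the site shifted
by k. -/
theorem trace_mul_unit (A : DiffOp) (k n : ℤ) : (A * unit (-k) (n + k)).trace = A k n := by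
  have h : ∀ m i : ℤ, A i m * unit (-k) (n + k) (0 - i) (m + i)
      = if i = k ∧ m = n then A k n else 0 := by
    intro m i
    rw [unit_apply]
    split_ifs with h1 h2 h2
    · rw [h2.1, h2.2, mul_one]
    · omega
    · omega
    · rw [mul_zero]
  rw [trace, finsum_eq_single _ n]
  · rw [res, mul_apply]
    simp only [h]
    rw [finsum_eq_single _ k fun i hi => if_neg fun h => hi h.1]
    simp
  · intro m hm
    rw [res, mul_apply]
    simp only [h]
    exact (finsum_congr fun i => if_neg fun h => hm h.2).trans finsum_zero

theorem lt_mem_finCoeff {A : DiffOp} (h : A ∈ finCoeff) (m : ℤ) : A.lt m ∈ finCoeff :=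
  mem_finCoeff_of_support h fun k n h => by rw [lt_apply, h, ite_self]

theorem ge_mem_finCoeff {A : DiffOp} (h : A ∈ finCoeff) (m : ℤ) : A.ge m ∈ finCoeff :=
  mem_finCoeff_of_support h fun k n h => by rw [ge_apply, h, ite_self]

theorem lt_mem_minusAlg {A : DiffOp} (h : A ∈ finCoeff) (m : ℤ) : A.lt m ∈ minusAlg :=
  ⟨lt_mem_finCoeff h m, m, lt_mem_degLT A m⟩

theorem ge_mem_plusAlg {A : DiffOp} (h : A ∈ finCoeff) (m : ℤ) : A.ge m ∈ plusAlg :=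
  ⟨ge_mem_finCoeff h m, m, ge_mem_degGE A m⟩

theorem ge_mem_minusAlg {A : DiffOp} (h : A ∈ minusAlg) (m : ℤ) : A.ge m ∈ minusAlg := by
  rw [eq_sub_of_add_eq' (lt_add_ge A m)]
  exact sub_mem h (lt_mem_minusAlg h.1 m)

theorem lt_mem_plusAlg {A : DiffOp} (h : A ∈ plusAlg) (m : ℤ) : A.lt m ∈ plusAlg := by
  rw [eq_sub_of_add_eq (lt_add_ge A m)]
  exact sub_mem h (ge_mem_plusAlg h.1 m)

theorem zero_trace : (0 : DiffOp).trace = 0 := finsum_zero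

end DiffOp

namespace Toda

open DiffOp

/-- Pairs of `ℰ⁻ × ℰ⁺` as elements of the ring of pairs. -/
noncomputable def ofCoupled : coupled →ₗ[ℂ] PairRing where
  toFun x := (⟨x.1.1, x.2.1.2⟩, ⟨x.1.2, x.2.2.2⟩)
  map_add' _ _ := rfl
  map_smul' _ _ := rfl

theorem ofCoupled_mem (x : coupled) : ofCoupled x ∈ coupledIdeal := x.2

theorem toPair_injective : Function.Injective toPair := fun _ _ h =>
  Prod.ext (Subtype.ext (congrArg Prod.fst h)) (Subtype.ext (congrArg Prod.snd h))

theorem pairing_toPair {x y : PairRing} (h : x * y ∈ coupledIdeal) :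
    pairing (toPair x) (toPair y) = pairTrace (x * y) :=
  (pairTrace_eq h).symm

variable {N M : ℕ}

theorem tangent_le_coupled : tangent N M ≤ coupled := fun _ h => ⟨h.1.1, h.2.1⟩

theorem cotangent_le_coupled : cotangent N M ≤ coupled := fun _ h => ⟨h.1.1, h.2.1⟩

/-- Tangent vectors as elements of the ring of pairs. -/
noncomputable def ofTangent : tangent N M →ₗ[ℂ] PairRing :=
  ofCoupled ∘ₗ Submodule.inclusion tangent_le_coupled

/-- Covectors as elements of the ring of pairs. -/
noncomputable def ofCotangent : cotangent N M →ₗ[ℂ] PairRing :=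
  ofCoupled ∘ₗ Submodule.inclusion cotangent_le_coupled

theorem ofCotangent_mem (X : cotangent N M) : ofCotangent X ∈ coupledIdeal := ofCoupled_mem _

variable (N M) in
/-- The pairing between covectors and tangent vectors. -/
noncomputable def dualPairing : cotangent N M →ₗ[ℂ] tangent N M →ₗ[ℂ] ℂ :=
  ((LinearMap.mul ℂ PairRing).compr₂ pairTrace).compl₁₂ ofCotangent ofTangent

theorem dualPairing_apply (X : cotangent N M) (v : tangent N M) :
    dualPairing N M X v = pairTrace (ofCotangent X * ofTangent v) := rfl

theorem dualPairing_eq (X : cotangent N M) (v : tangent N M) :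
    dualPairing N M X v = pairing X v :=
  (pairing_toPair (coupledIdeal_mul_right (ofCotangent_mem X) _)).symm

theorem cotangent_ext {X Y : cotangent N M} (h1 : ∀ k n, X.1.1 k n = Y.1.1 k n)
    (h2 : ∀ k n, X.1.2 k n = Y.1.2 k n) : X = Y :=
  Subtype.ext (Prod.ext (DiffOp.ext h1) (DiffOp.ext h2))

/-- The coordinate tangent vectors. -/
noncomputable def coordVector : (ℤ × ℤ) ⊕ (ℤ × ℤ) → tangent N M
  | .inl (k, n) => if h : -(N : ℤ) < k then
      ⟨(unit (-k) (n + k), 0), ⟨⟨unit_mem_finCoeff _ _, _, unit_mem_degLT _ (lt_add_one _)⟩,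
        unit_mem_degLT _ (by omega)⟩, zero_mem _⟩ else 0
  | .inr (k, n) => if h : k < (M : ℤ) + 1 then
      ⟨(0, unit (-k) (n + k)), zero_mem _, ⟨unit_mem_finCoeff _ _, _, unit_mem_degGE _ le_rfl⟩,
        unit_mem_degGE _ (by omega)⟩ else 0

/-- The coordinate covectors. -/
noncomputable def coordCovector : (ℤ × ℤ) ⊕ (ℤ × ℤ) → cotangent N M
  | .inl (k, n) => if h : -(N : ℤ) < k then
      ⟨(unit k n, 0), ⟨⟨unit_mem_finCoeff _ _, _, unit_mem_degLT _ (lt_add_one _)⟩,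
        unit_mem_degGE _ (by omega)⟩, zero_mem _⟩ else 0
  | .inr (k, n) => if h : k < (M : ℤ) + 1 then
      ⟨(0, unit k n), zero_mem _, ⟨unit_mem_finCoeff _ _, _, unit_mem_degGE _ le_rfl⟩,
        unit_mem_degLT _ h⟩ else 0

theorem dualPairing_coordVector_inl (X : cotangent N M) (k n : ℤ) :
    dualPairing N M X (coordVector (.inl (k, n))) = X.1.1 k n := by
  rw [coordVector]
  split_ifs with h
  · rw [dualPairing_eq]
    change (X.1.1 * unit (-k) (n + k)).trace + (X.1.2 * 0).trace = _
    rw [trace_mul_unit, mul_zero', zero_trace, add_zero]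
  · rw [map_zero, mem_degGE.1 X.2.1.2 k (by omega)]

theorem dualPairing_coordVector_inr (X : cotangent N M) (k n : ℤ) :
    dualPairing N M X (coordVector (.inr (k, n))) = X.1.2 k n := by
  rw [coordVector]
  split_ifs with h
  · rw [dualPairing_eq]
    change (X.1.1 * 0).trace + (X.1.2 * unit (-k) (n + k)).trace = _
    rw [trace_mul_unit, mul_zero', zero_trace, zero_add]
  · rw [map_zero, mem_degLT.1 X.2.2.2 k (by omega)]

theorem cotangent_ext_pairing {X Y : cotangent N M}
    (h : ∀ v, dualPairing N M X v = dualPairing N M Y v) : X = Y :=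
  cotangent_ext
    (fun k n => by
      rw [← dualPairing_coordVector_inl, ← dualPairing_coordVector_inl, h])
    (fun k n => by
      rw [← dualPairing_coordVector_inr, ← dualPairing_coordVector_inr, h])

/-- The families are dual only for admissible degrees, since outside them the coordinate covector is
zero; the factor from X, which vanishes there too, makes the relation hold for all indices. -/
theorem dualPairing_coord (X : cotangent N M) (i j : (ℤ × ℤ) ⊕ (ℤ × ℤ)) :
    dualPairing N M X (coordVector i) * dualPairing N M (coordCovector i) (coordVector j)
      = if i = j then dualPairing N M X (coordVector i) else 0 := by
  rcases i with ⟨k, n⟩ | ⟨k, n⟩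
  · rw [dualPairing_coordVector_inl, coordCovector]
    split_ifs with h h' h'
    · subst h'
      rw [dualPairing_coordVector_inl]
      change X.1.1 k n * unit k n k n = _
      rw [unit_apply, if_pos ⟨rfl, rfl⟩, mul_one]
    · rcases j with ⟨k', n'⟩ | ⟨k', n'⟩
      · rw [dualPairing_coordVector_inl]
        change X.1.1 k n * unit k n k' n' = _
        rw [unit_apply, if_neg, mul_zero]
        rintro ⟨rfl, rfl⟩
        exact h' rfl
      · rw [dualPairing_coordVector_inr]
        exact mul_zero _
    · rw [mem_degGE.1 X.2.1.2 k (by omega), zero_mul]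
    · rw [mem_degGE.1 X.2.1.2 k (by omega), zero_mul]
  · rw [dualPairing_coordVector_inr, coordCovector]
    split_ifs with h h' h'
    · subst h'
      rw [dualPairing_coordVector_inr]
      change X.1.2 k n * unit k n k n = _
      rw [unit_apply, if_pos ⟨rfl, rfl⟩, mul_one]
    · rcases j with ⟨k', n'⟩ | ⟨k', n'⟩
      · rw [dualPairing_coordVector_inl]
        exact mul_zero _
      · rw [dualPairing_coordVector_inr]
        change X.1.2 k n * unit k n k' n' = _
        rw [unit_apply, if_neg, mul_zero]
        rintro ⟨rfl, rfl⟩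
        exact h' rfl
    · rw [mem_degLT.1 X.2.2.2 k (by omega), zero_mul]
    · rw [mem_degLT.1 X.2.2.2 k (by omega), zero_mul]

/-- A covector is bounded in degree on both sides, by its algebra and by the cotangent condition,
and each coefficient has finite support. -/
theorem finite_coordinates (X : cotangent N M) :
    ∃ s : Finset ((ℤ × ℤ) ⊕ (ℤ × ℤ)), ∀ i ∉ s, dualPairing N M X (coordVector i) = 0 := by
  have h1 := finite_support_of_band X.2.1.1.1 X.2.1.1.2.choose_spec X.2.1.2
  have h2 := finite_support_of_band X.2.2.1.1 X.2.2.2 X.2.2.1.2.choose_spec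
  refine ⟨h1.toFinset.disjSum h2.toFinset, ?_⟩
  rintro (⟨k, n⟩ | ⟨k, n⟩) hi
  · rw [dualPairing_coordVector_inl]
    simpa using hi
  · rw [dualPairing_coordVector_inr]
    simpa using hi

variable (N M) in
/-- The coordinates on the cotangent space. -/
noncomputable def coordinates : FiniteCoordinates ((ℤ × ℤ) ⊕ (ℤ × ℤ)) (dualPairing N M) where
  e := coordVector
  ε := coordCovector
  finite := finite_coordinates
  expand X s hs := by
    classical
    have key : ∀ j, dualPairing N M X (coordVector j) = dualPairing N M
        (∑ i ∈ s, dualPairing N M X (coordVector i) • coordCovector i) (coordVector j) := by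
      intro j
      simp only [map_sum, map_smul, LinearMap.sum_apply, LinearMap.smul_apply, smul_eq_mul,
        dualPairing_coord, Finset.sum_ite_eq']
      split_ifs with h
      · rfl
      · exact hs j h
    refine cotangent_ext (fun k n => ?_) fun k n => ?_
    · rw [← dualPairing_coordVector_inl, ← dualPairing_coordVector_inl, key]
    · rw [← dualPairing_coordVector_inr, ← dualPairing_coordVector_inr, key]

/-- The projection of an element of `ℰ⁻ × ℰ⁺` to the cotangent space. -/
noncomputable def toCotangent (x : PairRing) (hx : x ∈ coupledIdeal) : cotangent N M :=
  ⟨((x.1 : DiffOp).ge (-N + 1), (x.2 : DiffOp).lt (M + 1)),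
    ⟨ge_mem_minusAlg hx.1 _, ge_mem_degGE _ _⟩, ⟨lt_mem_plusAlg hx.2 _, lt_mem_degLT _ _⟩⟩

theorem lt_eq_self {A : DiffOp} {m : ℤ} (h : A ∈ degLT m) : A.lt m = A := by
  ext k n
  rw [lt_apply]
  split_ifs with hk
  · rfl
  · exact (mem_degLT.1 h k (by omega) n).symm

theorem ge_eq_self {A : DiffOp} {m : ℤ} (h : A ∈ degGE m) : A.ge m = A := by
  ext k n
  rw [ge_apply]
  split_ifs with hk
  · rfl
  · exact (mem_degGE.1 h k (by omega) n).symm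

/-- The discarded degrees pair to zero with tangent vectors, so gradients may be computed in the
ideal and truncated afterwards. -/
theorem dualPairing_toCotangent (x : PairRing) (hx : x ∈ coupledIdeal) (v : tangent N M) :
    dualPairing N M (toCotangent x hx) v = pairTrace (ofTangent v * x) := by
  rw [dualPairing_eq, ← pairTrace_cyclic hx,
    ← pairing_toPair (coupledIdeal_mul_right hx _)]
  have h1 := trace_mul_lt x.1 v.1.1 N
  have h2 := trace_mul_ge x.2 v.1.2 (-M)
  rw [lt_eq_self v.2.1.2] at h1
  rw [ge_eq_self v.2.2.2] at h2
  rw [show (1 : ℤ) - N = -N + 1 by ring] at h1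
  rw [show (1 : ℤ) - -M = M + 1 by ring] at h2
  exact congrArg₂ (· + ·) h1.symm h2.symm

end Toda

/-! ### Tangency of the tensors to the coset. -/

namespace DiffOp

theorem bracket_mem_minusAlg {U A : DiffOp} (hU : U ∈ minusAlg) (hA : A ∈ bddAboveOp) :
    ⁅U, A⁆ ∈ minusAlg :=
  sub_mem (mul_mem_minusAlg_left hU hA) (mul_mem_minusAlg_right hA hU)

theorem bracket_mem_plusAlg {U A : DiffOp} (hU : U ∈ plusAlg) (hA : A ∈ bddBelowOp) :
    ⁅U, A⁆ ∈ plusAlg :=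
  sub_mem (mul_mem_plusAlg_left hU hA) (mul_mem_plusAlg_right hA hU)

theorem bracket_mem_degLT {U A : DiffOp} {p q : ℤ} (hU : U ∈ degLT (p + 1))
    (hA : A ∈ degLT (q + 1)) : ⁅U, A⁆ ∈ degLT (p + q + 1) :=
  sub_mem (mul_mem_degLT hU hA) (by rw [add_comm p]; exact mul_mem_degLT hA hU)

theorem bracket_mem_degGE {U A : DiffOp} {p q : ℤ} (hU : U ∈ degGE p) (hA : A ∈ degGE q) :
    ⁅U, A⁆ ∈ degGE (p + q) :=
  sub_mem (mul_mem_degGE hU hA) (by rw [add_comm p]; exact mul_mem_degGE hA hU)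

end DiffOp

namespace Toda

open DiffOp

section Coset

variable {N M : ℕ} {A X : Pair}

theorem coset_fst_apply (hA : A ∈ coset N M) {k : ℤ} (hk : (N : ℤ) ≤ k) (n : ℤ) :
    A.1 k n = if k = N then 1 else 0 :=
  sub_eq_zero.1 (mem_degLT.1 hA.1.2 k hk n)

theorem coset_fst_mem_degLT (hA : A ∈ coset N M) : A.1 ∈ degLT (N + 1) :=
  mem_degLT.2 fun k hk n => by rw [coset_fst_apply hA (by omega), if_neg (by omega)]

theorem coset_fst_finite (hA : A ∈ coset N M) {k : ℤ} (hk : k ≠ N) :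
    (Function.support (A.1 k)).Finite := by
  refine (hA.1.1.1 k).subset fun n hn => ?_
  have h : (A - (shiftPow N, 0)).1 k n = A.1 k n := by
    change A.1 k n - (if k = N then 1 else 0) = _
    rw [if_neg hk, sub_zero]
  exact fun h' => hn (h.symm.trans h')

theorem coset_snd_mem (hA : A ∈ coset N M) : A.2 ∈ plusAlg ⊓ degGE (-M) := by
  have h : A.2 = (A - (shiftPow N, 0)).2 := (sub_zero A.2).symm
  rw [h]; exact hA.2

theorem coset_subset_coupledExt (hA : A ∈ coset N M) : A ∈ coupledExt :=
  ⟨⟨_, coset_fst_mem_degLT hA⟩, _, (coset_snd_mem hA).2⟩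

/-- A commutator of an operator of negative degree with A has degree < N, and truncations to degrees
≤ 0 are admissible since N ≥ 1. Although Λᴺ has infinite support, products with factors from ℰ⁻ have
finite supports. -/
theorem P1_mem_tangent (hN : 0 < N) (hA : A ∈ coset N M) (hX : X ∈ coupled) :
    P1 A X ∈ tangent N M := by
  have hA1 := (coset_subset_coupledExt hA).1
  have hA2 := (coset_subset_coupledExt hA).2
  have c1 := bracket_mem_minusAlg hX.1 hA1
  have c2 := bracket_mem_plusAlg hX.2 hA2
  have hle : degLT 1 ≤ degLT N := degLT_mono (by omega)
  have hge : degGE 1 ≤ degGE (-M) := degGE_mono (by omega)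
  refine ⟨⟨?_, ?_⟩, ?_, ?_⟩
  · exact add_mem (add_mem (bracket_mem_minusAlg (sub_mem (neg_mem (lt_mem_minusAlg hX.1.1 0))
      (lt_mem_minusAlg hX.2.1 0)) hA1) (lt_mem_minusAlg c1.1 1)) (lt_mem_minusAlg c2.1 1)
  · refine add_mem (add_mem ?_ (hle (lt_mem_degLT _ _))) (hle (lt_mem_degLT _ _))
    have h := bracket_mem_degLT (p := -1) (U := -X.1.lt 0 - X.2.lt 0)
      (sub_mem (neg_mem (lt_mem_degLT _ _)) (lt_mem_degLT _ _)) (coset_fst_mem_degLT hA)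
    rwa [show (-1 : ℤ) + N + 1 = N by ring] at h
  · exact sub_mem (sub_mem (bracket_mem_plusAlg (add_mem (ge_mem_plusAlg hX.1.1 0)
      (ge_mem_plusAlg hX.2.1 0)) hA2) (ge_mem_plusAlg c1.1 1)) (ge_mem_plusAlg c2.1 1)
  · refine sub_mem (sub_mem ?_ (hge (ge_mem_degGE _ _))) (hge (ge_mem_degGE _ _))
    have h := bracket_mem_degGE (U := X.1.ge 0 + X.2.ge 0)
      (add_mem (ge_mem_degGE _ _) (ge_mem_degGE _ _)) (coset_snd_mem hA).2
    rwa [zero_add] at h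

theorem residue_mem_finFun (hA : A ∈ coupledExt) (hX : X ∈ coupled) :
    (⁅X.1, A.1⁆ + ⁅X.2, A.2⁆ : DiffOp).res ∈ finFun :=
  finFun.add_mem (show (⁅X.1, A.1⁆ : DiffOp) 0 ∈ finFun from (bracket_mem_minusAlg hX.1 hA.1).1 0)
    (show (⁅X.2, A.2⁆ : DiffOp) 0 ∈ finFun from (bracket_mem_plusAlg hX.2 hA.2).1 0)

/-- The only obstruction is the coefficient of Λᴺ, which P₂ changes by ½(1 + Λᴺ)Res of the total
commutator. The correction subtracts (1 - Λᴺ)f, the same function for any right inverse of 1 - Λᴺ on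
functions of finite support. -/
theorem P2corr_mem_tangent {inv : (ℤ → ℂ) → (ℤ → ℂ)}
    (hinv : ∀ g ∈ finFun, ∀ n, inv g n - inv g (n + N) = g n)
    (hA : A ∈ coset N M) (hX : X ∈ coupled) : P2corr inv N A X ∈ tangent N M := by
  have hA1 := (coset_subset_coupledExt hA).1
  have hA2 := (coset_subset_coupledExt hA).2
  have dA1 := coset_fst_mem_degLT hA
  have dA2 := (coset_snd_mem hA).2
  have c1 := bracket_mem_minusAlg hX.1 hA1
  have c2 := bracket_mem_plusAlg hX.2 hA2
  have s1 := add_mem (mul_mem_minusAlg_right hA1 hX.1) (mul_mem_minusAlg_left hX.1 hA1)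
  have s2 := add_mem (mul_mem_plusAlg_right hA2 hX.2) (mul_mem_plusAlg_left hX.2 hA2)
  set f := corrFun inv N A X with hf
  have hfdef : ∀ n, f n = (1 / 2 : ℂ) * (inv (⁅X.1, A.1⁆ + ⁅X.2, A.2⁆ : DiffOp).res n
    + inv (⁅X.1, A.1⁆ + ⁅X.2, A.2⁆ : DiffOp).res (n + N)) := fun n => rfl
  have hc := hinv _ (residue_mem_finFun (coset_subset_coupledExt hA) hX)
  set E : DiffOp := -(A.1 * X.1 + X.1 * A.1).lt 0 - (A.2 * X.2 + X.2 * A.2).lt 0 with hE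
  set F : DiffOp := (⁅X.1, A.1⁆ : DiffOp).lt 1 + (⁅X.2, A.2⁆ : DiffOp).lt 1 with hF
  have dE : E ∈ degLT (-1 + 1) := sub_mem (neg_mem (lt_mem_degLT _ _)) (lt_mem_degLT _ _)
  have dF : F ∈ degLT (0 + 1) := add_mem (lt_mem_degLT _ _) (lt_mem_degLT _ _)
  have mE : E ∈ minusAlg := sub_mem (neg_mem (lt_mem_minusAlg s1.1 _)) (lt_mem_minusAlg s2.1 _)
  have mF : F ∈ minusAlg := add_mem (lt_mem_minusAlg c1.1 _) (lt_mem_minusAlg c2.1 _)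
  have hF0 : ∀ n, F 0 n = (⁅X.1, A.1⁆ + ⁅X.2, A.2⁆ : DiffOp).res n := fun n => by
    rw [hF, add_apply, lt_apply, lt_apply, if_pos one_pos, if_pos one_pos]
    rfl
  have dEA := bracket_mem_degLT dE dA1
  rw [show (-1 : ℤ) + N + 1 = N by ring] at dEA
  set Q : DiffOp := (1 / 2 : ℂ) • (⁅E, A.1⁆ + A.1 * F + F * A.1) with hQ
  have mQ : Q ∈ minusAlg := Submodule.smul_mem _ _ (add_mem (add_mem (bracket_mem_minusAlg mE hA1)
    (mul_mem_minusAlg_right hA1 mF)) (mul_mem_minusAlg_left mF hA1))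
  have dQ : Q ∈ degLT (N + 1) := by
    have h1 := mul_mem_degLT dA1 dF
    have h2 := mul_mem_degLT dF dA1
    rw [add_zero] at h1
    rw [zero_add] at h2
    exact Submodule.smul_mem _ _ (add_mem (add_mem (degLT_mono (by omega) dEA) h1) h2)
  -- Only the products of A with the degree-zero part of F reach degree N, and the leading
  -- coefficient of A is 1.
  have hQN : ∀ n, Q N n = (1 / 2 : ℂ) * (F 0 (n + N) + F 0 n) := fun n => by
    have h1 := mul_apply_top dA1 dF n
    have h2 := mul_apply_top dF dA1 n
    rw [add_zero] at h1
    rw [zero_add] at h2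
    rw [hQ, smul_apply, add_apply, add_apply, mem_degLT.1 dEA N le_rfl, h1, h2,
      coset_fst_apply hA le_rfl, coset_fst_apply hA le_rfl, if_pos rfl]
    ring
  have hV : ∀ k n, (P2corr inv N A X).1 k n = Q k n - (f n * A.1 k n - A.1 k n * f (n + k)) :=
    fun k n => by
      change Q k n - ((diag f * A.1) k n - (A.1 * diag f) k n) = _
      rw [diag_mul_apply, mul_diag_apply]
  have hVN : ∀ k, (N : ℤ) ≤ k → ∀ n, (P2corr inv N A X).1 k n = 0 := by
    intro k hk n
    rw [hV, coset_fst_apply hA hk]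
    split_ifs with h
    · have e1 := hc n
      have e2 := hc (n + N)
      rw [h, hQN, hF0, hF0, hfdef, hfdef]
      linear_combination (-1 / 2 : ℂ) * e1 - (1 / 2 : ℂ) * e2
    · rw [mem_degLT.1 dQ k (by omega)]
      ring
  have dV : (P2corr inv N A X).1 ∈ degLT N := mem_degLT.2 hVN
  refine ⟨⟨⟨fun k => ?_, N, dV⟩, dV⟩, ?_⟩
  -- The function f need not have finite support. In degree N the coefficient is zero, and in the
  -- other degrees f is multiplied by a coefficient of A of finite support.
  · by_cases hk : k = N
    · rw [show (P2corr inv N A X).1 k = 0 from funext (hVN k hk.ge)]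
      rw [Function.support_zero]
      exact Set.finite_empty
    · refine ((mQ.1 k).union (coset_fst_finite hA hk)).subset fun n hn => ?_
      by_contra h
      simp only [Set.mem_union, Function.mem_support, not_or, not_not] at h
      exact hn (by rw [hV, h.1, h.2]; ring)
  · set E' : DiffOp := (A.1 * X.1 + X.1 * A.1).ge 0 + (A.2 * X.2 + X.2 * A.2).ge 0
    set F' : DiffOp := (⁅X.1, A.1⁆ : DiffOp).ge 1 + (⁅X.2, A.2⁆ : DiffOp).ge 1
    have dE' : E' ∈ degGE 0 := add_mem (ge_mem_degGE _ _) (ge_mem_degGE _ _)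
    have dF' : F' ∈ degGE 0 := add_mem (degGE_mono zero_le_one (ge_mem_degGE _ _))
      (degGE_mono zero_le_one (ge_mem_degGE _ _))
    have mE' : E' ∈ plusAlg := add_mem (ge_mem_plusAlg s1.1 _) (ge_mem_plusAlg s2.1 _)
    have mF' : F' ∈ plusAlg := add_mem (ge_mem_plusAlg c1.1 _) (ge_mem_plusAlg c2.1 _)
    have df : diag f ∈ degGE 0 := diag_mem_degGE f
    have mA2 : A.2 ∈ plusAlg := (coset_snd_mem hA).1
    have bf : diag f ∈ bddBelowOp := ⟨0, df⟩
    refine sub_mem (x := (1 / 2 : ℂ) • (⁅E', A.2⁆ - A.2 * F' - F' * A.2)) ?_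
      (sub_mem ⟨mul_mem_plusAlg_right bf mA2, ?_⟩ ⟨mul_mem_plusAlg_left mA2 bf, ?_⟩)
    · refine Submodule.smul_mem _ _ ⟨sub_mem (sub_mem (bracket_mem_plusAlg mE' hA2)
        (mul_mem_plusAlg_right hA2 mF')) (mul_mem_plusAlg_left mF' hA2), ?_⟩
      have h0 := bracket_mem_degGE dE' dA2
      have h1 := mul_mem_degGE dA2 dF'
      have h2 := mul_mem_degGE dF' dA2
      rw [zero_add] at h0 h2
      rw [add_zero] at h1
      exact sub_mem (sub_mem h0 h1) h2
    · have h := mul_mem_degGE df dA2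
      rwa [zero_add] at h
    · have h := mul_mem_degGE dA2 df
      rwa [add_zero] at h

end Coset

end Toda

/-! ### The pencil of the linear and the quadratic tensors. -/

namespace SklyaninData

variable {R : Type*} [Ring R] [Algebra ℂ R] (S : SklyaninData R)

theorem linW_eq (A Z : R) : S.linW A Z = S.W (A + 1) Z - S.W A Z := by
  have h := S.W_add_smul_one A Z 1
  rw [one_smul, one_smul] at h
  rw [h, add_sub_cancel_left]

theorem W_one (Z : R) : S.W 1 Z = 0 := by
  simp only [W, a, b, one_mul, mul_one, sub_self]

theorem G_add (A V Y Z : R) : S.G (A + V) Y Z = S.G A Y Z + S.G V Y Z := by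
  simp only [G, a_add, b_add, mul_add, add_mul]; abel

theorem G_smul (c : ℂ) (A Y Z : R) : S.G (c • A) Y Z = c • S.G A Y Z := by
  simp only [G, a_smul, b_smul, mul_smul_comm, smul_mul_assoc]; module

theorem T_W_skew {Y Z : R} (hY : Y ∈ S.I) (hZ : Z ∈ S.I) (A : R) :
    S.T (Y * S.W A Z) = -S.T (Z * S.W A Y) := by
  rw [T_W, S.β_skew hY hZ, T_W]

/-- Compares the quadratic form at A + 1 and at A; what is left is the polarization between A and 1,
whose gradient is G at the identity. -/
theorem T_linW {Y Z : R} (hY : Y ∈ S.I) (hZ : Z ∈ S.I) (A : R) :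
    S.T (Y * S.linW A Z) = S.T (A * S.G 1 Y Z) := by
  have h : S.β Y Z 1 1 = 0 := by rw [← T_W, W_one, mul_zero, map_zero]
  rw [← S.β_add_β hY hZ, linW_eq, mul_sub, map_sub, T_W, T_W, β_add_left, β_add_right, β_add_right,
    h]
  ring

/-- The pencil spanned by the linear and the quadratic tensors. -/
noncomputable def pencil (α β : ℂ) (A Z : R) : R := α • S.linW A Z + β • S.W A Z

/-- The gradient of the bracket of the pencil on constant covectors. -/
noncomputable def pencilG (α β : ℂ) (A Y Z : R) : R := α • S.G 1 Y Z + β • S.G A Y Z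

variable (α β : ℂ)

theorem pencil_add (A Y Z : R) : S.pencil α β A (Y + Z) = S.pencil α β A Y + S.pencil α β A Z := by
  simp only [pencil, linW_eq, W_add]; module

theorem pencil_smul (c : ℂ) (A Z : R) : S.pencil α β A (c • Z) = c • S.pencil α β A Z := by
  simp only [pencil, linW_eq, W_smul]; module

theorem pencilG_mem {A Y Z : R} (hY : Y ∈ S.I) (hZ : Z ∈ S.I) : S.pencilG α β A Y Z ∈ S.I :=
  add_mem (S.I.smul_mem _ (S.G_mem hY hZ)) (S.I.smul_mem _ (S.G_mem hY hZ))

theorem T_pencil {Y Z : R} (hY : Y ∈ S.I) (hZ : Z ∈ S.I) (A : R) :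
    S.T (Y * S.pencil α β A Z) = α * S.T (A * S.G 1 Y Z) + β * S.β Y Z A A := by
  rw [pencil, mul_add, map_add, mul_smul_comm, mul_smul_comm, map_smul, map_smul, T_W,
    S.T_linW hY hZ, smul_eq_mul, smul_eq_mul]

theorem T_pencil_skew {Y Z : R} (hY : Y ∈ S.I) (hZ : Z ∈ S.I) (A : R) :
    S.T (Y * S.pencil α β A Z) = -S.T (Z * S.pencil α β A Y) := by
  have h1 := S.T_W_skew hY hZ A
  have h2 := S.T_W_skew hY hZ (A + 1)
  simp only [pencil, linW_eq, mul_add, mul_sub, mul_smul_comm, map_add, map_sub, map_smul,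
    smul_eq_mul] at *
  linear_combination (β - α) * h1 + α * h2

theorem hasDerivAt_T_pencil {Y Z : R} (hY : Y ∈ S.I) (hZ : Z ∈ S.I) (A V : R) :
    HasDerivAt (fun t : ℂ => S.T (Y * S.pencil α β (A + t • V) Z))
      (S.T (V * S.pencilG α β A Y Z)) 0 := by
  -- The bracket of constant covectors is a quadratic polynomial in t, whose linear coefficient is
  -- the derivative at zero.
  have h : ∀ t : ℂ, S.T (Y * S.pencil α β (A + t • V) Z) = S.T (Y * S.pencil α β A Z)
      + t * S.T (V * S.pencilG α β A Y Z) + t * t * (β * S.β Y Z V V) := fun t => by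
    simp only [S.T_pencil α β hY hZ, pencilG, mul_add, map_add, mul_smul_comm, map_smul,
      smul_eq_mul, ← S.β_add_β hY hZ A V, β_add_left, β_add_right, β_smul_left, β_smul_right,
      add_mul, smul_mul_assoc]
    ring
  simp only [h]
  have h1 := (((hasDerivAt_id (0 : ℂ)).mul_const (S.T (V * S.pencilG α β A Y Z))).const_add
    (S.T (Y * S.pencil α β A Z))).add
    (((hasDerivAt_id (0 : ℂ)).mul (hasDerivAt_id (0 : ℂ))).mul_const (β * S.β Y Z V V))
  refine h1.congr_deriv ?_
  simp

theorem analyticOnNhd_T_pencil {Y Z : R} (hY : Y ∈ S.I) (hZ : Z ∈ S.I) {k : ℕ} (A : R)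
    (V : Fin k → R) : AnalyticOnNhd ℂ
      (fun c : Fin k → ℂ => S.T (Y * S.pencil α β (A + ∑ i, c i • V i) Z)) Set.univ := by
  let b : R →ₗ[ℂ] R →ₗ[ℂ] ℂ := LinearMap.mk₂ ℂ (S.β Y Z) (S.β_add_left Y Z)
    (fun c => S.β_smul_left c Y Z) (fun A => S.β_add_right Y Z A) (fun c => S.β_smul_right c Y Z)
  have hb : ∀ A, S.β Y Z A A = b A A := fun _ => rfl
  intro c _
  simp only [S.T_pencil α β hY hZ, hb, map_add, map_sum, map_smul, LinearMap.add_apply,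
    LinearMap.sum_apply, LinearMap.smul_apply, smul_eq_mul, add_mul, Finset.sum_mul,
    smul_mul_assoc]
  have hs : ∀ f : Fin k → (Fin k → ℂ) → ℂ, (∀ i, AnalyticAt ℂ (f i) c) →
      AnalyticAt ℂ (fun c => ∑ i, c i * f i c) c := fun f hf =>
    Finset.analyticAt_fun_sum _ fun i _ =>
      ((ContinuousLinearMap.proj (R := ℂ) (φ := fun _ : Fin k => ℂ) i).analyticAt c).mul (hf i)
  exact (analyticAt_const.mul (analyticAt_const.add (hs _ fun i => analyticAt_const))).add
    (analyticAt_const.mul ((analyticAt_const.add (hs _ fun i => analyticAt_const)).add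
      (hs _ fun i => analyticAt_const.add (hs _ fun j => analyticAt_const))))

/-- W(A + ε) and G(A + ε) are affine in ε, so the Jacobi sum at A + ε is J₀ + εJ₁ + ε²J₂. The sum
for the pencil is β²J₀ + αβJ₁ + α²J₂, and the values at ε = 0, 1, -1 determine the three
coefficients. -/
theorem jacobi_pencil {X Y Z : R} (hX : X ∈ S.I) (hY : Y ∈ S.I) (hZ : Z ∈ S.I) (A : R) :
    S.T (S.pencil α β A X * S.pencilG α β A Y Z) + S.T (S.pencil α β A Y * S.pencilG α β A Z X)
      + S.T (S.pencil α β A Z * S.pencilG α β A X Y) = 0 := by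
  have h0 := S.jacobi hX hY hZ A
  have h1 := S.jacobi hX hY hZ (A + (1 : ℂ) • 1)
  have h2 := S.jacobi hX hY hZ (A + (-1 : ℂ) • 1)
  simp only [W_add_smul_one, G_add, G_smul, pencil, pencilG, mul_add, add_mul, mul_smul_comm,
    smul_mul_assoc, map_add, map_smul, smul_eq_mul] at *
  linear_combination (β ^ 2 - α ^ 2) * h0 + (α ^ 2 / 2 + α * β / 2) * h1
    + (α ^ 2 / 2 - α * β / 2) * h2

/-- The identity is central, so p has the same commutator with A and A + 1; the difference of the
quadratic identity at these points is its linear analogue. -/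
theorem T_commutator_mul_pencilG {Y Z p : R} (hY : Y ∈ S.I) (hZ : Z ∈ S.I) (hp : p ∈ S.D) (A : R) :
    S.T ((p * A - A * p) * S.pencilG α β A Y Z) =
      S.T (Y * (p * S.pencil α β A Z - S.pencil α β A Z * p))
        - S.T (Z * (p * S.pencil α β A Y - S.pencil α β A Y * p)) := by
  have h0 := S.T_commutator_mul_G hY hZ hp A
  have h1 := S.T_commutator_mul_G hY hZ hp (A + (1 : ℂ) • 1)
  simp only [W_add_smul_one, G_add, G_smul, pencil, pencilG, mul_add, add_mul, mul_sub, sub_mul,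
    mul_smul_comm, smul_mul_assoc, map_add, map_sub, map_smul, smul_eq_mul, mul_one, one_mul] at *
  linear_combination (β - α) * h0 + α * h1

end SklyaninData

/-! ### The pencil on the coset. -/

namespace Toda

open DiffOp

variable {N M : ℕ}

/-- A linear extension of `(1 + Λᴺ)(1 - Λᴺ)⁻¹` to all functions. -/
noncomputable def skewShift (hN : 0 < N) : (ℤ → ℂ) →ₗ[ℂ] (ℤ → ℂ) :=
  (exists_linear_extension hN).choose

theorem skewShift_apply (hN : 0 < N) {g : ℤ → ℂ} (hg : g ∈ finFun) :
    skewShift hN g = fun n => invSym N g n + invSym N g (n + N) :=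
  (exists_linear_extension hN).choose_spec g hg

/-- The quadratic bracket corrected by `(1 + Λᴺ)(1 - Λᴺ)⁻¹`. -/
noncomputable def reducedSklyanin (hN : 0 < N) : SklyaninData PairRing :=
  sklyanin (skewShift hN) fun f hf g hg => by
    rw [skewShift_apply hN hf, skewShift_apply hN hg]
    exact finsum_invSym_skew hN hf hg

theorem commutator_mem {X : PairRing} (hX : X ∈ coupledIdeal) (A : PairRing) :
    X * A - A * X ∈ coupledIdeal :=
  sub_mem (coupledIdeal_mul_right hX A) (coupledIdeal_mul_left hX A)

theorem resSum_commutator (A X : PairRing) : resSum (X * A - A * X)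
    = (⁅(toPair X).1, (toPair A).1⁆ + ⁅(toPair X).2, (toPair A).2⁆ : DiffOp).res := rfl

theorem toPair_reducedSklyanin_W (hN : 0 < N) (A : PairRing) {X : PairRing}
    (hX : X ∈ coupledIdeal) :
    toPair ((reducedSklyanin hN).W A X) = P2red N (toPair A) (toPair X) := by
  have h : ((1 / 2 : ℂ) • skewShift hN (resSum (X * A - A * X)))
      = corrFun (invSym N) N (toPair A) (toPair X) := by
    rw [skewShift_apply hN (resSum_finite (commutator_mem hX A)), resSum_commutator]
    rfl
  rw [reducedSklyanin, toPair_W, h]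
  rfl

theorem shiftPow_mem_degLT (N : ℕ) : shiftPow N ∈ degLT (N + 1) :=
  mem_degLT.2 fun _ _ _ => if_neg (by omega)

/-- The points of the coset as elements of the ring of pairs. -/
noncomputable def ofPoint (u : tangent N M) : PairRing :=
  (⟨shiftPow N, _, shiftPow_mem_degLT N⟩, 0) + ofTangent u

theorem ofPoint_add (u v : tangent N M) : ofPoint (u + v) = ofPoint u + ofTangent v := by
  rw [ofPoint, ofPoint, map_add, add_assoc]

theorem point_mem_coset (u : tangent N M) : point u ∈ coset N M := by
  change point u - (shiftPow N, 0) ∈ tangent N M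
  rw [point, add_sub_cancel_left]
  exact u.2

theorem mem_coset_iff {A : Pair} : A ∈ coset N M ↔ ∃ u : tangent N M, point u = A :=
  ⟨fun h => ⟨⟨_, h⟩, add_sub_cancel _ _⟩, by rintro ⟨u, rfl⟩; exact point_mem_coset u⟩

theorem toPair_pencil (hN : 0 < N) (α β : ℂ) (u : tangent N M) (X : cotangent N M) :
    toPair ((reducedSklyanin hN).pencil α β (ofPoint u) (ofCotangent X))
      = α • P1red (point u) X + β • P2red N (point u) X := by
  rw [SklyaninData.pencil, map_add, map_smul, map_smul,
    toPair_reducedSklyanin_W hN _ (ofCotangent_mem X), reducedSklyanin, toPair_linW]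
  rfl

theorem P1red_mem_tangent (hN : 0 < N) {A X : Pair} (hA : A ∈ coset N M)
    (hX : X ∈ cotangent N M) : P1red A X ∈ tangent N M :=
  P1_mem_tangent hN hA (cotangent_le_coupled hX)

theorem P2red_mem_tangent (hN : 0 < N) {A X : Pair} (hA : A ∈ coset N M)
    (hX : X ∈ cotangent N M) : P2red N A X ∈ tangent N M :=
  P2corr_mem_tangent (fun _ hg => invSym_sub_shift hN hg) hA (cotangent_le_coupled hX)

theorem pencil_mem_tangent (hN : 0 < N) (α β : ℂ) (u : tangent N M) (X : cotangent N M) :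
    toPair ((reducedSklyanin hN).pencil α β (ofPoint u) (ofCotangent X)) ∈ tangent N M := by
  rw [toPair_pencil]
  exact add_mem (Submodule.smul_mem _ _ (P1red_mem_tangent hN (point_mem_coset u) X.2))
    (Submodule.smul_mem _ _ (P2red_mem_tangent hN (point_mem_coset u) X.2))

/-- The tensor `α P₁ + β P₂` at the points of the coset. -/
noncomputable def pencilMap (hN : 0 < N) (α β : ℂ) (u : tangent N M) :
    cotangent N M →ₗ[ℂ] tangent N M where
  toFun X := ⟨_, pencil_mem_tangent hN α β u X⟩
  map_add' X Y := Subtype.ext (by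
    simp only [map_add, SklyaninData.pencil_add, Submodule.coe_add])
  map_smul' c X := Subtype.ext (by
    simp only [map_smul, SklyaninData.pencil_smul, Submodule.coe_smul, RingHom.id_apply])

theorem coe_pencilMap (hN : 0 < N) (α β : ℂ) (u : tangent N M) (X : cotangent N M) :
    (pencilMap hN α β u X : Pair) = α • P1red (point u) X + β • P2red N (point u) X :=
  toPair_pencil hN α β u X

theorem ofTangent_pencilMap (hN : 0 < N) (α β : ℂ) (u : tangent N M) (X : cotangent N M) :
    ofTangent (pencilMap hN α β u X)
      = (reducedSklyanin hN).pencil α β (ofPoint u) (ofCotangent X) :=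
  toPair_injective rfl

theorem dualPairing_pencilMap (hN : 0 < N) (α β : ℂ) (u : tangent N M) (X Y : cotangent N M) :
    dualPairing N M X (pencilMap hN α β u Y) = (reducedSklyanin hN).T (ofCotangent X
      * (reducedSklyanin hN).pencil α β (ofPoint u) (ofCotangent Y)) := by
  rw [dualPairing_apply, ofTangent_pencilMap]
  rfl

/-- The gradients of the brackets of constant covectors. -/
noncomputable def pencilGradient (hN : 0 < N) (α β : ℂ) (X Y : cotangent N M) (u : tangent N M) :
    cotangent N M :=
  toCotangent _ ((reducedSklyanin hN).pencilG_mem α β (A := ofPoint u) (ofCotangent_mem X)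
    (ofCotangent_mem Y))

theorem dualPairing_pencilGradient (hN : 0 < N) (α β : ℂ) (X Y : cotangent N M)
    (u v : tangent N M) : dualPairing N M (pencilGradient hN α β X Y u) v
      = (reducedSklyanin hN).T (ofTangent v
        * (reducedSklyanin hN).pencilG α β (ofPoint u) (ofCotangent X) (ofCotangent Y)) :=
  dualPairing_toCotangent _ _ v

variable (M) in
/-- The pencil of Poisson tensors on the coset. -/
noncomputable def pencilTensor (hN : 0 < N) (α β : ℂ) : SkewTensor (dualPairing N M) where
  P := pencilMap hN α β
  Γ := pencilGradient hN α β
  skew u X Y := by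
    rw [dualPairing_pencilMap, dualPairing_pencilMap]
    exact (reducedSklyanin hN).T_pencil_skew α β (ofCotangent_mem X) (ofCotangent_mem Y) _
  analytic X Y k u v := by
    have h := (reducedSklyanin hN).analyticOnNhd_T_pencil α β (ofCotangent_mem X)
      (ofCotangent_mem Y) (ofPoint u) fun i => ofTangent (v i)
    simp only [dualPairing_pencilMap, ofPoint_add, map_sum, map_smul]
    exact h
  gradient X Y u v := by
    have h := (reducedSklyanin hN).hasDerivAt_T_pencil α β (ofCotangent_mem X)
      (ofCotangent_mem Y) (ofPoint u) (ofTangent v)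
    simp only [dualPairing_pencilMap, dualPairing_pencilGradient, ofPoint_add, map_smul]
    exact h

theorem pencilTensor_jacobi (hN : 0 < N) (α β : ℂ) (u : tangent N M) (X Y Z : cotangent N M) :
    dualPairing N M ((pencilTensor M hN α β).Γ Y Z u) ((pencilTensor M hN α β).P u X)
      + dualPairing N M ((pencilTensor M hN α β).Γ Z X u) ((pencilTensor M hN α β).P u Y)
      + dualPairing N M ((pencilTensor M hN α β).Γ X Y u) ((pencilTensor M hN α β).P u Z)
      = 0 := by
  change dualPairing N M (pencilGradient _ _ _ _ _ _) (pencilMap _ _ _ _ _)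
    + dualPairing N M (pencilGradient _ _ _ _ _ _) (pencilMap _ _ _ _ _)
    + dualPairing N M (pencilGradient _ _ _ _ _ _) (pencilMap _ _ _ _ _) = 0
  simp only [dualPairing_pencilGradient, ofTangent_pencilMap]
  exact (reducedSklyanin hN).jacobi_pencil α β (ofCotangent_mem X) (ofCotangent_mem Y)
    (ofCotangent_mem Z) _

/-! ### Conjugations by periodic functions -/

theorem diag_commutator_apply (p : ℤ → ℂ) (A : DiffOp) (k n : ℤ) :
    (⁅diag p, A⁆ : DiffOp) k n = (p n - p (n + k)) * A k n := by
  rw [bracket_def, sub_apply, diag_mul_apply, mul_diag_apply]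
  ring

theorem diag_commutator_mem_tangent (p : ℤ → ℂ) {V : Pair} (hV : V ∈ tangent N M) :
    pairComm (diag p, diag p) V ∈ tangent N M := by
  have h : ∀ (A : DiffOp) (k n : ℤ), A k n = 0 → (⁅diag p, A⁆ : DiffOp) k n = 0 :=
    fun A k n h => by rw [diag_commutator_apply, h, mul_zero]
  refine ⟨⟨⟨mem_finCoeff_of_support hV.1.1.1 (h V.1), N, ?_⟩, ?_⟩,
    ⟨mem_finCoeff_of_support hV.2.1.1 (h V.2), -M, ?_⟩, ?_⟩
  · exact mem_degLT.2 fun k hk n => h _ _ _ (mem_degLT.1 hV.1.2 k hk n)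
  · exact mem_degLT.2 fun k hk n => h _ _ _ (mem_degLT.1 hV.1.2 k hk n)
  · exact mem_degGE.2 fun k hk n => h _ _ _ (mem_degGE.1 hV.2.2 k hk n)
  · exact mem_degGE.2 fun k hk n => h _ _ _ (mem_degGE.1 hV.2.2 k hk n)

theorem pairComm_add (X A B : Pair) (hX : X ∈ coupledExt) (hA : A ∈ coupledExt)
    (hB : B ∈ coupledExt) : pairComm X (A + B) = pairComm X A + pairComm X B := by
  let f : ∀ Y ∈ coupledExt, PairRing := fun Y hY => (⟨Y.1, hY.1⟩, ⟨Y.2, hY.2⟩)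
  have h : f X hX * (f A hA + f B hB) - (f A hA + f B hB) * f X hX
      = (f X hX * f A hA - f A hA * f X hX) + (f X hX * f B hB - f B hB * f X hX) := by
    rw [mul_add, add_mul]; abel
  exact congrArg toPair h

theorem diag_commutator_shift {p : ℤ → ℂ} (hp : ∀ n, p (n + N) = p n) :
    (⁅diag p, shiftPow N⁆ : DiffOp) = 0 := by
  ext k n
  rw [diag_commutator_apply, zero_apply]
  by_cases h : k = N
  · rw [h, hp, sub_self, zero_mul]
  · rw [show shiftPow N k n = 0 from if_neg h, mul_zero]

theorem diag_mem_coupledExt (p : ℤ → ℂ) : (diag p, diag p) ∈ coupledExt :=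
  ⟨⟨1, diag_mem_degLT p⟩, 0, diag_mem_degGE p⟩

/-- The derivative of the conjugations by a function. -/
noncomputable def adDiag (p : ℤ → ℂ) (v : tangent N M) : tangent N M :=
  ⟨_, diag_commutator_mem_tangent p v.2⟩

theorem adDiag_add_smul (p : ℤ → ℂ) (u w : tangent N M) (t : ℂ) :
    adDiag p (u + t • w) = adDiag p u + t • adDiag p w := by
  have h : diagPair p * (ofTangent u + t • ofTangent w) - (ofTangent u + t • ofTangent w)
      * diagPair p = (diagPair p * ofTangent u - ofTangent u * diagPair p)
        + t • (diagPair p * ofTangent w - ofTangent w * diagPair p) := by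
    rw [mul_add, add_mul, mul_smul_comm, smul_mul_assoc]
    module
  exact Subtype.ext (congrArg toPair h)

theorem ofTangent_adDiag (p : ℤ → ℂ) (u : tangent N M) :
    ofTangent (adDiag p u) = diagPair p * ofTangent u - ofTangent u * diagPair p := rfl

/-- Λᴺ commutes with N-periodic functions, so the infinitesimal conjugation is tangent to the coset
and linear in the coordinate u. -/
theorem adDiag_eq {p : ℤ → ℂ} (hp : ∀ n, p (n + N) = p n) (u : tangent N M) :
    (adDiag p u : Pair) = pairComm (diag p, diag p) (point u) := by
  rw [point, pairComm_add _ _ _ (diag_mem_coupledExt p) ⟨⟨_, shiftPow_mem_degLT N⟩, zero_mem _⟩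
    (⟨u.2.1.1.2, u.2.2.1.2⟩)]
  have h : pairComm (diag p, diag p) (shiftPow N, 0) = 0 :=
    Prod.ext (diag_commutator_shift hp) (by
      change diag p * 0 - 0 * diag p = 0
      rw [mul_zero', zero_mul', sub_zero])
  rw [h, zero_add]
  rfl

theorem ofTangent_adDiag_of_periodic {p : ℤ → ℂ} (hp : ∀ n, p (n + N) = p n) (u : tangent N M) :
    ofTangent (adDiag p u) = diagPair p * ofPoint u - ofPoint u * diagPair p :=
  toPair_injective (adDiag_eq hp u)

theorem pencilTensor_invariant (hN : 0 < N) (α β : ℂ) {p : ℤ → ℂ} (hp : ∀ n, p (n + N) = p n)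
    (u : tangent N M) (X Y : cotangent N M) :
    dualPairing N M ((pencilTensor M hN α β).Γ X Y u) (adDiag p u)
      = dualPairing N M X (adDiag p ((pencilTensor M hN α β).P u Y))
        - dualPairing N M Y (adDiag p ((pencilTensor M hN α β).P u X)) := by
  change dualPairing N M (pencilGradient _ _ _ _ _ _) _
    = dualPairing N M X (adDiag p (pencilMap _ _ _ _ _))
      - dualPairing N M Y (adDiag p (pencilMap _ _ _ _ _))
  rw [dualPairing_pencilGradient, dualPairing_apply, dualPairing_apply,
    ofTangent_adDiag_of_periodic hp u]
  simp only [ofTangent_adDiag, ofTangent_pencilMap]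
  exact (reducedSklyanin hN).T_commutator_mul_pencilG α β (ofCotangent_mem X) (ofCotangent_mem Y)
    ⟨p, rfl⟩ _

end Toda

namespace Toda

open DiffOp

variable {N M : ℕ} {F G H : tangent N M → ℂ}

/-! ### Gradients of functionals -/

theorem grad_mem (F : tangent N M → ℂ) (u : tangent N M) : grad F u ∈ cotangent N M := by
  rw [grad]
  split_ifs with h
  · exact h.choose_spec.1
  · exact zero_mem _

/-- The gradient as a covector. -/
noncomputable def gradVec (F : tangent N M → ℂ) (u : tangent N M) : cotangent N M :=
  ⟨grad F u, grad_mem F u⟩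

theorem hasGrad_iff {F : tangent N M → ℂ} {u : tangent N M} {X : cotangent N M} :
    HasGrad F u X ↔ ∀ v, HasDerivAt (fun t : ℂ => F (u + t • v)) (dualPairing N M X v) 0 := by
  simp only [dualPairing_eq]
  exact ⟨fun h => h.2, fun h => ⟨X.2, h⟩⟩

theorem isGradient_gradVec (hF : IsFunctional F) : IsGradient (dualPairing N M) F (gradVec F) := by
  intro u
  have h : HasGrad F u (gradVec F u) := by
    change HasGrad F u (grad F u)
    rw [grad, dif_pos (hF.2 u)]
    exact (hF.2 u).choose_spec
  exact hasGrad_iff.1 h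

theorem isFunctional_of_isGradient (hF : AnalyticOnSubspaces F) {dF : tangent N M → cotangent N M}
    (hdF : IsGradient (dualPairing N M) F dF) : IsFunctional F :=
  ⟨hF, fun u => ⟨dF u, hasGrad_iff.2 (hdF u)⟩⟩

/-- Coordinate vectors separate covectors, so gradients are unique and the choice in `grad` is
immaterial. -/
theorem gradVec_eq {u : tangent N M} {X : cotangent N M}
    (h : ∀ v, HasDerivAt (fun t : ℂ => F (u + t • v)) (dualPairing N M X v) 0) :
    gradVec F u = X := by
  have he : ∃ Y, HasGrad F u Y := ⟨X, hasGrad_iff.2 h⟩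
  have h' : HasGrad F u (gradVec F u) := by
    change HasGrad F u (grad F u)
    rw [grad, dif_pos he]
    exact he.choose_spec
  exact cotangent_ext_pairing fun v => (hasGrad_iff.1 h' v).unique (h v)

theorem gradVec_add (hF : IsFunctional F) (hG : IsFunctional G) (u : tangent N M) :
    gradVec (F + G) u = gradVec F u + gradVec G u :=
  gradVec_eq fun v => by
    rw [map_add, LinearMap.add_apply]
    exact (isGradient_gradVec hF u v).add (isGradient_gradVec hG u v)

theorem gradVec_smul (c : ℂ) (hF : IsFunctional F) (u : tangent N M) :
    gradVec (c • F) u = c • gradVec F u :=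
  gradVec_eq fun v => by
    rw [map_smul, LinearMap.smul_apply]
    exact (isGradient_gradVec hF u v).const_mul c

theorem gradVec_mul (hF : IsFunctional F) (hG : IsFunctional G) (u : tangent N M) :
    gradVec (F * G) u = F u • gradVec G u + G u • gradVec F u :=
  gradVec_eq fun v => by
    refine ((isGradient_gradVec hF u v).mul (isGradient_gradVec hG u v)).congr_deriv ?_
    simp only [map_add, map_smul, LinearMap.add_apply, LinearMap.smul_apply, smul_eq_mul, zero_smul,
      add_zero]
    ring

theorem isFunctional_bracket (T : SkewTensor (dualPairing N M)) (hF : IsFunctional F)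
    (hH : IsFunctional H) : IsFunctional (T.bracket (gradVec F) (gradVec H)) := by
  obtain ⟨dK, hK⟩ := T.exists_gradient_bracket (coordinates N M) hF.1 (isGradient_gradVec hF)
    hH.1 (isGradient_gradVec hH)
  exact isFunctional_of_isGradient (T.analytic_bracket (coordinates N M) hF.1
    (isGradient_gradVec hF) hH.1 (isGradient_gradVec hH)) hK

/-! ### Poisson tensors -/

theorem poissonBracket_eq {P : Pair → Pair → Pair} {u : tangent N M} {w : tangent N M}
    (h : P (point u) (grad H u) = w) :
    poissonBracket P F H u = dualPairing N M (gradVec F u) w := by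
  rw [poissonBracket, h, dualPairing_eq]
  rfl

/-- A tensor whose brackets of functions of the class `C` are those of a skew tensor satisfying the
Jacobi identity on constant covectors. -/
theorem isPoissonTensor_of_skewTensor (T : SkewTensor (dualPairing N M))
    (hT : ∀ u X Y Z, dualPairing N M (T.Γ Y Z u) (T.P u X) + dualPairing N M (T.Γ Z X u) (T.P u Y)
      + dualPairing N M (T.Γ X Y u) (T.P u Z) = 0)
    {C : (tangent N M → ℂ) → Prop} (hC : ∀ F, C F → IsFunctional F) {P : Pair → Pair → Pair}
    (mapsTo : ∀ A ∈ coset N M, ∀ X ∈ cotangent N M, P A X ∈ tangent N M)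
    (map_add : ∀ A ∈ coset N M, ∀ X ∈ cotangent N M, ∀ Y ∈ cotangent N M,
      P A (X + Y) = P A X + P A Y)
    (map_smul : ∀ A ∈ coset N M, ∀ (c : ℂ), ∀ X ∈ cotangent N M, P A (c • X) = c • P A X)
    (hP : ∀ F H, C F → C H → poissonBracket P F H = T.bracket (gradVec F) (gradVec H))
    (closed : ∀ F H, C F → C H → C (T.bracket (gradVec F) (gradVec H))) :
    IsPoissonTensor N M C P where
  mapsTo := mapsTo
  map_add := map_add
  map_smul := map_smul
  closed F H hF hH := by rw [hP F H hF hH]; exact closed F H hF hH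
  add_left F G H hF hG _ := by
    funext u
    let w : tangent N M := ⟨_, mapsTo _ (point_mem_coset u) _ (grad_mem H u)⟩
    rw [Pi.add_apply, poissonBracket_eq (w := w) rfl, poissonBracket_eq (w := w) rfl,
      poissonBracket_eq (w := w) rfl, gradVec_add (hC F hF) (hC G hG), _root_.map_add,
      LinearMap.add_apply]
  smul_left c F H hF _ := by
    funext u
    let w : tangent N M := ⟨_, mapsTo _ (point_mem_coset u) _ (grad_mem H u)⟩
    rw [Pi.smul_apply, poissonBracket_eq (w := w) rfl, poissonBracket_eq (w := w) rfl,
      gradVec_smul c (hC F hF), _root_.map_smul, LinearMap.smul_apply]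
  skew F H hF hH := by
    funext u
    rw [hP F H hF hH, Pi.neg_apply, hP H F hH hF]
    exact T.skew u _ _
  leibniz F G H hF hG _ := by
    funext u
    let w : tangent N M := ⟨_, mapsTo _ (point_mem_coset u) _ (grad_mem H u)⟩
    rw [Pi.add_apply, Pi.mul_apply, Pi.mul_apply, poissonBracket_eq (w := w) rfl,
      poissonBracket_eq (w := w) rfl, poissonBracket_eq (w := w) rfl,
      gradVec_mul (hC F hF) (hC G hG)]
    simp only [_root_.map_add, _root_.map_smul, LinearMap.add_apply, LinearMap.smul_apply,
      smul_eq_mul]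
    ring
  jacobi F G H hF hG hH := by
    funext u
    have k1 := closed G H hG hH
    have k2 := closed H F hH hF
    have k3 := closed F G hF hG
    rw [hP G H hG hH, hP H F hH hF, hP F G hF hG, hP F _ hF k1, hP G _ hG k2, hP H _ hH k3]
    exact T.jacobi_bracket (coordinates N M) hT (hC F hF).1 (isGradient_gradVec (hC F hF))
      (hC G hG).1 (isGradient_gradVec (hC G hG)) (hC H hH).1 (isGradient_gradVec (hC H hH))
      (isGradient_gradVec (hC _ k1)) (isGradient_gradVec (hC _ k2)) (isGradient_gradVec (hC _ k3))
      u

theorem isPoissonTensor_pencil (hN : 0 < N) (α β : ℂ) {P : Pair → Pair → Pair}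
    (hP : ∀ A X, P A X = α • P1red A X + β • P2red N A X) :
    IsPoissonTensor N M IsFunctional P := by
  have h : ∀ (u : tangent N M) (X : cotangent N M), P (point u) X = pencilMap hN α β u X :=
    fun u X => by rw [hP, coe_pencilMap]
  refine isPoissonTensor_of_skewTensor (pencilTensor M hN α β) (pencilTensor_jacobi hN α β)
    (fun _ hF => hF) ?_ ?_ ?_ ?_ fun F H hF hH => isFunctional_bracket _ hF hH
  · intro A hA X hX
    obtain ⟨u, rfl⟩ := mem_coset_iff.1 hA
    rw [h u ⟨X, hX⟩]
    exact Subtype.prop _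
  · intro A hA X hX Y hY
    obtain ⟨u, rfl⟩ := mem_coset_iff.1 hA
    rw [h u ⟨X, hX⟩, h u ⟨Y, hY⟩, h u ⟨X + Y, add_mem hX hY⟩, ← Submodule.coe_add, ← map_add]
    rfl
  · intro A hA c X hX
    obtain ⟨u, rfl⟩ := mem_coset_iff.1 hA
    rw [h u ⟨X, hX⟩, h u ⟨c • X, Submodule.smul_mem _ c hX⟩, ← Submodule.coe_smul, ← map_smul]
    rfl
  · intro F H hF hH
    funext u
    exact poissonBracket_eq (h u (gradVec H u))

theorem compatiblePoisson_reduced (hN : 0 < N) :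
    CompatiblePoisson N M IsFunctional P1red (P2red N) :=
  ⟨isPoissonTensor_pencil hN 1 0 fun A X => by rw [one_smul, zero_smul, add_zero],
    isPoissonTensor_pencil hN 0 1 fun A X => by rw [one_smul, zero_smul, zero_add],
    fun α β => isPoissonTensor_pencil hN α β fun _ _ => rfl⟩

end Toda

/-! ### The one-sided expansion and periodic invariance. -/

namespace Toda

open DiffOp

theorem pairComm_diag_add (p q : ℤ → ℂ) (A : Pair) : pairComm (diag (p + q), diag (p + q)) A
    = pairComm (diag p, diag p) A + pairComm (diag q, diag q) A := by
  refine Prod.ext (DiffOp.ext fun k n => ?_) (DiffOp.ext fun k n => ?_)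
  all_goals
    simp only [pairComm, Prod.fst_add, Prod.snd_add, add_apply, diag_commutator_apply, Pi.add_apply]
    ring

theorem pairComm_diag_smul (c : ℂ) (p : ℤ → ℂ) (A : Pair) :
    pairComm (diag (c • p), diag (c • p)) A = c • pairComm (diag p, diag p) A := by
  refine Prod.ext (DiffOp.ext fun k n => ?_) (DiffOp.ext fun k n => ?_)
  all_goals
    simp only [pairComm, Prod.smul_fst, Prod.smul_snd, smul_apply, diag_commutator_apply,
      Pi.smul_apply, smul_eq_mul]
    ring

section Correction

variable {N M : ℕ}

theorem corrFun_sub_shift {inv : (ℤ → ℂ) → (ℤ → ℂ)}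
    (hinv : ∀ g ∈ finFun, ∀ n, inv g n - inv g (n + N) = g n) {A X : Pair}
    (hA : A ∈ coupledExt) (hX : X ∈ coupled) (n : ℤ) :
    corrFun inv N A X n - corrFun inv N A X (n + N) = (1 / 2 : ℂ)
      * ((⁅X.1, A.1⁆ + ⁅X.2, A.2⁆ : DiffOp).res n + (⁅X.1, A.1⁆ + ⁅X.2, A.2⁆ : DiffOp).res (n + N)) := by
  have h := hinv _ (residue_mem_finFun hA hX)
  simp only [corrFun]
  linear_combination (1 / 2 : ℂ) * h n + (1 / 2 : ℂ) * h (n + N)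

theorem residue_add {A X Y : Pair} (hA : A ∈ coupledExt) (hX : X ∈ coupled) (hY : Y ∈ coupled) :
    (⁅(X + Y).1, A.1⁆ + ⁅(X + Y).2, A.2⁆ : DiffOp).res
      = (⁅X.1, A.1⁆ + ⁅X.2, A.2⁆ : DiffOp).res + (⁅Y.1, A.1⁆ + ⁅Y.2, A.2⁆ : DiffOp).res := by
  have h : ∀ a x y : PairRing, resSum ((x + y) * a - a * (x + y))
      = resSum (x * a - a * x) + resSum (y * a - a * y) := fun a x y => by
    rw [← map_add, add_mul, mul_add, add_sub_add_comm]
  exact h (⟨A.1, hA.1⟩, ⟨A.2, hA.2⟩) (ofCoupled ⟨X, hX⟩) (ofCoupled ⟨Y, hY⟩)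

theorem residue_smul {A X : Pair} (hA : A ∈ coupledExt) (hX : X ∈ coupled) (c : ℂ) :
    (⁅(c • X).1, A.1⁆ + ⁅(c • X).2, A.2⁆ : DiffOp).res
      = c • (⁅X.1, A.1⁆ + ⁅X.2, A.2⁆ : DiffOp).res := by
  have h : ∀ a x : PairRing, resSum ((c • x) * a - a * (c • x)) = c • resSum (x * a - a * x) :=
    fun a x => by rw [← map_smul, smul_mul_assoc, mul_smul_comm, smul_sub]
  exact h (⟨A.1, hA.1⟩, ⟨A.2, hA.2⟩) (ofCoupled ⟨X, hX⟩)

/-- The difference of the corrections of the one-sided and of the symmetric expansions. -/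
noncomputable def corrDiff (N : ℕ) (A X : Pair) : ℤ → ℂ :=
  corrFun (invForward N) N A X - corrFun (invSym N) N A X

theorem P2redForward_eq (N : ℕ) (A X : Pair) : P2redForward N A X
    = P2red N A X - pairComm (diag (corrDiff N A X), diag (corrDiff N A X)) A := by
  have h : corrFun (invForward N) N A X = corrFun (invSym N) N A X + corrDiff N A X :=
    (add_sub_cancel _ _).symm
  rw [P2redForward, P2corr, h, pairComm_diag_add, P2red, P2corr, sub_sub]

/-- Both corrections solve the same difference equation with step N. -/
theorem corrDiff_periodic (hN : 0 < N) {A X : Pair} (hA : A ∈ coupledExt) (hX : X ∈ coupled)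
    (n : ℤ) : corrDiff N A X (n + N) = corrDiff N A X n := by
  have h1 := corrFun_sub_shift (fun _ hg => invForward_sub_shift hN hg) hA hX n
  have h2 := corrFun_sub_shift (fun _ hg => invSym_sub_shift hN hg) hA hX n
  simp only [corrDiff, Pi.sub_apply]
  linear_combination h2 - h1

theorem corrDiff_add (hN : 0 < N) {A X Y : Pair} (hA : A ∈ coupledExt) (hX : X ∈ coupled)
    (hY : Y ∈ coupled) : corrDiff N A (X + Y) = corrDiff N A X + corrDiff N A Y := by
  funext n
  have kX := residue_mem_finFun hA hX
  have kY := residue_mem_finFun hA hY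
  simp only [corrDiff, corrFun, Pi.sub_apply, Pi.add_apply]
  rw [residue_add hA hX hY]
  simp only [invForward_add hN kX kY, invSym_add hN kX kY]
  ring

theorem corrDiff_smul {A X : Pair} (hA : A ∈ coupledExt) (hX : X ∈ coupled) (c : ℂ) :
    corrDiff N A (c • X) = c • corrDiff N A X := by
  funext n
  simp only [corrDiff, corrFun, Pi.sub_apply, Pi.smul_apply, smul_eq_mul]
  rw [residue_smul hA hX c]
  simp only [invForward_smul, invSym_smul]
  ring

theorem pairing_pairComm_diag {A X : Pair} (hA : A ∈ coupledExt) (hX : X ∈ coupled)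
    (p : ℤ → ℂ) : pairing X (pairComm (diag p, diag p) A)
      = -∑ᶠ n, (⁅X.1, A.1⁆ + ⁅X.2, A.2⁆ : DiffOp).res n * p n := by
  let a : PairRing := (⟨A.1, hA.1⟩, ⟨A.2, hA.2⟩)
  let x : PairRing := ofCoupled ⟨X, hX⟩
  have hx : x ∈ coupledIdeal := hX
  have h1 : pairTrace (x * (diagPair p * a - a * diagPair p))
      = -pairTrace ((x * a - a * x) * diagPair p) := by
    have h := pairTrace_cyclic (coupledIdeal_mul_right hx (diagPair p)) a
    simp only [mul_sub, sub_mul, map_sub, mul_assoc] at *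
    rw [h]; ring
  rw [pairTrace_mul_diagPair (commutator_mem hx a),
    ← pairing_toPair (coupledIdeal_mul_right hx _)] at h1
  exact h1

/-- Forward minus symmetric is half of forward minus backward, and the operators built from these
two are minus each other's adjoints; the difference is self-adjoint. -/
theorem finsum_corrDiff_symm (hN : 0 < N) {f g : ℤ → ℂ} (hf : f ∈ finFun) (hg : g ∈ finFun) :
    ∑ᶠ n, f n * ((invForward N g n + invForward N g (n + N))
        - (invSym N g n + invSym N g (n + N)))
      = ∑ᶠ n, g n * ((invForward N f n + invForward N f (n + N))
        - (invSym N f n + invSym N f (n + N))) := by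
  have h : ∀ g n, invForward N g n + invForward N g (n + N) - (invSym N g n + invSym N g (n + N))
      = 1 / 2 * ((invForward N g n + invForward N g (n + N))
        + -1 * (invBackward N g n + invBackward N g (n + N))) := fun g n => by
    simp only [invSym]; ring
  simp only [h, finsum_mul_const_mul]
  rw [finsum_mul_add_distrib hf, finsum_mul_add_distrib hg, finsum_mul_const_mul,
    finsum_mul_const_mul]
  linear_combination (1 / 2) * finsum_forward_eq_neg_backward hN hf hg
    - (1 / 2) * finsum_forward_eq_neg_backward hN hg hf

theorem pairing_corrDiff_symm (hN : 0 < N) {A X Y : Pair} (hA : A ∈ coupledExt)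
    (hX : X ∈ coupled) (hY : Y ∈ coupled) :
    pairing X (pairComm (diag (corrDiff N A Y), diag (corrDiff N A Y)) A)
      = pairing Y (pairComm (diag (corrDiff N A X), diag (corrDiff N A X)) A) := by
  rw [pairing_pairComm_diag hA hX, pairing_pairComm_diag hA hY]
  have h := finsum_corrDiff_symm hN (residue_mem_finFun hA hX) (residue_mem_finFun hA hY)
  have e : ∀ (f : ℤ → ℂ) Y n, f n * corrDiff N A Y n = f n * (1 / 2
      * ((invForward N (⁅Y.1, A.1⁆ + ⁅Y.2, A.2⁆ : DiffOp).res n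
          + invForward N (⁅Y.1, A.1⁆ + ⁅Y.2, A.2⁆ : DiffOp).res (n + N))
        - (invSym N (⁅Y.1, A.1⁆ + ⁅Y.2, A.2⁆ : DiffOp).res n
          + invSym N (⁅Y.1, A.1⁆ + ⁅Y.2, A.2⁆ : DiffOp).res (n + N)))) := fun f Y n => by
    simp only [corrDiff, corrFun, Pi.sub_apply]
    ring
  simp only [e, finsum_mul_const_mul, h]

/-- A 1-periodic function is constant, hence central. For N = 1 this removes the difference of the
two corrections. -/
theorem pairComm_diag_eq_zero {p : ℤ → ℂ} (hp : ∀ n, p (n + 1) = p n) (A : Pair) :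
    pairComm (diag p, diag p) A = 0 := by
  have h : ∀ n k, p (n + k) = p n := fun n k => by
    induction k with
    | zero => rw [add_zero]
    | succ k ih => rw [← add_assoc, hp, ih]
    | pred k ih => rw [← ih, ← hp (n + (-k - 1))]; congr 1; ring
  refine Prod.ext (DiffOp.ext fun k n => ?_) (DiffOp.ext fun k n => ?_)
  all_goals exact (diag_commutator_apply _ _ _ _).trans (by rw [h, sub_self, zero_mul]; rfl)

end Correction

section Forward

variable {N M : ℕ}

theorem P2redForward_eq_P2red {A X : Pair} (hA : A ∈ coset 1 M) (hX : X ∈ cotangent 1 M) :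
    P2redForward 1 A X = P2red 1 A X := by
  rw [P2redForward_eq, pairComm_diag_eq_zero, sub_zero]
  exact corrDiff_periodic one_pos (coset_subset_coupledExt hA) (cotangent_le_coupled hX)

theorem point_mem_coupledExt (u : tangent N M) : point u ∈ coupledExt :=
  coset_subset_coupledExt (point_mem_coset u)

theorem coe_adDiag_corrDiff (hN : 0 < N) (u : tangent N M) (X : cotangent N M) :
    (adDiag (corrDiff N (point u) X) u : Pair)
      = pairComm (diag (corrDiff N (point u) X), diag (corrDiff N (point u) X)) (point u) :=
  adDiag_eq (corrDiff_periodic hN (point_mem_coupledExt u) (cotangent_le_coupled X.2)) u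

theorem pencil_forward_eq (hN : 0 < N) (α β : ℂ) (u : tangent N M) (X : cotangent N M) :
    α • P1red (point u) X + β • P2redForward N (point u) X
      = (pencilMap hN α β u X - β • adDiag (corrDiff N (point u) X) u : tangent N M) := by
  rw [Submodule.coe_sub, Submodule.coe_smul, coe_pencilMap, coe_adDiag_corrDiff hN, P2redForward_eq]
  module

theorem pairing_P2red_skew (hN : 0 < N) (u : tangent N M) (X Y : cotangent N M) :
    pairing X (P2red N (point u) Y) = -pairing Y (P2red N (point u) X) := by
  have h := (pencilTensor M hN 0 1).skew u X Y
  have e : ∀ X : cotangent N M, ((pencilTensor M hN 0 1).P u X : Pair) = P2red N (point u) X :=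
    fun X => by
      refine (coe_pencilMap hN 0 1 u X).trans ?_
      rw [one_smul, zero_smul, zero_add]
  rwa [dualPairing_eq, dualPairing_eq, e, e] at h

theorem pairing_P2redForward (hN : 0 < N) (u : tangent N M) (X Y : cotangent N M) :
    pairing X (P2redForward N (point u) Y) = pairing X (P2red N (point u) Y)
      - pairing X (pairComm (diag (corrDiff N (point u) Y), diag (corrDiff N (point u) Y))
        (point u)) := by
  have h := pencil_forward_eq hN 0 1 u Y
  have h' := coe_pencilMap hN 0 1 u Y
  rw [one_smul, zero_smul, zero_add] at h h'
  rw [h, ← dualPairing_eq, map_sub, one_smul, dualPairing_eq, dualPairing_eq, h',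
    coe_adDiag_corrDiff hN]

theorem P2red_eq_skew_part (hN : 0 < N) {A X Y : Pair} (hA : A ∈ coset N M)
    (hX : X ∈ cotangent N M) (hY : Y ∈ cotangent N M) : pairing X (P2red N A Y)
      = (1 / 2 : ℂ) * (pairing X (P2redForward N A Y) - pairing Y (P2redForward N A X)) := by
  obtain ⟨u, rfl⟩ := mem_coset_iff.1 hA
  have h1 := pairing_P2redForward hN u ⟨X, hX⟩ ⟨Y, hY⟩
  have h2 := pairing_P2redForward hN u ⟨Y, hY⟩ ⟨X, hX⟩
  have h3 := pairing_P2red_skew hN u ⟨X, hX⟩ ⟨Y, hY⟩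
  have h4 := pairing_corrDiff_symm hN (point_mem_coupledExt u) (cotangent_le_coupled hX)
    (cotangent_le_coupled hY)
  simp only at h1 h2 h3
  rw [h1, h2]
  linear_combination (1 / 2) * h3 + (1 / 2) * h4

theorem IsPeriodicInvariant.dualPairing_eq_zero {F : tangent N M → ℂ} (hF : IsPeriodicInvariant F)
    {p : ℤ → ℂ} (hp : ∀ n, p (n + N) = p n) (u : tangent N M) :
    dualPairing N M (gradVec F u) (adDiag p u) = 0 := by
  rw [dualPairing_eq, adDiag_eq hp]
  exact hF.2 u p hp

theorem isPeriodicInvariant_bracket (hN : 0 < N) (α β : ℂ) {F H : tangent N M → ℂ}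
    (hF : IsPeriodicInvariant F) (hH : IsPeriodicInvariant H) :
    IsPeriodicInvariant ((pencilTensor M hN α β).bracket (gradVec F) (gradVec H)) := by
  have hK := isFunctional_bracket (pencilTensor M hN α β) hF.1 hH.1
  refine ⟨hK, fun u p hp => ?_⟩
  have h := (pencilTensor M hN α β).bracket_invariant (coordinates N M) (ξ := adDiag p)
    (L := adDiag p) (fun u w t => adDiag_add_smul p u w t)
    (fun u X Y => pencilTensor_invariant hN α β hp u X Y) hF.1.1 (isGradient_gradVec hF.1)
    (fun u => hF.dualPairing_eq_zero hp u) hH.1.1 (isGradient_gradVec hH.1)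
    (fun u => hH.dualPairing_eq_zero hp u) (isGradient_gradVec hK) u
  rwa [dualPairing_eq, adDiag_eq hp] at h

/-- The tensor differs from the skew pencil by conjugation fields of periodic functions, which pair
to zero with gradients of invariant functionals. On this class the two brackets coincide, although
the tensor itself need not be skew. -/
theorem isPoissonTensor_forward (hN : 0 < N) (α β : ℂ) {P : Pair → Pair → Pair}
    (hP : ∀ A X, P A X = α • P1red A X + β • P2redForward N A X) :
    IsPoissonTensor N M IsPeriodicInvariant P := by
  have h : ∀ (u : tangent N M) (X : cotangent N M), P (point u) X
      = (pencilMap hN α β u X - β • adDiag (corrDiff N (point u) X) u : tangent N M) :=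
    fun u X => by rw [hP, pencil_forward_eq hN]
  have h' : ∀ (u : tangent N M) (X : cotangent N M), P (point u) X = pencilMap hN α β u X
      - β • pairComm (diag (corrDiff N (point u) X), diag (corrDiff N (point u) X)) (point u) :=
    fun u X => by rw [h, Submodule.coe_sub, Submodule.coe_smul, coe_adDiag_corrDiff hN]
  refine isPoissonTensor_of_skewTensor (pencilTensor M hN α β) (pencilTensor_jacobi hN α β)
    (fun _ hF => hF.1) ?_ ?_ ?_ ?_ fun F H hF hH => isPeriodicInvariant_bracket hN α β hF hH
  · intro A hA X hX
    obtain ⟨u, rfl⟩ := mem_coset_iff.1 hA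
    rw [h u ⟨X, hX⟩]
    exact Subtype.prop _
  · intro A hA X hX Y hY
    obtain ⟨u, rfl⟩ := mem_coset_iff.1 hA
    have e := congrArg (Subtype.val) (map_add (pencilMap hN α β u) ⟨X, hX⟩ ⟨Y, hY⟩)
    rw [Submodule.coe_add] at e
    rw [h' u ⟨X, hX⟩, h' u ⟨Y, hY⟩, h' u ⟨X + Y, add_mem hX hY⟩,
      corrDiff_add hN (point_mem_coupledExt u) (cotangent_le_coupled hX) (cotangent_le_coupled hY),
      pairComm_diag_add, smul_add, sub_add_sub_comm, ← e]
    rfl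
  · intro A hA c X hX
    obtain ⟨u, rfl⟩ := mem_coset_iff.1 hA
    have e := congrArg (Subtype.val) (map_smul (pencilMap hN α β u) c ⟨X, hX⟩)
    rw [Submodule.coe_smul] at e
    rw [h' u ⟨X, hX⟩, h' u ⟨c • X, Submodule.smul_mem _ c hX⟩,
      corrDiff_smul (point_mem_coupledExt u) (cotangent_le_coupled hX),
      pairComm_diag_smul, smul_comm β c, smul_sub, ← e]
    rfl
  · intro F H hF hH
    funext u
    rw [poissonBracket_eq (h u (gradVec H u)), map_sub, map_smul, hF.dualPairing_eq_zero
      (corrDiff_periodic hN (point_mem_coupledExt u) (cotangent_le_coupled (gradVec H u).2)) u,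
      smul_zero, sub_zero]
    rfl

theorem compatiblePoisson_forward (hN : 0 < N) :
    CompatiblePoisson N M IsPeriodicInvariant P1red (P2redForward N) :=
  ⟨isPoissonTensor_forward hN 1 0 fun A X => by rw [one_smul, zero_smul, add_zero],
    isPoissonTensor_forward hN 0 1 fun A X => by rw [one_smul, zero_smul, zero_add],
    fun α β => isPoissonTensor_forward hN α β fun _ _ => rfl⟩

end Forward

end Toda

/-! ### Comparison with the R-matrix brackets, and Dirac reduction. -/

namespace SklyaninData

variable {R : Type*} [Ring R] [Algebra ℂ R] (S : SklyaninData R)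

theorem T_mul_commutator {Y : R} (hY : Y ∈ S.I) (c A : R) :
    S.T (Y * (c * A - A * c)) = S.T ((A * Y - Y * A) * c) := by
  have h := S.rotate hY A c
  simp only [mul_sub, sub_mul, map_sub, mul_assoc] at *
  rw [h]

/-- The adjoint of s + δ is δ - s; this moves both halves of the R-matrix bracket onto one covector.
-/
theorem T_mul_add_δ {X Y : R} (hX : X ∈ S.I) (hY : Y ∈ S.I) :
    S.T (X * (S.s Y + S.δ Y)) = S.T (Y * (S.δ X - S.s X)) := by
  rw [mul_add, map_add, S.skew X hX Y hY, S.δ_symm X hX Y hY, mul_sub, map_sub]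
  ring

/-- The linear tensor is that of the `R`-matrix bracket of `s + δ`. -/
theorem T_linW_eq (hγ : S.γ = 0) {X Y : R} (hX : X ∈ S.I) (hY : Y ∈ S.I) (A : R) :
    S.T (X * S.linW A Y) = (1 / 2 : ℂ) * (S.T ((A * X - X * A) * (S.s Y + S.δ Y))
      - S.T ((A * Y - Y * A) * (S.s X + S.δ X))) := by
  rw [S.T_mul_add_δ (sub_mem (S.mul_left Y hY A) (S.mul_right Y hY A)) hX,
    ← S.T_mul_commutator hX]
  simp only [linW, a, b, hγ, LinearMap.zero_apply, smul_zero, sub_zero, one_mul, mul_one, map_sub,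
    mul_add, mul_sub, add_mul, map_add, mul_smul_comm, smul_mul_assoc, map_smul,
    smul_eq_mul]
  ring

/-- The quadratic tensor is that of the `R`-matrix bracket of `s + δ`. -/
theorem T_W_eq (hγ : S.γ = 0) {X Y : R} (hX : X ∈ S.I) (hY : Y ∈ S.I) (A : R) :
    S.T (X * S.W A Y) = (1 / 4 : ℂ)
      * (S.T ((A * X - X * A) * (S.s (A * Y + Y * A) + S.δ (A * Y + Y * A)))
        - S.T ((A * Y - Y * A) * (S.s (A * X + X * A) + S.δ (A * X + X * A)))) := by
  rw [S.T_mul_add_δ (sub_mem (S.mul_left Y hY A) (S.mul_right Y hY A))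
    (add_mem (S.mul_left X hX A) (S.mul_right X hX A)), T_W, S.β_eq hX]
  simp only [a, b, hγ, LinearMap.zero_apply, smul_zero, sub_zero, map_sub,
    mul_add, mul_sub, add_mul, sub_mul, map_add, mul_smul_comm, map_smul,
    smul_eq_mul]
  ring

end SklyaninData

namespace Toda

open DiffOp

/-! ### The `R`-matrix brackets -/

/-- The quadratic bracket without correction. -/
noncomputable def freeSklyanin : SklyaninData PairRing :=
  sklyanin 0 fun f _ g _ => by simp

theorem toPair_freeSklyanin_W (A X : PairRing) :
    toPair (freeSklyanin.W A X) = P2 (toPair A) (toPair X) := by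
  rw [freeSklyanin, toPair_W, LinearMap.zero_apply, smul_zero, sub_eq_self]
  exact pairComm_diag_eq_zero (fun _ => rfl) _

theorem toPair_freeSklyanin_linW (A X : PairRing) :
    toPair (freeSklyanin.linW A X) = P1 (toPair A) (toPair X) :=
  toPair_linW _ _ A X

/-- Adding the full diagonal residue to the evenly split operator turns its halves into the sharp
truncations of R. -/
theorem toPair_skewR_add (X : PairRing) :
    toPair (freeSklyanin.s X + freeSklyanin.δ X) = Rmat (toPair X) := by
  refine Prod.ext ?_ ?_
  · change (X.1.1 - (2 : ℂ) • lowHalf (X.1.1 + X.2.1)) + diag (resSum X)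
      = X.1.1.ge 0 - X.1.1.lt 0 - (2 : ℂ) • X.2.1.lt 0
    rw [diag_resSum, lt_zero_eq, lt_zero_eq, ge_zero_eq, map_add]
    nth_rewrite 1 [← lowHalf_add_highHalf X.1.1]
    module
  · change (-X.2.1 + (2 : ℂ) • highHalf (X.1.1 + X.2.1)) + diag (resSum X)
      = X.2.1.ge 0 - X.2.1.lt 0 + (2 : ℂ) • X.1.1.ge 0
    rw [diag_resSum, lt_zero_eq, ge_zero_eq, ge_zero_eq, map_add]
    nth_rewrite 1 [← lowHalf_add_highHalf X.2.1]
    module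

theorem pairing_eq_rBrackets {A X Y : Pair} (hA : A ∈ coupledExt) (hX : X ∈ coupled)
    (hY : Y ∈ coupled) : pairing X (P1 A Y) = linearRBracket A X Y ∧
      pairing X (P2 A Y) = quadraticRBracket A X Y := by
  have h : ∀ a x y : PairRing, x ∈ coupledIdeal → y ∈ coupledIdeal →
      pairing (toPair x) (P1 (toPair a) (toPair y))
        = linearRBracket (toPair a) (toPair x) (toPair y) ∧
      pairing (toPair x) (P2 (toPair a) (toPair y))
        = quadraticRBracket (toPair a) (toPair x) (toPair y) := by
    intro a x y hx hy
    have hc : ∀ {z : PairRing}, z ∈ coupledIdeal → a * z - z * a ∈ coupledIdeal := fun hz =>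
      sub_mem (coupledIdeal_mul_left hz a) (coupledIdeal_mul_right hz a)
    have e : ∀ {z : PairRing}, z ∈ coupledIdeal → ∀ w, pairing (pairComm (toPair a) (toPair z))
        (Rmat (toPair w)) = pairTrace ((a * z - z * a) * (freeSklyanin.s w + freeSklyanin.δ w)) :=
      fun hz w => by
        rw [← pairing_toPair (coupledIdeal_mul_right (hc hz) _), toPair_skewR_add]
        rfl
    have e' : ∀ z, pairAnti (toPair a) (toPair z) = toPair (a * z + z * a) := fun _ => rfl
    constructor
    · rw [linearRBracket, e hx, e hy, ← toPair_freeSklyanin_linW,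
        pairing_toPair (coupledIdeal_mul_right hx _)]
      exact freeSklyanin.T_linW_eq (LinearMap.ext fun _ => map_zero diagPair) hx hy a
    · rw [quadraticRBracket, e', e', e hx, e hy, ← toPair_freeSklyanin_W,
        pairing_toPair (coupledIdeal_mul_right hx _)]
      exact freeSklyanin.T_W_eq (LinearMap.ext fun _ => map_zero diagPair) hx hy a
  exact h (⟨A.1, hA.1⟩, ⟨A.2, hA.2⟩) (ofCoupled ⟨X, hX⟩) (ofCoupled ⟨Y, hY⟩) hX hY

/-! ### Dirac reduction -/

variable {N M : ℕ}

theorem projU_eq_self {V : Pair} (hV : V ∈ tangent N M) : projU N M V = V :=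
  Prod.ext (lt_eq_self hV.1.2) (ge_eq_self hV.2.2)

theorem projU_add (V W : Pair) : projU N M (V + W) = projU N M V + projU N M W :=
  Prod.ext (lt_add _ _ _) (ge_add _ _ _)

theorem projV_add (V W : Pair) : projV N M (V + W) = projV N M V + projV N M W :=
  Prod.ext (ge_add _ _ _) (lt_add _ _ _)

theorem projV_eq_zero {V : Pair} (hV : V ∈ tangent N M) : projV N M V = 0 := by
  refine Prod.ext ?_ ?_
  · have h := lt_add_ge V.1 N
    rw [lt_eq_self hV.1.2, add_eq_left] at h
    exact h
  · have h := lt_add_ge V.2 (-M)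
    rw [ge_eq_self hV.2.2, add_eq_right] at h
    exact h

/-- A tangent vector has no transversal part and is its own projection, so both requirements follow
from one decomposition. -/
theorem isDiracReduction_of {P Pr : Pair → Pair → Pair}
    (h : ∀ A ∈ coset N M, ∀ X ∈ cotangent N M, Pr A X ∈ tangent N M ∧
      ∃ W ∈ cotangentCompl N M, Pr A X = P A X + P A W) : IsDiracReduction N M P Pr := by
  intro A hA X hX
  obtain ⟨hT, W, hW, hP⟩ := h A hA X hX
  refine ⟨W, hW, ?_, ?_⟩
  · have h' := projV_eq_zero hT
    rw [hP, projV_add, add_comm] at h'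
    exact eq_neg_of_add_eq_zero_left h'
  · rw [← projU_add, ← hP, projU_eq_self hT]

theorem isDiracReduction_P1 (hN : 0 < N) : IsDiracReduction N M P1 P1red :=
  -- P₁ is tangent already, so W = 0.
  isDiracReduction_of fun A hA X hX => ⟨P1red_mem_tangent hN hA hX, 0, zero_mem _, by
    have hA' := coset_subset_coupledExt hA
    have h0 : ∀ a : PairRing, freeSklyanin.linW a 0 = 0 := fun a => by
      have h : ∀ b, freeSklyanin.W b 0 = 0 := fun b => by
        simpa only [zero_smul] using freeSklyanin.W_smul 0 b 0
      rw [SklyaninData.linW_eq, h, h, sub_zero]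
    have h := toPair_freeSklyanin_linW (⟨A.1, hA'.1⟩, ⟨A.2, hA'.2⟩) 0
    rw [h0, map_zero] at h
    exact (add_eq_left.2 h.symm).symm⟩

/-- The covector `w Λ⁻ᴺ`. -/
noncomputable def transversal (N : ℕ) (w : ℤ → ℂ) : DiffOp := fun k => if k = -N then w else 0

theorem transversal_mem_degLT (N : ℕ) (w : ℤ → ℂ) : transversal N w ∈ degLT (-N + 1) :=
  mem_degLT.2 fun k hk n => by
    rw [show transversal N w k = 0 from if_neg (by omega)]
    rfl

/-- In degrees ≤ 0 with zero second component, the splitting is minus the identity except for the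
evenly shared diagonal, which appears in both components. -/
theorem skewR_of_mem_degLT {x : bddAboveOp} (hx : (x : DiffOp) ∈ degLT 1) :
    skewR (x, 0) = -(x, 0) + diagPair ((x : DiffOp) 0) := by
  have h1 : lowHalf (x : DiffOp) = x - (1 / 2 : ℂ) • diag ((x : DiffOp) 0) := by
    have h := lt_one_eq (x : DiffOp)
    rw [lt_eq_self hx] at h
    nth_rewrite 2 [h]
    rw [add_sub_cancel_right]
  have h2 : highHalf (x : DiffOp) = (1 / 2 : ℂ) • diag ((x : DiffOp) 0) := by
    have h := lowHalf_add_highHalf (x : DiffOp)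
    rw [h1] at h
    rw [eq_sub_of_add_eq' h, sub_sub_cancel]
  refine toPair_injective (Prod.ext ?_ ?_)
  · change (x : DiffOp) - (2 : ℂ) • lowHalf (x + 0) = -(x : DiffOp) + diag ((x : DiffOp) 0)
    rw [add_zero, h1]
    module
  · change -(0 : DiffOp) + (2 : ℂ) • highHalf (x + 0) = -(0 : DiffOp) + diag ((x : DiffOp) 0)
    rw [add_zero, h2]
    module

/-- Both Ax and xA, for x = wΛ⁻ᴺ, have degrees ≤ 0, with residues w(n + N) and w(n). By
`skewR_of_mem_degLT` the terms ∓½AxA cancel, and both multipliers become the same function, half the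
sum of the residues. -/
theorem P2_transversal {A : Pair} (hA : A ∈ coset N M) (w : ℤ → ℂ) :
    P2 A (transversal N w, 0) = pairComm (diag fun n => (1 / 2 : ℂ) * (w n + w (n + N)),
      diag fun n => (1 / 2 : ℂ) * (w n + w (n + N))) A := by
  have hA' := coset_subset_coupledExt hA
  let a : PairRing := (⟨A.1, hA'.1⟩, ⟨A.2, hA'.2⟩)
  let x : bddAboveOp := ⟨transversal N w, _, transversal_mem_degLT N w⟩
  have dA := coset_fst_mem_degLT hA
  have dx := transversal_mem_degLT N w
  have d1 : ((a.1 * x : bddAboveOp) : DiffOp) ∈ degLT 1 := by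
    have h := mul_mem_degLT dA dx
    rwa [show (N : ℤ) + -N + 1 = 1 by ring] at h
  have d2 : ((x * a.1 : bddAboveOp) : DiffOp) ∈ degLT 1 := by
    have h := mul_mem_degLT dx dA
    rwa [show -(N : ℤ) + N + 1 = 1 by ring] at h
  have hx : transversal N w (-N) = w := if_pos rfl
  have r1 : ((a.1 * x : bddAboveOp) : DiffOp) 0 = fun n => w (n + N) := by
    funext n
    have h := mul_apply_top dA dx n
    rw [add_neg_cancel, coset_fst_apply hA le_rfl, if_pos rfl, one_mul, hx] at h
    exact h
  have r2 : ((x * a.1 : bddAboveOp) : DiffOp) 0 = w := by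
    funext n
    have h := mul_apply_top dx dA n
    rw [neg_add_cancel, coset_fst_apply hA le_rfl, if_pos rfl, mul_one, hx] at h
    exact h
  have e1 : a * (x, 0) = (a.1 * x, 0) := Prod.ext rfl (mul_zero _)
  have e2 : (x, 0) * a = (x * a.1, 0) := Prod.ext rfl (zero_mul _)
  have s1 : resSum (a.1 * x, 0) = fun n => w (n + N) := (add_zero _).trans r1
  have s2 : resSum (x * a.1, 0) = w := (add_zero _).trans r2
  have hd : (fun n => (1 / 2 : ℂ) * (w n + w (n + N)))
      = (1 / 2 : ℂ) • w + (1 / 2 : ℂ) • fun n => w (n + N) := by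
    funext n
    simp only [Pi.add_apply, Pi.smul_apply, smul_eq_mul]
    ring
  have h := P2_eq a (x, 0)
  have key : ((1 / 2 : ℂ) • skewR (a * (x, 0)) + (1 / 2 : ℂ) • diagPair (resSum ((x, 0) * a))) * a
        - a * ((1 / 2 : ℂ) • skewR ((x, 0) * a) + (1 / 2 : ℂ) • diagPair (resSum (a * (x, 0))))
      = diagPair (fun n => (1 / 2 : ℂ) * (w n + w (n + N))) * a
        - a * diagPair fun n => (1 / 2 : ℂ) * (w n + w (n + N)) := by
    have e3 : (a.1 * x, (0 : bddBelowOp)) * a = a * (x * a.1, 0) := by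
      rw [← e1, ← e2, mul_assoc]
    rw [e1, e2, skewR_of_mem_degLT d1, skewR_of_mem_degLT d2, s1, s2, r1, r2, hd, map_add,
      map_smul, map_smul]
    simp only [add_mul, mul_add, smul_mul_assoc, mul_smul_comm, neg_mul, mul_neg, e3]
    module
  rw [key] at h
  exact h

theorem isDiracReduction_P2corr {inv : (ℤ → ℂ) → (ℤ → ℂ)}
    (hinv : ∀ g ∈ finFun, ∀ n, inv g n - inv g (n + N) = g n) :
    IsDiracReduction N M P2 (P2corr inv N) :=
  isDiracReduction_of fun A hA X hX => by
    refine ⟨P2corr_mem_tangent hinv hA (cotangent_le_coupled hX),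
      -- Half of (1 + Λᴺ) applied to this w is -f, so P₂(W) is the correction -([f, A], [f, Â]). Its
      -- coefficients need not have finite support.
      (transversal N (-inv (⁅X.1, A.1⁆ + ⁅X.2, A.2⁆ : DiffOp).res), 0),
      ⟨⟨⟨_, transversal_mem_degLT N _⟩, transversal_mem_degLT N _⟩, zero_mem _⟩, ?_⟩
    have h : (fun n : ℤ => (1 / 2 : ℂ) * ((-inv (⁅X.1, A.1⁆ + ⁅X.2, A.2⁆ : DiffOp).res) n
        + (-inv (⁅X.1, A.1⁆ + ⁅X.2, A.2⁆ : DiffOp).res) (n + N)))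
        = (-1 : ℂ) • corrFun inv N A X := by
      funext n
      simp only [corrFun, Pi.neg_apply, Pi.smul_apply, smul_eq_mul]
      ring
    rw [P2_transversal hA, h, pairComm_diag_smul, neg_one_smul, ← sub_eq_add_neg]
    rfl

end Toda

theorem mainTheorem4 (N M : ℕ) (hN : 0 < N) (hM : 0 < M) :
    -- the two compatible Poisson structures on the coset
    Toda.CompatiblePoisson N M Toda.IsFunctional Toda.P1red (Toda.P2red N) ∧
    -- with the one-sided expansion: the antisymmetric part is the same for all `N`,
    -- the tensor is the same for `N = 1`, and the restriction to invariant functionals is Poisson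
    (∀ A ∈ Toda.coset N M, ∀ X ∈ Toda.cotangent N M, ∀ Y ∈ Toda.cotangent N M,
      Toda.pairing X (Toda.P2red N A Y) =
        (1 / 2 : ℂ) * (Toda.pairing X (Toda.P2redForward N A Y)
          - Toda.pairing Y (Toda.P2redForward N A X))) ∧
    (N = 1 → ∀ A ∈ Toda.coset N M, ∀ X ∈ Toda.cotangent N M,
      Toda.P2redForward N A X = Toda.P2red N A X) ∧
    Toda.CompatiblePoisson N M Toda.IsPeriodicInvariant Toda.P1red (Toda.P2redForward N) ∧
    -- the brackets come from the `R`-matrix brackets on `ℰ⁻ × ℰ⁺`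
    (∀ A ∈ Toda.coupledExt, ∀ X ∈ Toda.coupled, ∀ Y ∈ Toda.coupled,
      Toda.pairing X (Toda.P1 A Y) = Toda.linearRBracket A X Y ∧
      Toda.pairing X (Toda.P2 A Y) = Toda.quadraticRBracket A X Y) ∧
    -- by Dirac reduction
    Toda.IsDiracReduction N M Toda.P1 Toda.P1red ∧
    Toda.IsDiracReduction N M Toda.P2 (Toda.P2red N) ∧
    Toda.IsDiracReduction N M Toda.P2 (Toda.P2redForward N) := by
  refine ⟨Toda.compatiblePoisson_reduced hN,
    fun A hA X hX Y hY => Toda.P2red_eq_skew_part hN hA hX hY, ?_,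
    Toda.compatiblePoisson_forward hN,
    fun A hA X hX Y hY => Toda.pairing_eq_rBrackets hA hX hY,
    Toda.isDiracReduction_P1 hN,
    Toda.isDiracReduction_P2corr fun _ hg => Toda.invSym_sub_shift hN hg,
    Toda.isDiracReduction_P2corr fun _ hg => Toda.invForward_sub_shift hN hg⟩
  rintro rfl A hA X hX
  exact Toda.P2redForward_eq_P2red hA hX
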